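/- Let $$z(w)=\frac13\Big(\frac1w+\frac1{w-1}+\frac1{w+1}\Big),\qquad w_k=3^{-1/4}\,\omega_8^{-2k-1},\quad \omega_8=e^{2\pi i/8},\qquad z_k=z(w_k)\quad(k=1,2,3,4).$$ Let $\Gamma_P$ be a simple regular $C^1$ arc (regular up to and including its end points) in the open left half-plane, oriented from $z_1$ to $z_2$, and let $\Gamma_R$ be a simple regular $C^1$ arc in the open right half-plane, oriented from $z_3$ to $z_4$ (for instance, the trajectories $\frac{3}{2\pi i}\int_{z_1}^z(\psi_Q-\psi_P)_+(s)\,ds\in\mathbb R$, $z\in\Gamma_P$, and $\frac{3}{2\pi i}\int_{z_3}^z(\psi_Q-\psi_R)_+(s)\,ds\in\mathbb R$, $z\in\Gamma_R$, in these half-planes). The $+$-side (resp. $-$-side) of an oriented arc is its left (resp. right) side, and subscripts $\pm$ denote limiting values from these sides at the interior points of the arc. Let $\mathcal R$ be the Riemann surface of the inverse of $z(w)$ with sheets $\mathcal R_P,\mathcal R_Q,\mathcal R_R$, where $\mathcal R_P,\mathcal R_Q$ are glued crosswise along $\Gamma_P$ and $\mathcal R_Q,\mathcal R_R$ are glued crosswise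 along $\Gamma_R$, and let $\psi_P,\psi_Q,\psi_R$ be the restrictions to the sheets of the inverse $\psi:\mathcal R\to\overline{\mathbb C}$ of $z(w)$. Thus they are the three solutions of $zw^3-w^2-zw+\frac13=0$, they are analytic in $\mathbb C\setminus\Gamma_P$, $\mathbb C\setminus(\Gamma_P\cup\Gamma_R\cup\{0\})$, $\mathbb C\setminus\Gamma_R$ respectively, with $\psi_P(\infty)=-1$, $\psi_Q(\infty)=0$, $\psi_R(\infty)=1$, $\psi_{P\pm}=\psi_{Q\mp}$ on $\Gamma_P$ and $\psi_{R\pm}=\psi_{Q\mp}$ on $\Gamma_R$; $\psi_Q(0)=\infty$. Let $\sqrt{3w^4+1}$ be the branch that is analytic in $\mathbb C\setminus(\psi_{P+}(\Gamma_P)\cup\psi_{R+}(\Gamma_R))$ (closed arcs, with end points $w_1,w_2$ and $w_3,w_4$) and positive for large positive $w$. Define $$\widetilde G(w)=\begin{cases}\frac1w\,e^{\frac{(w+1)(2w-1)}{w(w-1)}}, & w\in\psi(\mathcal R_P),\\[4pt] \frac{w^2-1}{w^2-1/3}\,e^{\frac{2w^2}{w^2-1}}, & w\in\psi(\mathcal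 R_Q),\\[4pt] \frac1w\,e^{\frac{(w-1)(2w+1)}{w(w+1)}}, & w\in\psi(\mathcal R_R),\end{cases}$$ $$\widetilde F_1(w)=\frac{-w(w-1)\widetilde G(w)}{\sqrt{3w^4+1}},\qquad \widetilde F_2(w)=\frac{(w^2-1)\widetilde G(w)}{3\sqrt{3w^4+1}},\qquad \widetilde F_3(w)=\frac{w(w+1)\widetilde G(w)}{\sqrt{3w^4+1}}.$$ Then the matrix-valued function $$\widetilde N(z)=\begin{pmatrix}\widetilde F_1(\psi_P(z))&\widetilde F_1(\psi_Q(z))&\widetilde F_1(\psi_R(z))\\ \widetilde F_2(\psi_P(z))&\widetilde F_2(\psi_Q(z))&\widetilde F_2(\psi_R(z))\\ \widetilde F_3(\psi_P(z))&\widetilde F_3(\psi_Q(z))&\widetilde F_3(\psi_R(z))\end{pmatrix}$$ (where $\widetilde F_i(\psi_Q(0))=\widetilde F_i(\infty)$ is understood as the limit) solves the following Riemann–Hilbert problem: 1. $\widetilde N$ is analytic in $\mathbb C\setminus(\Gamma_P\cup\Gamma_R)$. 2. $\widetilde N$ has limiting values $\widetilde N_\pm$ at the interior points of $\Gamma_P$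 and $\Gamma_R$, and $$\widetilde N_+(z)=\widetilde N_-(z)\begin{pmatrix}0&z^{-1}e^{-3z}&0\\-ze^{3z}&0&0\\0&0&1\end{pmatrix}\ (z\in\Gamma_P),\qquad \widetilde N_+(z)=\widetilde N_-(z)\begin{pmatrix}1&0&0\\0&0&-ze^{-3z}\\0&z^{-1}e^{3z}&0\end{pmatrix}\ (z\in\Gamma_R).$$ 3. $\widetilde N(z)=I+O(1/z)$ as $z\to\infty$. -/

import Mathlib

open Filter Topology Asymptotics

noncomputable section

namespace HermitePadeRH

/-- The rational function `z(w) = (1/3) (1/w + 1/(w-1) + 1/(w+1))`, whose inverse lives on the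
three-sheeted Riemann surface. -/
def zOf (w : ℂ) : ℂ := (1 / 3) * (1 / w + 1 / (w - 1) + 1 / (w + 1))

/-- The critical points `w_k = 3^{-1/4} ω₈^{-2k-1}`, `ω₈ = e^{2πi/8}`, for `k = 1, 2, 3, 4`. -/
def critW (k : ℕ) : ℂ :=
  (((3 : ℝ) ^ (-(1 / 4) : ℝ) : ℝ) : ℂ) *
    Complex.exp (2 * (Real.pi : ℂ) * Complex.I / 8) ^ (-(2 * (k : ℤ)) - 1)

/-- The branch points `z_k = z(w_k)`. -/
def branchZ (k : ℕ) : ℂ := zOf (critW k)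

/-- `γ`, restricted to `[0,1]`, is a simple regular `C¹` arc from `a` to `b`
(regular up to and including the end points). -/
structure IsArc (γ : ℝ → ℂ) (a b : ℂ) : Prop where
  contDiffOn : ContDiffOn ℝ 1 γ (Set.Icc 0 1)
  regular : ∀ t ∈ Set.Icc (0 : ℝ) 1, derivWithin γ (Set.Icc 0 1) t ≠ 0
  injOn : Set.InjOn γ (Set.Icc 0 1)
  source : γ 0 = a
  target : γ 1 = b

/-- The set of points of an arc, end points included. -/
def trace (γ : ℝ → ℂ) : Set ℂ := γ '' Set.Icc 0 1

/-- For an interior parameter `t` of a regular `C¹` arc `γ`, the filter of the points close to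
`γ t` and strictly on its left-hand side, the `+`-side: near `(t, 0)` the map
`(τ, ε) ↦ γ τ + ε i γ'(t)` is a homeomorphism onto a neighbourhood of `γ t`, which takes `ε = 0`
to the arc and `ε > 0` to its left-hand side. (Limits along it need not be non-tangential.) -/
def plusSide (γ : ℝ → ℂ) (t : ℝ) : Filter ℂ :=
  Filter.map
    (fun p : ℝ × ℝ => γ p.1 + (p.2 : ℂ) * (Complex.I * derivWithin γ (Set.Icc 0 1) t))
    (𝓝 t ×ˢ 𝓝[>] (0 : ℝ))

/-- The same for the right-hand side, the `-`-side. -/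
def minusSide (γ : ℝ → ℂ) (t : ℝ) : Filter ℂ :=
  Filter.map
    (fun p : ℝ × ℝ => γ p.1 - (p.2 : ℂ) * (Complex.I * derivWithin γ (Set.Icc 0 1) t))
    (𝓝 t ×ˢ 𝓝[>] (0 : ℝ))

/-- Two sheets are glued crosswise along the arc `γ`: the function given by `f` on one sheet and
by `g` on the other one extends continuously across the cut, `f₊ = g₋` and `g₊ = f₋`. -/
def GluedAlong (γ : ℝ → ℂ) (f g : ℂ → ℂ) : Prop :=
  ∀ t ∈ Set.Ioo (0 : ℝ) 1,
    (∃ a, Tendsto f (plusSide γ t) (𝓝 a) ∧ Tendsto g (minusSide γ t) (𝓝 a)) ∧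
    (∃ b, Tendsto g (plusSide γ t) (𝓝 b) ∧ Tendsto f (minusSide γ t) (𝓝 b))

/-- `ψP, ψQ, ψR` are the restrictions to the three sheets `P, Q, R` of the inverse of `z(w)`, for
the Riemann surface with sheets `P, Q` glued along `γP` and sheets `Q, R` glued along `γR`: they
are analytic on their sheets (`ψQ` has a pole at `z = 0`), they are the three solutions of
`z w³ - w² - z w + 1/3 = 0`, and they take the values `-1, 0, 1` at infinity. -/
structure IsSheets (γP γR : ℝ → ℂ) (ψP ψQ ψR : ℂ → ℂ) : Prop where
  analyticP : AnalyticOnNhd ℂ ψP (trace γP)ᶜ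
  analyticQ : AnalyticOnNhd ℂ ψQ (trace γP ∪ trace γR ∪ {0})ᶜ
  analyticR : AnalyticOnNhd ℂ ψR (trace γR)ᶜ
  roots : ∀ z ∉ trace γP ∪ trace γR, z ≠ 0 → ∀ w : ℂ,
    z * w ^ 3 - w ^ 2 - z * w + 1 / 3 = 0 ↔ w = ψP z ∨ w = ψQ z ∨ w = ψR z
  inftyP : Tendsto ψP (Bornology.cobounded ℂ) (𝓝 (-1))
  inftyQ : Tendsto ψQ (Bornology.cobounded ℂ) (𝓝 0)
  inftyR : Tendsto ψR (Bornology.cobounded ℂ) (𝓝 1)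
  glueP : GluedAlong γP ψP ψQ
  glueR : GluedAlong γR ψR ψQ

/-- The curve `ψ₊(Γ)` of the `+`-boundary values of `ψ` on the arc `γ`, with its end points
`a`, `b` (the images of the two branch points). -/
def plusImage (γ : ℝ → ℂ) (ψ : ℂ → ℂ) (a b : ℂ) : Set ℂ :=
  {w | ∃ t ∈ Set.Ioo (0 : ℝ) 1, Tendsto ψ (plusSide γ t) (𝓝 w)} ∪ {a, b}

/-- `s` is the branch of `√(3w⁴+1)` that is analytic off `ψ_{P+}(Γ_P) ∪ ψ_{R+}(Γ_R)` and positive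
for large positive `w`. -/
structure IsSqrtBranch (γP γR : ℝ → ℂ) (ψP ψR : ℂ → ℂ) (s : ℂ → ℂ) : Prop where
  analytic : AnalyticOnNhd ℂ s
    (plusImage γP ψP (critW 1) (critW 2) ∪ plusImage γR ψR (critW 3) (critW 4))ᶜ
  sq : ∀ w ∉ plusImage γP ψP (critW 1) (critW 2) ∪ plusImage γR ψR (critW 3) (critW 4),
    s w ^ 2 = 3 * w ^ 4 + 1
  pos : ∀ᶠ x : ℝ in atTop, ∃ r : ℝ, 0 < r ∧ s (x : ℂ) = (r : ℂ)

/-- The finite part of the image of the sheet `P`; the point `-1` is the image of infinity. -/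
def imageP (γP : ℝ → ℂ) (ψP : ℂ → ℂ) : Set ℂ := ψP '' (trace γP)ᶜ ∪ {-1}

/-- The finite part of the image of the sheet `Q` (the point `z = 0` is mapped to infinity);
the point `0` is the image of infinity. -/
def imageQ (γP γR : ℝ → ℂ) (ψQ : ℂ → ℂ) : Set ℂ :=
  ψQ '' (trace γP ∪ trace γR ∪ {0})ᶜ ∪ {0}

/-- The finite part of the image of the sheet `R`; the point `1` is the image of infinity. -/
def imageR (γR : ℝ → ℂ) (ψR : ℂ → ℂ) : Set ℂ := ψR '' (trace γR)ᶜ ∪ {1}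

open Classical in
/-- The piecewise function `G̃` (given the value `0` off the three disjoint images). -/
def Gt (γP γR : ℝ → ℂ) (ψP ψQ ψR : ℂ → ℂ) (w : ℂ) : ℂ :=
  if w ∈ imageP γP ψP then
    (1 / w) * Complex.exp ((w + 1) * (2 * w - 1) / (w * (w - 1)))
  else if w ∈ imageQ γP γR ψQ then
    ((w ^ 2 - 1) / (w ^ 2 - 1 / 3)) * Complex.exp (2 * w ^ 2 / (w ^ 2 - 1))
  else if w ∈ imageR γR ψR then
    (1 / w) * Complex.exp ((w - 1) * (2 * w + 1) / (w * (w + 1)))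
  else 0

/-- `F̃₁, F̃₂, F̃₃` built from the branch `s` of `√(3w⁴+1)` and the function `G = G̃`. -/
def Ft (s G : ℂ → ℂ) (w : ℂ) : Fin 3 → ℂ :=
  ![-w * (w - 1) * G w / s w, (w ^ 2 - 1) * G w / (3 * s w), w * (w + 1) * G w / s w]

/-- The jump matrix on `Γ_P`. -/
def jumpP (z : ℂ) : Matrix (Fin 3) (Fin 3) ℂ :=
  !![0, z⁻¹ * Complex.exp (-3 * z), 0;
     -z * Complex.exp (3 * z), 0, 0;
     0, 0, 1]

/-- The jump matrix on `Γ_R`. -/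
def jumpR (z : ℂ) : Matrix (Fin 3) (Fin 3) ℂ :=
  !![1, 0, 0;
     0, 0, -z * Complex.exp (-3 * z);
     0, z⁻¹ * Complex.exp (3 * z), 0]

/-- `N₊ = N₋ J` on the (open) arc `γ`, the boundary values being part of the claim. -/
def HasJump (γ : ℝ → ℂ) (J : ℂ → Matrix (Fin 3) (Fin 3) ℂ)
    (N : ℂ → Matrix (Fin 3) (Fin 3) ℂ) : Prop :=
  ∀ t ∈ Set.Ioo (0 : ℝ) 1, ∃ Np Nm : Matrix (Fin 3) (Fin 3) ℂ,
    Tendsto N (plusSide γ t) (𝓝 Np) ∧ Tendsto N (minusSide γ t) (𝓝 Nm) ∧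
      Np = Nm * J (γ t)

/-- `N` solves the Riemann–Hilbert problem of the outer parametrix. -/
structure SolvesRH (γP γR : ℝ → ℂ) (N : ℂ → Matrix (Fin 3) (Fin 3) ℂ) : Prop where
  analytic : ∀ i j, AnalyticOnNhd ℂ (fun z => N z i j) (trace γP ∪ trace γR)ᶜ
  jump_P : HasJump γP jumpP N
  jump_R : HasJump γR jumpR N
  infty : ∀ i j, (fun z => N z i j - (1 : Matrix (Fin 3) (Fin 3) ℂ) i j)
    =O[Bornology.cobounded ℂ] fun z => z⁻¹

end HermitePadeRH

end

/-! The three sheets are, at each `z` off the cuts, the three distinct roots of the cubic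
`z w³ - w² - z w + 1/3`, and two sheets have the same boundary values, interchanged, on the two
sides of a cut. Since the formulas for `G̃` satisfy `G_P = z e^{3z} G_Q` and
`G_R = z e^{-3z} G_Q` at every root (`GP_eq`, `GR_eq`), the jump relations only say that
`√(3w⁴+1)` changes sign across the slit formed by the `+`-boundary values of a cut
(`Config.exists_boundaryValues_neg`). Its square is continuous there, so the quotient of its two
boundary values is `±1`, and constant along the cut by connectedness. Near an end point of the cut
the square root behaves like a fourth root of `z - z₁`, hence is multiplied by nearly `i` when `z`
turns once around `z₁` on a small circle (`IsArc.tendsto_boundaryValue_ratio`); turning once on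
each of the two sheets returns to the starting point on the other side of the slit and gives
the factor `-1`.

The normalization at infinity amounts to `√(3w⁴+1)` being `-1` at `w = 0` and `2` at `w = ±1`.
The imaginary axis misses the slits, and comparing `√(3w⁴+1)` with `√3 w²` along it gives the value
at `0` (`Config.sqrt_zero`). At `-1` the sign depends on the side of the cut on which the slit lies.
On `Re z < 0` the product of the square roots on the sheets `P`, `Q` equals, up to a factor `ε = ±1`,
an explicit expression in the roots, where `√(3ψ_R⁴+1)` is the principal branch; the expression
changes sign across the cut just as the product does, so that `ε` is constant
(`Config.exists_sign`). At infinity one reads off the value `2ε`, and at `z₁` a comparison with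
the factor `i` above, whose sign is that of the orientation, gives `ε = 1` (`Config.sqrt_neg_one`).
The symmetry `z ↦ -z`, `w ↦ -w` interchanges the two cuts (`Config.neg`) and yields the value at
`1` and the jump on the right arc.

The second column is analytic at `z = 0` because `ψ_Q` has a pole there and the entries have
limits as `w → ∞`. -/

noncomputable section

namespace HermitePadeRH

/-! ### Regular arcs and their two sides -/

/-- The velocity `γ'(t)` of an arc, one-sided at the end points. -/
abbrev velocity (γ : ℝ → ℂ) (t : ℝ) : ℂ := derivWithin γ (Set.Icc 0 1) t

/-- The chart `(τ, ε) ↦ γ τ + ε i γ'(t)` around the interior point `γ t` of an arc; positive `ε`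
correspond to the left-hand side. -/
def collar (γ : ℝ → ℂ) (t : ℝ) (p : ℝ × ℝ) : ℂ :=
  γ p.1 + (p.2 : ℂ) * (Complex.I * velocity γ t)

theorem plusSide_eq (γ : ℝ → ℂ) (t : ℝ) :
    plusSide γ t = map (collar γ t) (𝓝 t ×ˢ 𝓝[>] (0 : ℝ)) := rfl

theorem minusSide_eq (γ : ℝ → ℂ) (t : ℝ) :
    minusSide γ t = map (collar γ t) (𝓝 t ×ˢ 𝓝[<] (0 : ℝ)) := by
  have : (𝓝[<] (0 : ℝ)) = map (fun x : ℝ => -x) (𝓝[>] (0 : ℝ)) := by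
    simp
  rw [this, ← Filter.map_id (f := 𝓝 t), Filter.prod_map_map_eq, Filter.map_map]
  refine Filter.map_congr (Eventually.of_forall fun p => ?_)
  simp [collar, sub_eq_add_neg]

instance plusSide_neBot (γ : ℝ → ℂ) (t : ℝ) : (plusSide γ t).NeBot := by
  rw [plusSide_eq]; infer_instance

instance minusSide_neBot (γ : ℝ → ℂ) (t : ℝ) : (minusSide γ t).NeBot := by
  rw [minusSide_eq]; infer_instance

/-- The real-linear equivalence `(x, y) ↦ (x + i y) d`. -/
def frame (d : ℂ) (hd : d ≠ 0) : (ℝ × ℝ) ≃L[ℝ] ℂ :=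
  Complex.equivRealProdCLM.symm.trans (ContinuousLinearEquiv.unitsEquivAut ℂ (Units.mk0 d hd)
    |>.restrictScalars ℝ)

theorem frame_apply (d : ℂ) (hd : d ≠ 0) (p : ℝ × ℝ) :
    frame d hd p = (p.1 : ℂ) * d + (p.2 : ℂ) * (Complex.I * d) := by
  have : Complex.equivRealProdCLM.symm p = (p.1 : ℂ) + (p.2 : ℂ) * Complex.I := by
    apply Complex.ext <;> simp
  simp only [frame, ContinuousLinearEquiv.trans_apply, this,
    ContinuousLinearEquiv.restrictScalars_apply, ContinuousLinearEquiv.unitsEquivAut_apply,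
    Units.val_mk0]
  ring

theorem frame_symm_snd (d : ℂ) (hd : d ≠ 0) (z : ℂ) : ((frame d hd).symm z).2 = (z / d).im := by
  obtain ⟨p, rfl⟩ := (frame d hd).surjective z
  rw [ContinuousLinearEquiv.symm_apply_apply, frame_apply, add_div, mul_div_assoc,
    div_self hd, ← mul_assoc, mul_div_assoc, div_self hd]
  simp

section Arc

variable {γ : ℝ → ℂ} {a b : ℂ} {t : ℝ}

theorem IsArc.continuousOn (h : IsArc γ a b) : ContinuousOn γ (Set.Icc 0 1) :=
  h.contDiffOn.continuousOn

theorem IsArc.isCompact_trace (h : IsArc γ a b) : IsCompact (trace γ) :=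
  isCompact_Icc.image_of_continuousOn h.continuousOn

theorem IsArc.isClosed_trace (h : IsArc γ a b) : IsClosed (trace γ) :=
  h.isCompact_trace.isClosed

theorem IsArc.dense_compl_trace (h : IsArc γ a b) : Dense (trace γ)ᶜ := by
  refine h.contDiffOn.dense_compl_image_of_dimH_lt_finrank (convex_Icc 0 1) le_rfl ?_
  refine (dimH_mono (Set.subset_univ _)).trans_lt ?_
  rw [Real.dimH_univ_eq_finrank ℝ, Complex.finrank_real_complex, Module.finrank_self]
  norm_num

theorem mem_trace (ht : t ∈ Set.Icc (0 : ℝ) 1) : γ t ∈ trace γ := ⟨t, ht, rfl⟩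

theorem IsArc.hasStrictDerivAt (h : IsArc γ a b) (ht : t ∈ Set.Ioo (0 : ℝ) 1) :
    HasStrictDerivAt γ (velocity γ t) t := by
  have hn : Set.Icc (0 : ℝ) 1 ∈ 𝓝 t := Icc_mem_nhds ht.1 ht.2
  rw [velocity, derivWithin_of_mem_nhds hn]
  exact (h.contDiffOn.contDiffAt hn).hasStrictDerivAt (by simp)

theorem IsArc.velocity_ne_zero (h : IsArc γ a b) (ht : t ∈ Set.Ioo (0 : ℝ) 1) :
    velocity γ t ≠ 0 :=
  h.regular t (Set.Ioo_subset_Icc_self ht)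

theorem IsArc.continuousAt (h : IsArc γ a b) (ht : t ∈ Set.Ioo (0 : ℝ) 1) : ContinuousAt γ t :=
  (h.hasStrictDerivAt ht).hasDerivAt.continuousAt

theorem IsArc.continuousOn_velocity (h : IsArc γ a b) :
    ContinuousOn (velocity γ) (Set.Icc 0 1) :=
  h.contDiffOn.continuousOn_derivWithin (uniqueDiffOn_Icc zero_lt_one) (by simp)

theorem collar_zero (γ : ℝ → ℂ) (t τ : ℝ) : collar γ t (τ, 0) = γ τ := by simp [collar]

theorem IsArc.hasStrictFDerivAt_collar (h : IsArc γ a b) (ht : t ∈ Set.Ioo (0 : ℝ) 1) :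
    HasStrictFDerivAt (collar γ t)
      (frame (velocity γ t) (h.velocity_ne_zero ht) : (ℝ × ℝ) →L[ℝ] ℂ) (t, 0) := by
  have h1 : HasStrictFDerivAt (fun p : ℝ × ℝ => γ p.1)
      ((ContinuousLinearMap.toSpanSingleton ℝ (velocity γ t)).comp
        (ContinuousLinearMap.fst ℝ ℝ ℝ)) (t, 0) :=
    (h.hasStrictDerivAt ht).hasStrictFDerivAt.comp (t, (0 : ℝ)) hasStrictFDerivAt_fst
  have h2 : HasStrictFDerivAt (fun p : ℝ × ℝ => (p.2 : ℂ) * (Complex.I * velocity γ t))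
      ((ContinuousLinearMap.toSpanSingleton ℝ (Complex.I * velocity γ t)).comp
        (ContinuousLinearMap.snd ℝ ℝ ℝ)) (t, 0) := by
    refine (ContinuousLinearMap.hasStrictFDerivAt _).congr_of_eventuallyEq
      (Eventually.of_forall fun p => ?_)
    simp
  refine (h1.add h2).congr_fderiv ?_
  ext <;> simp [frame_apply]

/-- The collar is a local homeomorphism. The second component of its local inverse `e` measures
the signed distance from the arc: along a curve through `γ t` with velocity `v`, its derivative is
`Im (v / γ'(t))`. -/
theorem IsArc.exists_chart (h : IsArc γ a b) (ht : t ∈ Set.Ioo (0 : ℝ) 1) :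
    ∃ e : ℂ → ℝ × ℝ, e (γ t) = (t, 0) ∧ ContinuousAt e (γ t) ∧
      (∀ᶠ p in 𝓝 (t, (0 : ℝ)), e (collar γ t p) = p) ∧
      (∀ᶠ z in 𝓝 (γ t), collar γ t (e z) = z) ∧
      ∀ (z : ℝ → ℂ) (v : ℂ), HasDerivAt z v 0 → z 0 = γ t →
        HasDerivAt (fun θ => (e (z θ)).2) (v / velocity γ t).im 0 := by
  have hs := h.hasStrictFDerivAt_collar ht
  have hz : collar γ t (t, 0) = γ t := collar_zero γ t t
  refine ⟨hs.localInverse, ?_, ?_, hs.eventually_left_inverse, ?_, ?_⟩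
  · have := hs.localInverse_apply_image
    rwa [hz] at this
  · have := hs.localInverse_continuousAt
    rwa [hz] at this
  · have := hs.eventually_right_inverse
    rwa [hz] at this
  · intro z v hzv hz0
    have h1 := hs.to_localInverse.hasFDerivAt
    rw [hz, ← hz0] at h1
    have h2 := (hasFDerivAt_snd (𝕜 := ℝ) (E := ℝ) (F := ℝ)
      (p := hs.localInverse (collar γ t) _ _ (z 0))).comp (z 0) h1
    have h3 := h2.comp_hasDerivAt (0 : ℝ) hzv
    refine h3.congr_deriv ?_
    rw [← frame_symm_snd _ (h.velocity_ne_zero ht)]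
    rfl

/-- A curve crossing the arc at `γ t` from right to left arrives on the `+`-side. -/
theorem IsArc.tendsto_sides (h : IsArc γ a b) (ht : t ∈ Set.Ioo (0 : ℝ) 1) {z : ℝ → ℂ} {v : ℂ}
    (hz : HasDerivAt z v 0) (hz0 : z 0 = γ t) (hv : 0 < (v / velocity γ t).im) :
    Tendsto z (𝓝[>] 0) (plusSide γ t) ∧ Tendsto z (𝓝[<] 0) (minusSide γ t) := by
  obtain ⟨e, he0, hec, -, her, hed⟩ := h.exists_chart ht
  have hd := hed z v hz hz0
  have hsign := eventually_nhdsWithin_sign_eq_of_deriv_pos (f := fun θ => (e (z θ)).2)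
    (x₀ := 0) (by rw [hd.deriv]; exact hv) (by simp [hz0, he0])
  have hzc : Tendsto z (𝓝 0) (𝓝 (γ t)) := hz0 ▸ hz.continuousAt
  have hecz : Tendsto (fun θ => e (z θ)) (𝓝 0) (𝓝 (t, 0)) := he0 ▸ hec.tendsto.comp hzc
  have h1 : Tendsto (fun θ => (e (z θ)).1) (𝓝 0) (𝓝 t) := (continuous_fst.tendsto _).comp hecz
  have h2 : Tendsto (fun θ => (e (z θ)).2) (𝓝 0) (𝓝 0) := (continuous_snd.tendsto _).comp hecz
  have hinv : ∀ᶠ θ in 𝓝 (0 : ℝ), collar γ t (e (z θ)) = z θ := hzc.eventually her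
  constructor
  · rw [plusSide_eq]
    have hp : Tendsto (fun θ => e (z θ)) (𝓝[>] 0) (𝓝 t ×ˢ 𝓝[>] (0 : ℝ)) := by
      refine Tendsto.prodMk (f := 𝓝[>] (0 : ℝ)) (h1.mono_left nhdsWithin_le_nhds)
        (tendsto_nhdsWithin_iff.2 ⟨h2.mono_left nhdsWithin_le_nhds, ?_⟩)
      filter_upwards [nhdsWithin_le_nhds hsign, self_mem_nhdsWithin] with θ hθ hθ0
      rw [sub_zero, sign_pos (Set.mem_Ioi.1 hθ0), sign_eq_one_iff] at hθ
      exact hθ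
    refine (tendsto_map.comp hp).congr' ?_
    filter_upwards [nhdsWithin_le_nhds hinv] with θ hθ using hθ
  · rw [minusSide_eq]
    have hp : Tendsto (fun θ => e (z θ)) (𝓝[<] 0) (𝓝 t ×ˢ 𝓝[<] (0 : ℝ)) := by
      refine Tendsto.prodMk (f := 𝓝[<] (0 : ℝ)) (h1.mono_left nhdsWithin_le_nhds)
        (tendsto_nhdsWithin_iff.2 ⟨h2.mono_left nhdsWithin_le_nhds, ?_⟩)
      filter_upwards [nhdsWithin_le_nhds hsign, self_mem_nhdsWithin] with θ hθ hθ0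
      rw [sub_zero, sign_neg (Set.mem_Iio.1 hθ0), sign_eq_neg_one_iff] at hθ
      exact hθ
    refine (tendsto_map.comp hp).congr' ?_
    filter_upwards [nhdsWithin_le_nhds hinv] with θ hθ using hθ

/-- Points of the arc close to `γ t` have parameters close to `t`. -/
theorem IsArc.eventually_param (h : IsArc γ a b) (ht : t ∈ Set.Icc (0 : ℝ) 1) {U : Set ℝ}
    (hU : U ∈ 𝓝 t) : ∀ᶠ z in 𝓝 (γ t), ∀ τ ∈ Set.Icc (0 : ℝ) 1, γ τ = z → τ ∈ U := by
  have hK : IsCompact (γ '' (Set.Icc 0 1 \ interior U)) :=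
    (isCompact_Icc.diff isOpen_interior).image_of_continuousOn
      (h.continuousOn.mono Set.sdiff_subset)
  have hn : γ t ∉ γ '' (Set.Icc 0 1 \ interior U) := by
    rintro ⟨τ, hτ, e⟩
    rw [h.injOn hτ.1 ht e] at hτ
    exact hτ.2 (mem_interior_iff_mem_nhds.2 hU)
  filter_upwards [hK.isClosed.isOpen_compl.mem_nhds hn] with z hz τ hτ e
  by_contra hτU
  exact hz ⟨τ, ⟨hτ, fun hi => hτU (interior_subset hi)⟩, e⟩

theorem IsArc.sides_le (h : IsArc γ a b) (ht : t ∈ Set.Ioo (0 : ℝ) 1) :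
    plusSide γ t ≤ 𝓝[(trace γ)ᶜ] (γ t) ∧ minusSide γ t ≤ 𝓝[(trace γ)ᶜ] (γ t) := by
  obtain ⟨e, he0, hec, hel, her, -⟩ := h.exists_chart ht
  have htend : Tendsto (collar γ t) (𝓝 (t, 0)) (𝓝 (γ t)) := by
    have := (h.hasStrictFDerivAt_collar ht).continuousAt.tendsto
    rwa [collar_zero] at this
  have hpar : ∀ᶠ τ in 𝓝 t, e (collar γ t (τ, 0)) = (τ, 0) :=
    (Continuous.prodMk_left (0 : ℝ)).continuousAt.tendsto.eventually hel
  -- a point of the arc near `γ t` has vanishing second chart component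
  have key : ∀ᶠ p : ℝ × ℝ in 𝓝 (t, (0 : ℝ)), p.2 ≠ 0 → collar γ t p ∈ (trace γ)ᶜ := by
    filter_upwards [hel, htend.eventually
      (h.eventually_param (Set.Ioo_subset_Icc_self ht) hpar)] with p hp hpp hp2
    rintro ⟨τ, hτ, hτe⟩
    have : e (collar γ t (τ, 0)) = (τ, 0) := hpp τ hτ hτe
    rw [collar_zero, hτe, hp] at this
    exact hp2 (by rw [this])
  have hle : ∀ s : Set ℝ, 𝓝 t ×ˢ 𝓝[s] (0 : ℝ) ≤ 𝓝 (t, (0 : ℝ)) := fun s => by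
    rw [nhds_prod_eq]; exact Filter.prod_mono le_rfl nhdsWithin_le_nhds
  constructor
  · rw [plusSide_eq]
    refine tendsto_nhdsWithin_iff.2 ⟨htend.mono_left (hle _), ?_⟩
    filter_upwards [hle _ key, tendsto_snd.eventually (self_mem_nhdsWithin)] with p hp hp2
    exact hp (ne_of_gt hp2)
  · rw [minusSide_eq]
    refine tendsto_nhdsWithin_iff.2 ⟨htend.mono_left (hle _), ?_⟩
    filter_upwards [hle _ key, tendsto_snd.eventually (self_mem_nhdsWithin)] with p hp hp2
    exact hp (ne_of_lt hp2)

theorem IsArc.plusSide_le (h : IsArc γ a b) (ht : t ∈ Set.Ioo (0 : ℝ) 1) :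
    plusSide γ t ≤ 𝓝 (γ t) :=
  (h.sides_le ht).1.trans nhdsWithin_le_nhds

theorem IsArc.minusSide_le (h : IsArc γ a b) (ht : t ∈ Set.Ioo (0 : ℝ) 1) :
    minusSide γ t ≤ 𝓝 (γ t) :=
  (h.sides_le ht).2.trans nhdsWithin_le_nhds

/-- The two sides exhaust a punctured neighbourhood of the arc. -/
theorem IsArc.nhdsWithin_le_sides (h : IsArc γ a b) (ht : t ∈ Set.Ioo (0 : ℝ) 1) :
    𝓝[(trace γ)ᶜ] (γ t) ≤ plusSide γ t ⊔ minusSide γ t := by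
  obtain ⟨e, he0, hec, hel, her, -⟩ := h.exists_chart ht
  intro A hA
  obtain ⟨hA1, hA2⟩ := Filter.mem_sup.1 hA
  rw [plusSide_eq, Filter.mem_map] at hA1
  rw [minusSide_eq, Filter.mem_map] at hA2
  obtain ⟨U1, hU1, V1, hV1, h1⟩ := Filter.mem_prod_iff.1 hA1
  obtain ⟨U2, hU2, V2, hV2, h2⟩ := Filter.mem_prod_iff.1 hA2
  rw [mem_nhdsWithin_iff_eventually] at hV1 hV2
  have hec' : Tendsto e (𝓝 (γ t)) (𝓝 t ×ˢ 𝓝 0) := by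
    rw [← nhds_prod_eq, ← he0]; exact hec.tendsto
  have hI : Set.Icc (0 : ℝ) 1 ∈ 𝓝 t := Icc_mem_nhds ht.1 ht.2
  refine mem_nhdsWithin_iff_eventually.2 ?_
  filter_upwards [her, (tendsto_fst.comp hec').eventually (inter_mem (inter_mem hU1 hU2) hI),
    (tendsto_snd.comp hec').eventually (hV1.and hV2)] with z hz hzU hzV hzΓ
  rcases lt_trichotomy (e z).2 0 with hlt | heq | hgt
  · have := @h2 (e z) ⟨hzU.1.2, hzV.2 hlt⟩
    simpa [hz] using this
  · refine absurd ?_ hzΓ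
    have : collar γ t ((e z).1, 0) = z := by rw [← heq]; exact hz
    rw [collar_zero] at this
    exact ⟨_, hzU.2, this⟩
  · have := @h1 (e z) ⟨hzU.1.1, hzV.1 hgt⟩
    simpa [hz] using this

end Arc

/-! ### Continuous branches of roots -/

/-- On a preconnected set, a continuous function whose `n`-th power avoids the negative half-line
is a fixed `n`-th root of unity times the principal root. -/
theorem exists_eq_mul_cpow {X : Type*} [TopologicalSpace X] {S : Set X} (hS : IsPreconnected S)
    {f : X → ℂ} (hf : ContinuousOn f S) {n : ℕ} (hn : n ≠ 0)
    (hsl : ∀ x ∈ S, f x ^ n ∈ Complex.slitPlane) :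
    ∃ r : ℂ, r ^ n = 1 ∧ ∀ x ∈ S, f x = r * (f x ^ n) ^ (1 / (n : ℂ)) := by
  rcases S.eq_empty_or_nonempty with rfl | ⟨x₀, hx₀⟩
  · exact ⟨1, one_pow n, by simp⟩
  have hpow : ∀ z : ℂ, (z ^ (1 / (n : ℂ))) ^ n = z := fun z => by
    rw [one_div]; exact Complex.cpow_nat_inv_pow z hn
  have hne : ∀ x ∈ S, (f x ^ n) ^ (1 / (n : ℂ)) ≠ 0 := fun x hx h0 => by
    have := hpow (f x ^ n)
    rw [h0, zero_pow hn] at this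
    exact Complex.slitPlane_ne_zero (hsl x hx) this.symm
  have hg : ContinuousOn (fun x => f x / (f x ^ n) ^ (1 / (n : ℂ))) S :=
    hf.div ((hf.pow n).cpow continuousOn_const hsl) hne
  have hfin : ({r : ℂ | r ^ n = 1}).Finite := by
    have : NeZero n := ⟨hn⟩
    refine ((Polynomial.nthRootsFinset n (1 : ℂ)).finite_toSet).subset fun r hr => ?_
    exact (Polynomial.mem_nthRootsFinset (Nat.pos_of_ne_zero hn) 1).2 hr
  have hmaps : Set.MapsTo (fun x => f x / (f x ^ n) ^ (1 / (n : ℂ))) S {r : ℂ | r ^ n = 1} := by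
    intro x hx
    show (f x / (f x ^ n) ^ (1 / (n : ℂ))) ^ n = 1
    rw [div_pow, hpow, div_self (Complex.slitPlane_ne_zero (hsl x hx))]
  obtain ⟨r, hr, hconst⟩ := hS.eqOn_const_of_mapsTo hfin.isDiscrete hg hmaps ⟨1, one_pow n⟩
  refine ⟨r, hr, fun x hx => ?_⟩
  have : f x / (f x ^ n) ^ (1 / (n : ℂ)) = r := hconst hx
  rw [← this, div_mul_cancel₀ _ (hne x hx)]

theorem mem_slitPlane_of_norm_sub_one_lt {z : ℂ} (h : ‖z - 1‖ < 1) : z ∈ Complex.slitPlane := by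
  refine Complex.mem_slitPlane_iff.2 (Or.inl ?_)
  have := (Complex.abs_re_le_norm (z - 1)).trans_lt h
  rw [Complex.sub_re, Complex.one_re, abs_lt] at this
  linarith [this.1]

theorem re_div_pos_of_norm_sub_one_le {p q : ℂ} (hp : ‖p - 1‖ ≤ 1 / 4) (hq : ‖q - 1‖ ≤ 1 / 4) :
    0 < (p / q).re := by
  have h1 := abs_le.1 ((Complex.abs_re_le_norm (p - 1)).trans hp)
  have h2 := abs_le.1 ((Complex.abs_im_le_norm (p - 1)).trans hp)
  have h3 := abs_le.1 ((Complex.abs_re_le_norm (q - 1)).trans hq)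
  have h4 := abs_le.1 ((Complex.abs_im_le_norm (q - 1)).trans hq)
  simp only [Complex.sub_re, Complex.sub_im, Complex.one_re, Complex.one_im, sub_zero] at h1 h2 h3 h4
  have hq0 : q ≠ 0 := by
    rintro rfl
    norm_num at h3
  have hN : 0 < Complex.normSq q := Complex.normSq_pos.2 hq0
  rw [Complex.div_re, ← add_div]
  refine div_pos ?_ hN
  nlinarith [mul_nonneg (sub_nonneg.2 h1.1) (sub_nonneg.2 h3.1), mul_nonneg (sub_nonneg.2 h2.1)
    (sub_nonneg.2 h4.1), mul_nonneg (sub_nonneg.2 h2.2) (sub_nonneg.2 h4.2)]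

/-! ### Boundary values of root functions along an arc -/

section Arc

variable {γ : ℝ → ℂ} {a b : ℂ} {t : ℝ}

/-- Both sides have bases of preconnected sets. -/
theorem IsArc.exists_preconnected (h : IsArc γ a b) (ht : t ∈ Set.Ioo (0 : ℝ) 1) {F : Filter ℂ}
    (hF : F = plusSide γ t ∨ F = minusSide γ t) {A : Set ℂ} (hA : A ∈ F) :
    ∃ B ∈ F, B ⊆ A ∧ IsPreconnected B := by
  have main : ∀ s : Set ℝ, (∀ V ∈ 𝓝[s] (0 : ℝ), ∃ W ∈ 𝓝[s] (0 : ℝ), W ⊆ V ∧ IsPreconnected W) →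
      A ∈ map (collar γ t) (𝓝 t ×ˢ 𝓝[s] (0 : ℝ)) →
      ∃ B ∈ map (collar γ t) (𝓝 t ×ˢ 𝓝[s] (0 : ℝ)), B ⊆ A ∧ IsPreconnected B := by
    intro s hs hA
    obtain ⟨U, hU, V, hV, hUV⟩ := Filter.mem_prod_iff.1 (Filter.mem_map.1 hA)
    obtain ⟨W, hW, hWV, hWc⟩ := hs V hV
    obtain ⟨δ, hδ, hball⟩ := Metric.mem_nhds_iff.1 (inter_mem hU (Ioo_mem_nhds ht.1 ht.2))
    refine ⟨collar γ t '' (Metric.ball t δ ×ˢ W),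
      Filter.image_mem_map (Filter.prod_mem_prod (Metric.ball_mem_nhds t hδ) hW), ?_, ?_⟩
    · rintro _ ⟨p, hp, rfl⟩
      exact hUV ⟨(hball hp.1).1, hWV hp.2⟩
    · refine IsPreconnected.image ((convex_ball t δ).isPreconnected.prod hWc) _ ?_
      refine ContinuousOn.add ?_ (by fun_prop)
      intro p hp
      exact ((h.continuousAt (hball hp.1).2).comp continuous_fst.continuousAt).continuousWithinAt
  rcases hF with rfl | rfl
  · rw [plusSide_eq] at hA ⊢
    refine main _ (fun V hV => ?_) hA
    obtain ⟨u, hu, huV⟩ := (mem_nhdsGT_iff_exists_Ioo_subset).1 hV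
    exact ⟨_, Ioo_mem_nhdsGT hu, huV, isPreconnected_Ioo⟩
  · rw [minusSide_eq] at hA ⊢
    refine main _ (fun V hV => ?_) hA
    obtain ⟨u, hu, huV⟩ := (mem_nhdsLT_iff_exists_Ioo_subset).1 hV
    exact ⟨_, Ioo_mem_nhdsLT hu, huV, isPreconnected_Ioo⟩

/-- A continuous function has a boundary value as soon as its square has a nonzero one. -/
theorem IsArc.exists_tendsto_of_sq (h : IsArc γ a b) (ht : t ∈ Set.Ioo (0 : ℝ) 1) {F : Filter ℂ}
    (hF : F = plusSide γ t ∨ F = minusSide γ t) {f : ℂ → ℂ} {U : Set ℂ} (hU : U ∈ F)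
    (hf : ContinuousOn f U) {l : ℂ} (hl : l ≠ 0) (hlim : Tendsto (fun z => f z ^ 2) F (𝓝 l)) :
    ∃ σ, Tendsto f F (𝓝 σ) := by
  obtain ⟨k, hk⟩ : ∃ k : ℂ, k ^ 2 = l := IsAlgClosed.exists_pow_nat_eq l two_pos
  have hk0 : k ≠ 0 := by rintro rfl; exact hl (by rw [← hk]; simp)
  have hlim1 : Tendsto (fun z => (f z / k) ^ 2) F (𝓝 1) := by
    have := hlim.div_const l
    rw [div_self hl] at this
    refine this.congr fun z => ?_
    rw [div_pow, hk]
  have hA : U ∩ {z | ‖(f z / k) ^ 2 - 1‖ < 1} ∈ F := by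
    refine inter_mem hU ?_
    have := hlim1.eventually (Metric.ball_mem_nhds 1 one_pos)
    filter_upwards [this] with z hz
    simpa [dist_eq_norm] using hz
  obtain ⟨B, hB, hBA, hBc⟩ := h.exists_preconnected ht hF hA
  obtain ⟨r, -, hr⟩ := exists_eq_mul_cpow hBc (f := fun z => f z / k)
    ((hf.mono fun z hz => (hBA hz).1).div_const k) two_ne_zero
    fun z hz => mem_slitPlane_of_norm_sub_one_lt (hBA hz).2
  refine ⟨k * (r * 1 ^ (1 / ((2 : ℕ) : ℂ))), ?_⟩
  have hc : Tendsto (fun z => k * (r * ((f z / k) ^ 2) ^ (1 / ((2 : ℕ) : ℂ)))) F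
      (𝓝 (k * (r * 1 ^ (1 / ((2 : ℕ) : ℂ))))) :=
    (((continuousAt_cpow_const (by simp)).tendsto.comp hlim1).const_mul r).const_mul k
  refine hc.congr' ?_
  filter_upwards [hB] with z hz
  rw [← hr z hz, mul_div_cancel₀ _ hk0]

/-- Boundary values depend continuously on the point of the arc. -/
theorem IsArc.continuousOn_boundaryValue (h : IsArc γ a b) {side : (ℝ → ℂ) → ℝ → Filter ℂ}
    (hside : side = plusSide ∨ side = minusSide) {f : ℂ → ℂ} {σ : ℝ → ℂ}
    (hσ : ∀ t ∈ Set.Ioo (0 : ℝ) 1, Tendsto f (side γ t) (𝓝 (σ t))) :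
    ContinuousOn σ (Set.Ioo 0 1) := by
  have main : ∀ s : Set ℝ, (𝓝[s] (0 : ℝ)).NeBot → ∀ t ∈ Set.Ioo (0 : ℝ) 1,
      Tendsto f (map (collar γ t) (𝓝 t ×ˢ 𝓝[s] (0 : ℝ))) (𝓝 (σ t)) →
      (∀ t' ∈ Set.Ioo (0 : ℝ) 1, 0 < (Complex.I * velocity γ t / velocity γ t').im →
        Tendsto (fun ε => f (collar γ t (t', ε))) (𝓝[s] 0) (𝓝 (σ t'))) → ContinuousAt σ t := by
    intro s _ t ht hft hcurve
    refine (closed_nhds_basis (σ t)).tendsto_right_iff.2 fun W hW => ?_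
    obtain ⟨U, hU, V, hV, hUV⟩ := Filter.mem_prod_iff.1 (Filter.mem_map.1 (hft hW.1))
    have hvel : ContinuousAt (fun t' => (Complex.I * velocity γ t / velocity γ t').im) t := by
      refine Complex.continuous_im.continuousAt.comp (continuousAt_const.div ?_
        (h.velocity_ne_zero ht))
      exact (h.continuousOn_velocity).continuousAt (Icc_mem_nhds ht.1 ht.2)
    have hpos : 0 < (Complex.I * velocity γ t / velocity γ t).im := by
      rw [mul_div_assoc, div_self (h.velocity_ne_zero ht)]; simp
    filter_upwards [hU, hvel.eventually (lt_mem_nhds hpos), Ioo_mem_nhds ht.1 ht.2] with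
      t' ht'U ht'v ht'
    refine hW.2.mem_of_tendsto (hcurve t' ht' ht'v) ?_
    filter_upwards [hV] with ε hε
    exact @hUV (t', ε) ⟨ht'U, hε⟩
  have hcol : ∀ t t' : ℝ, HasDerivAt (fun ε : ℝ => collar γ t (t', ε))
      (Complex.I * velocity γ t) 0 := fun t t' => by
    simpa [collar] using
      ((Complex.ofRealCLM.hasDerivAt (x := 0)).mul_const (Complex.I * velocity γ t)).const_add (γ t')
  rcases hside with rfl | rfl
  · intro t ht
    refine (main (Set.Ioi 0) inferInstance t ht (hσ t ht) fun t' ht' hv => ?_).continuousWithinAt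
    exact (hσ t' ht').comp (h.tendsto_sides ht' (hcol t t') (collar_zero γ t t') hv).1
  · intro t ht
    refine (main (Set.Iio 0) inferInstance t ht ?_ fun t' ht' hv => ?_).continuousWithinAt
    · rw [← minusSide_eq]; exact hσ t ht
    · exact (hσ t' ht').comp (h.tendsto_sides ht' (hcol t t') (collar_zero γ t t') hv).2

/-! ### Small circles around the initial point of an arc -/

theorem IsArc.tendsto_source (h : IsArc γ a b) : Tendsto γ (𝓝[>] 0) (𝓝 a) := by
  have := h.continuousOn 0 (by simp)
  rw [ContinuousWithinAt, h.source] at this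
  refine this.mono_left ?_
  rw [← nhdsWithin_Ioo_eq_nhdsGT (zero_lt_one' ℝ)]
  exact nhdsWithin_mono _ Set.Ioo_subset_Icc_self

/-- Near its initial point an arc is close to a straight segment. -/
theorem IsArc.exists_almost_straight (h : IsArc γ a b) : ∃ δ ∈ Set.Ioo (0 : ℝ) 1,
    (∀ τ ∈ Set.Icc (0 : ℝ) δ, ‖velocity γ τ / velocity γ 0 - 1‖ ≤ 1 / 4) ∧
    ∀ τ ∈ Set.Icc (0 : ℝ) δ, ∀ τ' ∈ Set.Icc (0 : ℝ) δ,
      ‖(γ τ' - γ τ) / velocity γ 0 - (τ' - τ : ℝ)‖ ≤ 1 / 4 * |τ' - τ| := by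
  have h0 : velocity γ 0 ≠ 0 := h.regular 0 (by simp)
  have hc : Tendsto (fun τ => ‖velocity γ τ / velocity γ 0 - 1‖) (𝓝[Set.Icc 0 1] 0) (𝓝 0) := by
    have := ((((h.continuousOn_velocity) 0 (by simp)).div_const (velocity γ 0)).sub_const 1).norm
    simpa [ContinuousWithinAt, div_self h0] using this
  have hev := hc.eventually (ge_mem_nhds (show (0 : ℝ) < 1 / 4 by norm_num))
  obtain ⟨δ, hδ, hball⟩ := Metric.mem_nhdsWithin_iff.1 hev
  have hδ1 : ∀ τ ∈ Set.Icc (0 : ℝ) (min (δ / 2) (1 / 2)),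
      τ ∈ Set.Icc (0 : ℝ) 1 ∧ ‖velocity γ τ / velocity γ 0 - 1‖ ≤ 1 / 4 := by
    intro τ hτ
    have h1 := hτ.2.trans (min_le_left _ _)
    have h2 := hτ.2.trans (min_le_right _ _)
    have h3 : τ ∈ Set.Icc (0 : ℝ) 1 := ⟨hτ.1, by linarith⟩
    refine ⟨h3, hball ⟨?_, h3⟩⟩
    rw [Metric.mem_ball, Real.dist_eq, sub_zero, abs_of_nonneg hτ.1]
    linarith
  refine ⟨min (δ / 2) (1 / 2), ⟨by positivity, (min_le_right _ _).trans_lt (by norm_num)⟩,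
    fun τ hτ => (hδ1 τ hτ).2, fun τ hτ τ' hτ' => ?_⟩
  have hderiv : ∀ x ∈ Set.Icc (0 : ℝ) (min (δ / 2) (1 / 2)),
      HasDerivWithinAt (fun x : ℝ => γ x / velocity γ 0 - (x : ℂ))
        (velocity γ x / velocity γ 0 - 1) (Set.Icc 0 (min (δ / 2) (1 / 2))) x := by
    intro x hx
    have hd : HasDerivWithinAt γ (velocity γ x) (Set.Icc 0 1) x :=
      (h.contDiffOn.differentiableOn (by simp) x (hδ1 x hx).1).hasDerivWithinAt
    exact ((hd.mono fun y hy => (hδ1 y hy).1).div_const _).sub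
      (Complex.ofRealCLM.hasDerivAt (x := x)).hasDerivWithinAt
  have := (convex_Icc (0 : ℝ) (min (δ / 2) (1 / 2))).norm_image_sub_le_of_norm_hasDerivWithin_le
    hderiv (fun x hx => (hδ1 x hx).2) hτ hτ'
  rw [Real.norm_eq_abs] at this
  refine (le_of_eq ?_).trans this
  congr 1
  push_cast
  ring

/-- A small circle around the initial point of an arc meets the arc exactly once, and crosses it
from right to left when run through counterclockwise. -/
theorem IsArc.eventually_circle (h : IsArc γ a b) : ∀ᶠ t in 𝓝[>] (0 : ℝ),
    t ∈ Set.Ioo (0 : ℝ) 1 ∧ (∀ τ ∈ Set.Icc (0 : ℝ) 1, ‖γ τ - a‖ = ‖γ t - a‖ → τ = t) ∧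
      0 < ((γ t - a) / velocity γ t).re := by
  obtain ⟨δ, hδ, hv, hs⟩ := h.exists_almost_straight
  have h0 : velocity γ 0 ≠ 0 := h.regular 0 (by simp)
  have h00 : (0 : ℝ) ∈ Set.Icc (0 : ℝ) δ := ⟨le_rfl, hδ.1.le⟩
  have hsrc := h.source
  -- `γ τ - a` divided by `τ γ'(0)` is close to one
  have hq : ∀ τ ∈ Set.Icc (0 : ℝ) δ, ‖(γ τ - a) / velocity γ 0 - τ‖ ≤ 1 / 4 * τ := fun τ hτ => by
    have := hs 0 h00 τ hτ
    simpa [hsrc, abs_of_nonneg hτ.1] using this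
  have hre : ∀ τ ∈ Set.Icc (0 : ℝ) δ, ∀ t ∈ Set.Icc (0 : ℝ) δ, τ < t →
      ‖γ τ - a‖ ≠ ‖γ t - a‖ := by
    intro τ hτ t ht hlt heq
    have htp : 0 < t := hτ.1.trans_lt hlt
    have hp : ‖(γ t - γ τ) / velocity γ 0 / (t - τ : ℝ) - 1‖ ≤ 1 / 4 := by
      have hne : ((t - τ : ℝ) : ℂ) ≠ 0 := Complex.ofReal_ne_zero.2 (sub_pos.2 hlt).ne'
      rw [← div_self hne, ← sub_div, norm_div, Complex.norm_real, Real.norm_eq_abs,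
        div_le_iff₀ (abs_pos.2 (sub_pos.2 hlt).ne')]
      exact hs τ hτ t ht
    have hpq : ‖(γ t + γ τ - 2 * a) / velocity γ 0 / (t + τ : ℝ) - 1‖ ≤ 1 / 4 := by
      have hpos : 0 < t + τ := by linarith [hτ.1]
      have hne : ((t + τ : ℝ) : ℂ) ≠ 0 := Complex.ofReal_ne_zero.2 hpos.ne'
      rw [← div_self hne, ← sub_div, norm_div, Complex.norm_real, Real.norm_eq_abs,
        abs_of_pos hpos, div_le_iff₀ hpos]
      calc ‖(γ t + γ τ - 2 * a) / velocity γ 0 - (t + τ : ℝ)‖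
          = ‖((γ t - a) / velocity γ 0 - t) + ((γ τ - a) / velocity γ 0 - τ)‖ := by
            congr 1; push_cast; ring
        _ ≤ 1 / 4 * t + 1 / 4 * τ := (norm_add_le _ _).trans (add_le_add (hq t ht) (hq τ hτ))
        _ = 1 / 4 * (t + τ) := by ring
    have hpos := re_div_pos_of_norm_sub_one_le hp hpq
    have hexp : (γ t - γ τ) / velocity γ 0 / (t - τ : ℝ) /
        ((γ t + γ τ - 2 * a) / velocity γ 0 / (t + τ : ℝ)) =
        (((t + τ) / (t - τ) : ℝ) : ℂ) * ((γ t - γ τ) / (γ t + γ τ - 2 * a)) := by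
      push_cast
      field_simp
    rw [hexp, Complex.re_ofReal_mul] at hpos
    have hzero : ((γ t - γ τ) / (γ t + γ τ - 2 * a)).re = 0 := by
      have hsq : Complex.normSq (γ τ - a) = Complex.normSq (γ t - a) := by
        rw [Complex.normSq_eq_norm_sq, Complex.normSq_eq_norm_sq, heq]
      rw [Complex.div_re, ← add_div]
      refine div_eq_zero_iff.2 (Or.inl ?_)
      simp only [Complex.normSq_apply, Complex.sub_re, Complex.sub_im, Complex.add_re,
        Complex.add_im, Complex.mul_re, Complex.mul_im] at hsq ⊢
      norm_num
      linarith
    rw [hzero, mul_zero] at hpos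
    exact lt_irrefl _ hpos
  -- the rest of the arc keeps a distance from `a`
  have hfar : ∀ᶠ z in 𝓝 a, ∀ τ ∈ Set.Icc (0 : ℝ) 1, γ τ = z → τ ∈ Set.Iio δ := by
    rw [← hsrc]; exact h.eventually_param (by simp) (Iio_mem_nhds hδ.1)
  obtain ⟨r, hr, hball⟩ := Metric.mem_nhds_iff.1 hfar
  filter_upwards [h.tendsto_source.eventually (Metric.ball_mem_nhds a hr), Ioo_mem_nhdsGT hδ.1] with t htr ht
  have ht' : t ∈ Set.Icc (0 : ℝ) δ := ⟨ht.1.le, ht.2.le⟩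
  refine ⟨⟨ht.1, ht.2.trans hδ.2⟩, fun τ hτ heq => ?_, ?_⟩
  · have hτδ : τ < δ := by
      have hτr : γ τ ∈ Metric.ball a r := by
        rwa [Metric.mem_ball, dist_eq_norm, heq, ← dist_eq_norm]
      exact hball hτr τ hτ rfl
    rcases lt_trichotomy τ t with hlt | heq' | hgt
    · exact absurd heq (hre τ ⟨hτ.1, hτδ.le⟩ t ht' hlt)
    · exact heq'
    · exact absurd heq.symm (hre t ht' τ ⟨hτ.1, hτδ.le⟩ hgt)
  · have hp : ‖(γ t - a) / velocity γ 0 / (t : ℝ) - 1‖ ≤ 1 / 4 := by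
      have hne : ((t : ℝ) : ℂ) ≠ 0 := Complex.ofReal_ne_zero.2 ht.1.ne'
      rw [← div_self hne, ← sub_div, norm_div, Complex.norm_real, Real.norm_eq_abs,
        abs_of_pos ht.1, div_le_iff₀ ht.1]
      exact hq t ht'
    have hpos := re_div_pos_of_norm_sub_one_le hp (hv t ht')
    have hexp : (γ t - a) / velocity γ 0 / (t : ℝ) / (velocity γ t / velocity γ 0) =
        ((t⁻¹ : ℝ) : ℂ) * ((γ t - a) / velocity γ t) := by
      push_cast
      field_simp
    rw [hexp, Complex.re_ofReal_mul] at hpos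
    exact (mul_pos_iff_of_pos_left (inv_pos.2 ht.1)).1 hpos

/-- If `f⁴` behaves like `K (z - a)` at the initial point `a` of the arc, then turning once counterclockwise
around `a` on a small circle, from the left side of the arc to its right side, multiplies `f` by
approximately `e^{2πi/4} = i`. -/
theorem IsArc.tendsto_boundaryValue_ratio (h : IsArc γ a b) {f : ℂ → ℂ} {K : ℂ} (hK : K ≠ 0)
    {U : Set ℂ} (hU : U ∈ 𝓝 a) (hf : ContinuousOn f (U ∩ (trace γ)ᶜ))
    (hlim : Tendsto (fun z => f z ^ 4 / (z - a)) (𝓝[(trace γ)ᶜ] a) (𝓝 K)) {σ τ : ℝ → ℂ}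
    (hσ : ∀ t ∈ Set.Ioo (0 : ℝ) 1, Tendsto f (plusSide γ t) (𝓝 (σ t)))
    (hτ : ∀ t ∈ Set.Ioo (0 : ℝ) 1, Tendsto f (minusSide γ t) (𝓝 (τ t))) :
    Tendsto (fun t => τ t / σ t) (𝓝[>] 0) (𝓝 Complex.I) := by
  set q : ℂ := 1 / ((4 : ℕ) : ℂ) with hqdef
  rw [Metric.tendsto_nhds]
  intro ε hε
  -- closeness of principal fourth roots
  have hroot : Tendsto (fun p : ℂ × ℂ => p.2 ^ q / p.1 ^ q) (𝓝 ((1 : ℂ), (1 : ℂ))) (𝓝 1) := by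
    have hc : ContinuousAt (fun z : ℂ => z ^ q) 1 := continuousAt_cpow_const (by simp)
    have h1 : Tendsto (fun p : ℂ × ℂ => p.2 ^ q) (𝓝 ((1 : ℂ), (1 : ℂ))) (𝓝 ((1 : ℂ) ^ q)) :=
      hc.tendsto.comp (continuous_snd.tendsto ((1 : ℂ), (1 : ℂ)))
    have h2 : Tendsto (fun p : ℂ × ℂ => p.1 ^ q) (𝓝 ((1 : ℂ), (1 : ℂ))) (𝓝 ((1 : ℂ) ^ q)) :=
      hc.tendsto.comp (continuous_fst.tendsto ((1 : ℂ), (1 : ℂ)))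
    have h3 := h1.div h2 (by simp)
    rwa [Complex.one_cpow, div_one] at h3
  obtain ⟨δ, hδ, hδroot⟩ := Metric.tendsto_nhds_nhds.1 hroot ε hε
  have hη : 0 < min (δ / 2) (1 / 2) := by positivity
  obtain ⟨r₁, hr₁, hball₁⟩ := Metric.mem_nhds_iff.1 hU
  have hlim1 : Tendsto (fun z => f z ^ 4 / (z - a) / K) (𝓝[(trace γ)ᶜ] a) (𝓝 1) := by
    simpa [div_self hK] using hlim.div_const K
  obtain ⟨r₂, hr₂, hball₂⟩ := Metric.mem_nhdsWithin_iff.1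
    (hlim1.eventually (Metric.ball_mem_nhds 1 hη))
  filter_upwards [h.eventually_circle,
    h.tendsto_source.eventually (Metric.ball_mem_nhds a (lt_min hr₁ hr₂))] with t hcirc htr
  obtain ⟨ht, huniq, hre⟩ := hcirc
  have hγa : γ t - a ≠ 0 := by
    intro h0; rw [h0, zero_div] at hre; exact lt_irrefl _ hre
  -- the circle through `γ t`
  set z : ℝ → ℂ := fun θ => a + (γ t - a) * Complex.exp (θ * Complex.I) with hz
  have hz0 : z 0 = γ t := by simp [hz]
  have hper : ∀ θ, z (θ - 2 * Real.pi) = z θ := fun θ => by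
    have : Complex.exp (((θ - 2 * Real.pi : ℝ) : ℂ) * Complex.I) = Complex.exp (θ * Complex.I) := by
      push_cast
      rw [sub_mul]
      exact Complex.exp_periodic.sub_eq _
    simp only [hz, this]
  have hnorm : ∀ θ, ‖z θ - a‖ = ‖γ t - a‖ := fun θ => by
    simp [hz, Complex.norm_exp_ofReal_mul_I]
  have hzcont : Continuous z := by fun_prop
  have hzd : HasDerivAt z (Complex.I * (γ t - a)) 0 := by
    have h1 : HasDerivAt (fun θ : ℝ => Complex.exp (θ * Complex.I)) (Complex.I) 0 := by
      have h2 : HasDerivAt (fun θ : ℝ => (θ : ℂ) * Complex.I) (1 * Complex.I) 0 :=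
        (Complex.ofRealCLM.hasDerivAt (x := 0)).mul_const Complex.I
      simpa using h2.cexp
    have := (h1.const_mul (γ t - a)).const_add a
    rwa [mul_comm (γ t - a)] at this
  have hsides := h.tendsto_sides ht hzd hz0 (by
    rw [mul_div_assoc, Complex.I_mul_im]; exact hre)
  have hoff : ∀ θ ∈ Set.Ioo (0 : ℝ) (2 * Real.pi), z θ ∈ (trace γ)ᶜ := by
    rintro θ hθ ⟨s, hs, hse⟩
    have hst := huniq s hs (by rw [hse, hnorm])
    rw [hst] at hse
    have h1 : Complex.exp (θ * Complex.I) = 1 := by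
      have : (γ t - a) * Complex.exp (θ * Complex.I) = (γ t - a) * 1 := by
        rw [mul_one]; linear_combination -hse
      exact mul_left_cancel₀ hγa this
    obtain ⟨n, hn⟩ := Complex.exp_eq_one_iff.1 h1
    have h2 : θ = n * (2 * Real.pi) := by
      have : (θ : ℂ) * Complex.I = ((n * (2 * Real.pi) : ℝ) : ℂ) * Complex.I := by
        rw [hn]; push_cast; ring
      exact_mod_cast mul_right_cancel₀ Complex.I_ne_zero this
    have hpi : 0 < 2 * Real.pi := Real.two_pi_pos
    have hn0 : (0 : ℝ) < n := by
      by_contra hcon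
      have := mul_nonpos_of_nonpos_of_nonneg (not_lt.1 hcon) hpi.le
      linarith [hθ.1]
    have hn1 : (n : ℝ) < 1 := by
      by_contra hcon
      have := mul_le_mul_of_nonneg_right (not_lt.1 hcon) hpi.le
      linarith [hθ.2]
    have h3 : 0 < n := by exact_mod_cast hn0
    have h4 : n < 1 := by exact_mod_cast hn1
    omega
  have hmem : ∀ θ ∈ Set.Ioo (0 : ℝ) (2 * Real.pi), z θ ∈ U ∩ (trace γ)ᶜ := fun θ hθ => by
    refine ⟨hball₁ ?_, hoff θ hθ⟩
    rw [Metric.mem_ball, dist_eq_norm, hnorm, ← dist_eq_norm]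
    exact (Metric.mem_ball.1 htr).trans_le (min_le_left _ _)
  have hclose : ∀ θ ∈ Set.Ioo (0 : ℝ) (2 * Real.pi),
      ‖f (z θ) ^ 4 / (z θ - a) / K - 1‖ < min (δ / 2) (1 / 2) := fun θ hθ => by
    have : z θ ∈ Metric.ball a r₂ ∩ (trace γ)ᶜ := by
      refine ⟨?_, hoff θ hθ⟩
      rw [Metric.mem_ball, dist_eq_norm, hnorm, ← dist_eq_norm]
      exact (Metric.mem_ball.1 htr).trans_le (min_le_right _ _)
    have := hball₂ this
    rwa [← dist_eq_norm]
  obtain ⟨κ, hκ⟩ : ∃ κ : ℂ, κ ^ 4 = K * (γ t - a) := IsAlgClosed.exists_pow_nat_eq _ four_pos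
  have hκ0 : κ ≠ 0 := by
    rintro rfl
    exact mul_ne_zero hK hγa (by rw [← hκ]; simp)
  -- untwisted by `e^{-iθ/4}`, the fourth power of `f` stays near a constant along the circle
  set n : ℝ → ℂ := fun θ => f (z θ) * Complex.exp (-(θ * Complex.I / 4)) / κ with hn
  have hn4 : ∀ θ, n θ ^ 4 = f (z θ) ^ 4 / (z θ - a) / K := fun θ => by
    have he : Complex.exp (-(θ * Complex.I / 4)) ^ 4 = (Complex.exp (θ * Complex.I))⁻¹ := by
      rw [← Complex.exp_nat_mul, ← Complex.exp_neg]
      congr 1; push_cast; ring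
    have hza : z θ - a = (γ t - a) * Complex.exp (θ * Complex.I) := by simp [hz]
    simp only [hn]
    rw [div_pow, mul_pow, hκ, he, hza]
    have := Complex.exp_ne_zero (θ * Complex.I)
    field_simp
  have hncont : ContinuousOn n (Set.Ioo 0 (2 * Real.pi)) := by
    refine ContinuousOn.div_const (ContinuousOn.mul ?_ (by fun_prop)) κ
    exact hf.comp hzcont.continuousOn hmem
  obtain ⟨r, hr, hroots⟩ := exists_eq_mul_cpow isPreconnected_Ioo hncont four_ne_zero fun θ hθ => by
    rw [hn4]
    exact mem_slitPlane_of_norm_sub_one_lt ((hclose θ hθ).trans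
      ((min_le_right _ _).trans_lt (by norm_num)))
  have hr0 : r ≠ 0 := by rintro rfl; norm_num at hr
  have hpi : (0 : ℝ) < 2 * Real.pi := Real.two_pi_pos
  have hlim0 : Tendsto n (𝓝[>] 0) (𝓝 (σ t / κ)) := by
    have h1 : Tendsto (fun θ : ℝ => Complex.exp (-(θ * Complex.I / 4))) (𝓝[>] 0) (𝓝 1) := by
      have : Continuous fun θ : ℝ => Complex.exp (-(θ * Complex.I / 4)) := by fun_prop
      simpa using (this.tendsto 0).mono_left (nhdsWithin_le_nhds (s := Set.Ioi 0))
    simpa using (((hσ t ht).comp hsides.1).mul h1).div_const κ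
  have hlim2 : Tendsto n (𝓝[<] (2 * Real.pi)) (𝓝 (τ t * (-Complex.I) / κ)) := by
    have h1 : Tendsto (fun θ : ℝ => Complex.exp (-(θ * Complex.I / 4))) (𝓝[<] (2 * Real.pi))
        (𝓝 (-Complex.I)) := by
      have : Continuous fun θ : ℝ => Complex.exp (-(θ * Complex.I / 4)) := by fun_prop
      have h2 := (this.tendsto (2 * Real.pi)).mono_left (nhdsWithin_le_nhds (s := Set.Iio (2 * Real.pi)))
      have h3 : Complex.exp (-(((2 * Real.pi : ℝ) : ℂ) * Complex.I / 4)) = -Complex.I := by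
        rw [← Complex.exp_neg_pi_div_two_mul_I]
        congr 1; push_cast; ring
      rwa [h3] at h2
    have h4 : Tendsto (fun θ : ℝ => θ - 2 * Real.pi) (𝓝[<] (2 * Real.pi)) (𝓝[<] 0) := by
      refine tendsto_nhdsWithin_iff.2 ⟨?_, ?_⟩
      · have : Continuous fun θ : ℝ => θ - 2 * Real.pi := by fun_prop
        simpa using (this.tendsto (2 * Real.pi)).mono_left
          (nhdsWithin_le_nhds (s := Set.Iio (2 * Real.pi)))
      · filter_upwards [self_mem_nhdsWithin] with θ hθ
        exact sub_neg.2 (Set.mem_Iio.1 hθ)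
    have h5 : Tendsto (fun θ => f (z θ)) (𝓝[<] (2 * Real.pi)) (𝓝 (τ t)) := by
      have := ((hτ t ht).comp hsides.2).comp h4
      refine this.congr fun θ => ?_
      simp only [Function.comp, hper]
    exact (h5.mul h1).div_const κ
  have hEq : ∀ {F : Filter ℝ} [F.NeBot] {l : ℂ}, Set.Ioo (0 : ℝ) (2 * Real.pi) ∈ F →
      Tendsto n F (𝓝 l) → ‖l ^ 4 - 1‖ ≤ min (δ / 2) (1 / 2) ∧ l = r * (l ^ 4) ^ q := by
    intro F _ l hF hl
    have h1 : ‖l ^ 4 - 1‖ ≤ min (δ / 2) (1 / 2) := by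
      refine le_of_tendsto (((hl.pow 4).sub_const 1).norm) ?_
      filter_upwards [hF] with θ hθ
      rw [hn4]; exact (hclose θ hθ).le
    refine ⟨h1, ?_⟩
    have hsl : l ^ 4 ∈ Complex.slitPlane :=
      mem_slitPlane_of_norm_sub_one_lt (h1.trans_lt ((min_le_right _ _).trans_lt (by norm_num)))
    refine tendsto_nhds_unique hl ?_
    refine (((continuousAt_cpow_const hsl).tendsto.comp (hl.pow 4)).const_mul r).congr' ?_
    filter_upwards [hF] with θ hθ
    exact (hroots θ hθ).symm
  obtain ⟨hc0, he0⟩ := hEq (Ioo_mem_nhdsGT hpi) hlim0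
  obtain ⟨hc2, he2⟩ := hEq (Ioo_mem_nhdsLT hpi) hlim2
  have hlt : ∀ {l : ℂ}, ‖l ^ 4 - 1‖ ≤ min (δ / 2) (1 / 2) → dist (l ^ 4) 1 < δ := fun {l} hl => by
    rw [dist_eq_norm]
    exact hl.trans_lt ((min_le_left _ _).trans_lt (by linarith))
  have hfin := hδroot (x := ((σ t / κ) ^ 4, (τ t * (-Complex.I) / κ) ^ 4)) (by
    rw [Prod.dist_eq]; exact max_lt (hlt hc0) (hlt hc2))
  have hratio : ((τ t * (-Complex.I) / κ) ^ 4) ^ q / ((σ t / κ) ^ 4) ^ q =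
      -Complex.I * (τ t / σ t) := by
    rw [← mul_div_mul_left _ _ hr0, ← he0, ← he2, div_div_div_cancel_right₀ hκ0]
    ring
  simp only [hratio] at hfin
  rw [dist_eq_norm] at hfin ⊢
  calc ‖τ t / σ t - Complex.I‖ = ‖-Complex.I * (τ t / σ t - Complex.I)‖ := by simp
    _ = ‖-Complex.I * (τ t / σ t) - 1‖ := by
      congr 1; linear_combination Complex.I_mul_I
    _ < ε := hfin

end Arc

/-! ### The cubic equation and its critical points -/

/-- The cubic polynomial in `w` whose three roots are the values of the inverse of `z(w)`. -/
def cubic (z w : ℂ) : ℂ := z * w ^ 3 - w ^ 2 - z * w + 1 / 3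

theorem cubic_neg (z w : ℂ) : cubic (-z) (-w) = cubic z w := by simp only [cubic]; ring

theorem zOf_neg (w : ℂ) : zOf (-w) = -zOf w := by
  have h1 : -w - 1 = -(w + 1) := by ring
  have h2 : -w + 1 = -(w - 1) := by ring
  simp only [zOf, h1, h2, one_div, inv_neg]
  ring

theorem ne_of_cubic_eq_zero {z w : ℂ} (h : cubic z w = 0) : w ≠ 0 ∧ w - 1 ≠ 0 ∧ w + 1 ≠ 0 := by
  refine ⟨?_, ?_, ?_⟩
  · rintro rfl
    norm_num [cubic] at h
  · intro h0
    rw [sub_eq_zero.1 h0] at h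
    norm_num [cubic] at h
  · intro h0
    rw [eq_neg_of_add_eq_zero_left h0] at h
    simp only [cubic] at h
    ring_nf at h
    norm_num at h

theorem zOf_eq_iff {z w : ℂ} (h0 : w ≠ 0) (h1 : w - 1 ≠ 0) (h2 : w + 1 ≠ 0) :
    zOf w = z ↔ cubic z w = 0 := by
  have hz : zOf w * (3 * w * (w - 1) * (w + 1)) = 3 * w ^ 2 - 1 := by
    simp only [zOf]
    field_simp
    ring
  have h3 : 3 * w * (w - 1) * (w + 1) ≠ 0 := by
    simp [h0, h1, h2]
  constructor
  · rintro rfl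
    rw [cubic]
    linear_combination hz / 3
  · intro h
    refine mul_right_cancel₀ h3 ?_
    rw [hz]
    rw [cubic] at h
    linear_combination -3 * h

theorem zOf_eq_of_cubic {z w : ℂ} (h : cubic z w = 0) : zOf w = z := by
  obtain ⟨h0, h1, h2⟩ := ne_of_cubic_eq_zero h
  exact (zOf_eq_iff h0 h1 h2).2 h

theorem eq_of_cubic_eq_zero {z z' w : ℂ} (h : cubic z w = 0) (h' : cubic z' w = 0) : z = z' :=
  (zOf_eq_of_cubic h).symm.trans (zOf_eq_of_cubic h')

/-- The four critical points are `-u, iu, u, -iu`, where `u = 3^{-1/4} ω₈`. -/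
theorem exists_critW_explicit : ∃ u : ℂ, 0 < u.re ∧ u.re = u.im ∧ u ^ 4 = -1 / 3 ∧
    critW 1 = -u ∧ critW 2 = Complex.I * u ∧ critW 3 = u ∧ critW 4 = -(Complex.I * u) := by
  set l : ℝ := (3 : ℝ) ^ (-(1 / 4) : ℝ) with hl
  have hl0 : 0 < l := by positivity
  have hl4 : l ^ 4 = 1 / 3 := by
    rw [hl, ← Real.rpow_natCast, ← Real.rpow_mul (by norm_num)]
    norm_num
  set ω : ℂ := Complex.exp (2 * (Real.pi : ℂ) * Complex.I / 8) with hω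
  have hω' : ω = (Real.cos (Real.pi / 4) : ℂ) + (Real.sin (Real.pi / 4) : ℂ) * Complex.I := by
    rw [hω, Complex.ofReal_cos, Complex.ofReal_sin, ← Complex.exp_mul_I]
    congr 1; push_cast; ring
  rw [Real.cos_pi_div_four, Real.sin_pi_div_four] at hω'
  have h2 : ω ^ 2 = Complex.I := by
    rw [hω']
    have : ((√2 / 2 : ℝ) : ℂ) ^ 2 = 1 / 2 := by
      rw [← Complex.ofReal_pow, div_pow, Real.sq_sqrt (by norm_num)]; norm_num
    linear_combination (1 + 2 * Complex.I + Complex.I ^ 2) * this + (1 / 2) * Complex.I_sq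
  have h4 : ω ^ 4 = -1 := by
    linear_combination (ω ^ 2 + Complex.I) * h2 + Complex.I_sq
  have hzp : ∀ (m : ℕ) (v : ℂ), ω ^ m * v = 1 → ω ^ (-(m : ℤ)) = v := fun m v hv => by
    rw [zpow_neg, zpow_natCast]; exact inv_eq_of_mul_eq_one_right hv
  have hre : ((l : ℂ) * ω).re = l * (√2 / 2) := by
    rw [hω', Complex.re_ofReal_mul]; simp
  have him : ((l : ℂ) * ω).im = l * (√2 / 2) := by
    rw [hω', Complex.im_ofReal_mul]; simp
  refine ⟨l * ω, ?_, ?_, ?_, ?_, ?_, ?_, ?_⟩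
  · rw [hre]; positivity
  · rw [hre, him]
  · rw [mul_pow, h4, ← Complex.ofReal_pow, hl4]; norm_num
  · have := hzp 3 (-ω) (by linear_combination -h4)
    norm_num [critW] at this ⊢
    rw [this]; ring
  · have := hzp 5 (Complex.I * ω) (by
      linear_combination Complex.I * (ω ^ 2) * h4 - Complex.I * h2 - Complex.I_sq)
    norm_num [critW] at this ⊢
    rw [this]; ring
  · have := hzp 7 ω (by linear_combination (ω ^ 4 - 1) * h4)
    norm_num [critW] at this ⊢
    rw [this]
  · have := hzp 9 (-(Complex.I * ω)) (by
      linear_combination -Complex.I * (ω ^ 6 - ω ^ 2) * h4 - Complex.I * h2 - Complex.I_sq)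
    norm_num [critW] at this ⊢
    rw [this]; ring

theorem critW_pow_four {k : ℕ} (hk : k ∈ Finset.Icc 1 4) : critW k ^ 4 = -1 / 3 := by
  obtain ⟨u, -, -, h4, h1, h2, h3, h5⟩ := exists_critW_explicit
  fin_cases hk
  · show critW 1 ^ 4 = _
    rw [h1]; linear_combination h4
  · show critW 2 ^ 4 = _
    rw [h2, mul_pow, Complex.I_pow_four]; linear_combination h4
  · show critW 3 ^ 4 = _
    rw [h3, h4]
  · show critW 4 ^ 4 = _
    rw [h5, neg_pow, mul_pow, Complex.I_pow_four]; linear_combination h4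

theorem cubic_branchZ {k : ℕ} (hk : k ∈ Finset.Icc 1 4) : cubic (branchZ k) (critW k) = 0 := by
  have h := critW_pow_four hk
  refine (zOf_eq_iff ?_ ?_ ?_).1 rfl
  · intro h0; rw [h0] at h; norm_num at h
  · intro h0; rw [sub_eq_zero.1 h0] at h; norm_num at h
  · intro h0; rw [eq_neg_of_add_eq_zero_left h0] at h; norm_num at h

theorem exists_critW {w : ℂ} (h : 3 * w ^ 4 + 1 = 0) : ∃ k ∈ Finset.Icc 1 4, w = critW k := by
  obtain ⟨u, -, -, h4, h1, h2, h3, h5⟩ := exists_critW_explicit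
  have : (w + u) * (w - Complex.I * u) * (w - u) * (w + Complex.I * u) = 0 := by
    linear_combination h / 3 - h4 + (-w ^ 2 * u ^ 2 + u ^ 4) * Complex.I_sq
  simp only [mul_eq_zero] at this
  rcases this with ((h0 | h0) | h0) | h0
  · exact ⟨1, by decide, by rw [h1]; linear_combination h0⟩
  · exact ⟨2, by decide, by rw [h2]; linear_combination h0⟩
  · exact ⟨3, by decide, by rw [h3]; linear_combination h0⟩
  · exact ⟨4, by decide, by rw [h5]; linear_combination h0⟩

theorem quartic_ne_zero {z w : ℂ} (hz : ∀ k ∈ Finset.Icc 1 4, z ≠ branchZ k) (h : cubic z w = 0) :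
    3 * w ^ 4 + 1 ≠ 0 := by
  intro h0
  obtain ⟨k, hk, rfl⟩ := exists_critW h0
  exact hz k hk (eq_of_cubic_eq_zero h (cubic_branchZ hk))

/-- Vieta's relations for three solutions `x, y, v` of `z w³ - w² - z w + 1/3 = 0`, with the
variable `z = 1 / (x + y + v)` eliminated. -/
structure IsTriple (x y v : ℂ) : Prop where
  sum_mul : x * y + x * v + y * v = -1
  prod : 3 * (x * y * v) = -(x + y + v)

namespace IsTriple

variable {x y v : ℂ}

theorem swap (h : IsTriple x y v) : IsTriple y x v :=
  ⟨by linear_combination h.sum_mul, by linear_combination h.prod⟩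

theorem rotate (h : IsTriple x y v) : IsTriple v x y :=
  ⟨by linear_combination h.sum_mul, by linear_combination h.prod⟩

theorem sum_eq (h : IsTriple x y v) : (y + v) * (3 * x ^ 2 - 1) = -2 * x := by
  linear_combination -h.prod + 3 * x * h.sum_mul

/-- At a root, `3w⁴+1` is the product of `3w²-1` and the derivative of the monic cubic. -/
theorem quartic (h : IsTriple x y v) :
    3 * x ^ 4 + 1 = (3 * x ^ 2 - 1) * ((x - y) * (x - v)) := by
  linear_combination 2 * x * h.sum_eq - (3 * x ^ 2 - 1) * h.sum_mul

theorem prod_sq (h : IsTriple x y v) :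
    (3 * x ^ 2 - 1) * (3 * y ^ 2 - 1) * (3 * v ^ 2 - 1) = -4 := by
  linear_combination (9 * x * y * v - 3 * (x + y + v)) * h.prod
    + (-9 * (x * y + x * v + y * v) + 3) * h.sum_mul + 6 * (x + y + v) * h.prod

end IsTriple

theorem isTriple_of_factor {z x y v : ℂ} (hz : z ≠ 0)
    (h : ∀ w, cubic z w = z * ((w - x) * (w - y) * (w - v))) : IsTriple x y v := by
  have h0 := h 0
  have h1 := h 1
  have h2 := h (-1)
  simp only [cubic] at h0 h1 h2
  refine ⟨mul_left_cancel₀ hz ?_, mul_left_cancel₀ hz ?_⟩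
  · linear_combination -(h1 - h2) / 2
  · linear_combination 2 * h0 + (h1 + h2) / 2

/-- Away from the branch points the cubic has three distinct roots. -/
theorem cubic_factor {z x y v : ℂ} (hz0 : z ≠ 0) (hz : ∀ k ∈ Finset.Icc 1 4, z ≠ branchZ k)
    (h : ∀ w, cubic z w = 0 ↔ w = x ∨ w = y ∨ w = v) :
    (∀ w, cubic z w = z * ((w - x) * (w - y) * (w - v))) ∧ x ≠ y ∧ x ≠ v ∧ y ≠ v := by
  have hx : cubic z x = 0 := (h x).2 (Or.inl rfl)
  -- the two other roots of the cubic, from the quadratic formula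
  obtain ⟨d, hd⟩ : ∃ d : ℂ, d ^ 2 = (1 / z - x) ^ 2 - 4 * (x ^ 2 - x / z - 1) :=
    IsAlgClosed.exists_pow_nat_eq _ two_pos
  set p : ℂ := (1 / z - x + d) / 2 with hp
  set q : ℂ := (1 / z - x - d) / 2 with hq
  have hfac : ∀ w, cubic z w = z * ((w - x) * (w - p) * (w - q)) := by
    intro w
    have hzz : z * (1 / z) = 1 := by field_simp
    have hpq : (w - p) * (w - q) = w ^ 2 - (1 / z - x) * w + (x ^ 2 - x * (1 / z) - 1) := by
      simp only [hp, hq]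
      linear_combination -hd / 4
    rw [mul_assoc (w - x), hpq]
    simp only [cubic] at hx ⊢
    linear_combination hx + (w ^ 2 - x ^ 2) * hzz
  have hdouble : ∀ {r r' r'' : ℂ}, (∀ w, cubic z w = z * ((w - r) * (w - r') * (w - r''))) →
      r ≠ r' := by
    intro r r' r'' hf e
    have h1 : cubic z r = 0 := by rw [hf]; simp
    refine quartic_ne_zero hz h1 ?_
    rw [(isTriple_of_factor hz0 hf).quartic, e]
    simp
  have hxp : x ≠ p := hdouble hfac
  have hxq : x ≠ q := hdouble (r'' := p) fun w => by rw [hfac]; ring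
  have hpq : p ≠ q := hdouble (r'' := x) fun w => by rw [hfac]; ring
  have hpm := (h p).1 (by rw [hfac]; simp)
  have hqm := (h q).1 (by rw [hfac]; simp)
  rcases hpm with hpx | rfl | rfl
  · exact absurd hpx.symm hxp
  · rcases hqm with hqx | hqp | rfl
    · exact absurd hqx.symm hxq
    · exact absurd hqp.symm hpq
    · exact ⟨hfac, hxp, hxq, hpq⟩
  · rcases hqm with hqx | rfl | hqp
    · exact absurd hqx.symm hxq
    · exact ⟨fun w => by rw [hfac]; ring, hxq, hxp, hpq.symm⟩
    · exact absurd hqp.symm hpq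

theorem continuous_cubic : Continuous fun p : ℂ × ℂ => cubic p.1 p.2 := by
  unfold cubic; fun_prop

/-! ### The sheets and their symmetry -/

/-- The union of the two cuts in the `z`-plane. -/
abbrev cuts (γP γR : ℝ → ℂ) : Set ℂ := trace γP ∪ trace γR

/-- The union of the two cuts of the square root in the `w`-plane. -/
abbrev slits (γP γR : ℝ → ℂ) (ψP ψR : ℂ → ℂ) : Set ℂ :=
  plusImage γP ψP (critW 1) (critW 2) ∪ plusImage γR ψR (critW 3) (critW 4)

/-- The two arcs and the three sheets, with all their properties. -/
structure Config (γP γR : ℝ → ℂ) (ψP ψQ ψR : ℂ → ℂ) : Prop where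
  arcP : IsArc γP (branchZ 1) (branchZ 2)
  leftP : ∀ t ∈ Set.Icc (0 : ℝ) 1, (γP t).re < 0
  arcR : IsArc γR (branchZ 3) (branchZ 4)
  rightR : ∀ t ∈ Set.Icc (0 : ℝ) 1, 0 < (γR t).re
  sheets : IsSheets γP γR ψP ψQ ψR

theorem cubic_eq_zero_of_tendsto {F : Filter ℂ} [F.NeBot] {z₀ : ℂ} {S : Set ℂ}
    (hF : F ≤ 𝓝[S] z₀) {f : ℂ → ℂ} (hf : ∀ z ∈ S, cubic z (f z) = 0) {a : ℂ}
    (ha : Tendsto f F (𝓝 a)) : cubic z₀ a = 0 := by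
  have h0 : Tendsto (fun y : ℂ => y) F (𝓝 z₀) := tendsto_id'.2 (hF.trans nhdsWithin_le_nhds)
  have h1 := (continuous_cubic.tendsto (z₀, a)).comp (h0.prodMk_nhds ha)
  refine tendsto_nhds_unique (f := fun y => cubic y (f y)) h1 (tendsto_const_nhds.congr' ?_)
  filter_upwards [hF self_mem_nhdsWithin] with y hy using (hf y hy).symm

theorem re_cpow_half_pos {z : ℂ} (hz : z ∈ Complex.slitPlane) :
    0 < (z ^ (1 / ((2 : ℕ) : ℂ))).re := by
  have h0 := Complex.slitPlane_ne_zero hz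
  have harg := Complex.mem_slitPlane_iff_arg.1 hz
  have h1 := Complex.neg_pi_lt_arg z
  have h2 := lt_of_le_of_ne (Complex.arg_le_pi z) harg.1
  have him : (Complex.log z * (1 / ((2 : ℕ) : ℂ))).im = Complex.arg z / 2 := by
    have : Complex.log z * (1 / ((2 : ℕ) : ℂ)) = ((1 / 2 : ℝ) : ℂ) * Complex.log z := by
      push_cast; ring
    rw [this, Complex.im_ofReal_mul, Complex.log_im]; ring
  rw [Complex.cpow_def_of_ne_zero h0, Complex.exp_re, him]
  exact mul_pos (Real.exp_pos _) (Real.cos_pos_of_mem_Ioo ⟨by linarith, by linarith⟩)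

theorem re_pos_or_neg_of_mem_cuts {γP γR : ℝ → ℂ} {ψP ψQ ψR : ℂ → ℂ}
    (c : Config γP γR ψP ψQ ψR) :
    (∀ z ∈ trace γP, z.re < 0) ∧ (∀ z ∈ trace γR, 0 < z.re) :=
  ⟨by rintro _ ⟨t, ht, rfl⟩; exact c.leftP t ht, by rintro _ ⟨t, ht, rfl⟩; exact c.rightR t ht⟩

theorem tendsto_zOf_cobounded : Tendsto zOf (Bornology.cobounded ℂ) (𝓝 0) := by
  have h : ∀ c : ℂ, Tendsto (fun w : ℂ => 1 / (w + c)) (Bornology.cobounded ℂ) (𝓝 0) := fun c => by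
    simp only [one_div]
    exact tendsto_inv₀_cobounded.comp (tendsto_add_const_cobounded c)
  have := (((h 0).add (h (-1))).add (h 1)).const_mul (1 / 3 : ℂ)
  have hz : zOf = fun w => (1 / 3 : ℂ) * (1 / (w + 0) + 1 / (w + -1) + 1 / (w + 1)) := by
    funext w
    simp only [zOf, add_zero, sub_eq_add_neg]
  rw [hz]
  simpa using this

/-- The exterior of a disc is preconnected, being the image of a half-plane under `exp`. -/
theorem isPreconnected_exterior {R : ℝ} (hR : 0 < R) : IsPreconnected {w : ℂ | R < ‖w‖} := by
  have h : {w : ℂ | R < ‖w‖} = Complex.exp '' {w : ℂ | Real.log R < w.re} := by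
    ext w
    constructor
    · intro hw
      have hw0 : w ≠ 0 := by
        rintro rfl
        exact absurd hw (by simp [hR.le])
      refine ⟨Complex.log w, ?_, Complex.exp_log hw0⟩
      show Real.log R < (Complex.log w).re
      rw [Complex.log_re]
      exact Real.log_lt_log hR hw
    · rintro ⟨v, hv, rfl⟩
      show R < ‖Complex.exp v‖
      rw [Complex.norm_exp, ← Real.log_lt_iff_lt_exp hR]
      exact hv
  rw [h]
  exact (convex_halfSpace_re_gt _).isPreconnected.image _ Complex.continuous_exp.continuousOn

theorem plusSide_neg (γ : ℝ → ℂ) (t : ℝ) :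
    plusSide (fun t => -γ t) t = map (fun z => -z) (plusSide γ t) := by
  have hv : velocity (fun t => -γ t) t = -velocity γ t := derivWithin.fun_neg
  rw [plusSide_eq, plusSide_eq, Filter.map_map]
  refine Filter.map_congr (Eventually.of_forall fun p => ?_)
  simp only [collar, Function.comp, hv]
  ring

theorem minusSide_neg (γ : ℝ → ℂ) (t : ℝ) :
    minusSide (fun t => -γ t) t = map (fun z => -z) (minusSide γ t) := by
  have hv : velocity (fun t => -γ t) t = -velocity γ t := derivWithin.fun_neg
  rw [minusSide_eq, minusSide_eq, Filter.map_map]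
  refine Filter.map_congr (Eventually.of_forall fun p => ?_)
  simp only [collar, Function.comp, hv]
  ring

theorem mem_trace_neg {γ : ℝ → ℂ} {z : ℂ} : z ∈ trace (fun t => -γ t) ↔ -z ∈ trace γ := by
  constructor
  · rintro ⟨t, ht, rfl⟩
    exact ⟨t, ht, by simp⟩
  · rintro ⟨t, ht, h⟩
    exact ⟨t, ht, by simp [h]⟩

theorem IsArc.neg {γ : ℝ → ℂ} {a b : ℂ} (h : IsArc γ a b) :
    IsArc (fun t => -γ t) (-a) (-b) where
  contDiffOn := h.contDiffOn.neg
  regular t ht := by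
    rw [show derivWithin (fun t => -γ t) (Set.Icc 0 1) t = -derivWithin γ (Set.Icc 0 1) t from
      derivWithin.fun_neg]
    exact neg_ne_zero.2 (h.regular t ht)
  injOn x hx y hy hxy := h.injOn hx hy (neg_injective hxy)
  source := by rw [h.source]
  target := by rw [h.target]

theorem mem_plusImage_neg {γ : ℝ → ℂ} {ψ : ℂ → ℂ} {a b w : ℂ} :
    w ∈ plusImage (fun t => -γ t) (fun z => -ψ (-z)) (-a) (-b) ↔ -w ∈ plusImage γ ψ a b := by
  have h : ∀ t, Tendsto (fun z => -ψ (-z)) (plusSide (fun t => -γ t) t) (𝓝 w) ↔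
      Tendsto ψ (plusSide γ t) (𝓝 (-w)) := fun t => by
    rw [plusSide_neg, tendsto_map'_iff]
    constructor
    · intro h
      simpa [Function.comp_def] using h.neg
    · intro h
      simpa [Function.comp_def] using h.neg
  simp only [plusImage, Set.mem_union, Set.mem_ofPred_eq, h, Set.mem_insert_iff,
    Set.mem_singleton_iff, neg_eq_iff_eq_neg]

theorem GluedAlong.neg {γ : ℝ → ℂ} {f g : ℂ → ℂ} (h : GluedAlong γ f g) :
    GluedAlong (fun t => -γ t) (fun z => -f (-z)) (fun z => -g (-z)) := by
  intro t ht
  obtain ⟨⟨x, hx1, hx2⟩, y, hy1, hy2⟩ := h t ht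
  simp only [plusSide_neg, minusSide_neg, tendsto_map'_iff, Function.comp_def, neg_neg]
  exact ⟨⟨-x, hx1.neg, hx2.neg⟩, -y, hy1.neg, hy2.neg⟩

theorem critW_neg : critW 3 = -critW 1 ∧ critW 4 = -critW 2 := by
  obtain ⟨u, -, -, -, h1, h2, h3, h4⟩ := exists_critW_explicit
  exact ⟨by rw [h1, h3, neg_neg], by rw [h2, h4]⟩

theorem branchZ_neg : branchZ 3 = -branchZ 1 ∧ branchZ 4 = -branchZ 2 := by
  simp only [branchZ, critW_neg.1, critW_neg.2, zOf_neg, and_self]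

namespace Config

variable {γP γR : ℝ → ℂ} {ψP ψQ ψR : ℂ → ℂ}

theorem isClosed_cuts (c : Config γP γR ψP ψQ ψR) : IsClosed (cuts γP γR) :=
  c.arcP.isClosed_trace.union c.arcR.isClosed_trace

theorem not_mem_cuts_of_re_eq_zero (c : Config γP γR ψP ψQ ψR) {z : ℂ} (hz : z.re = 0) :
    z ∉ cuts γP γR := by
  rintro (h | h)
  · exact absurd hz ((re_pos_or_neg_of_mem_cuts c).1 z h).ne
  · exact absurd hz ((re_pos_or_neg_of_mem_cuts c).2 z h).ne'

theorem branchZ_mem (c : Config γP γR ψP ψQ ψR) {k : ℕ} (hk : k ∈ Finset.Icc 1 4) :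
    branchZ k ∈ cuts γP γR := by
  fin_cases hk
  · exact Or.inl ⟨0, by simp, c.arcP.source⟩
  · exact Or.inl ⟨1, by simp, c.arcP.target⟩
  · exact Or.inr ⟨0, by simp, c.arcR.source⟩
  · exact Or.inr ⟨1, by simp, c.arcR.target⟩

theorem ne_branchZ (c : Config γP γR ψP ψQ ψR) {z : ℂ} (hz : z ∉ cuts γP γR) :
    ∀ k ∈ Finset.Icc 1 4, z ≠ branchZ k :=
  fun _ hk e => hz (e ▸ c.branchZ_mem hk)

theorem arcP_ne_branchZ (c : Config γP γR ψP ψQ ψR) {t : ℝ} (ht : t ∈ Set.Ioo (0 : ℝ) 1) :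
    ∀ k ∈ Finset.Icc 1 4, γP t ≠ branchZ k := by
  have ht' := Set.Ioo_subset_Icc_self ht
  intro k hk e
  fin_cases hk
  · exact ht.1.ne' (c.arcP.injOn ht' (by simp) (e.trans c.arcP.source.symm))
  · exact ht.2.ne (c.arcP.injOn ht' (by simp) (e.trans c.arcP.target.symm))
  · have h1 := c.leftP t ht'
    rw [e.trans c.arcR.source.symm] at h1
    exact lt_asymm h1 (c.rightR 0 (by simp))
  · have h1 := c.leftP t ht'
    rw [e.trans c.arcR.target.symm] at h1
    exact lt_asymm h1 (c.rightR 1 (by simp))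

/-- Off the cuts the three sheets give the three distinct roots of the cubic. -/
theorem factor (c : Config γP γR ψP ψQ ψR) {z : ℂ} (hz : z ∉ cuts γP γR) (hz0 : z ≠ 0) :
    (∀ w, cubic z w = z * ((w - ψP z) * (w - ψQ z) * (w - ψR z))) ∧
      ψP z ≠ ψQ z ∧ ψP z ≠ ψR z ∧ ψQ z ≠ ψR z :=
  cubic_factor hz0 (c.ne_branchZ hz) (c.sheets.roots z hz hz0)

theorem isTriple (c : Config γP γR ψP ψQ ψR) {z : ℂ} (hz : z ∉ cuts γP γR) (hz0 : z ≠ 0) :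
    IsTriple (ψP z) (ψQ z) (ψR z) :=
  isTriple_of_factor hz0 (c.factor hz hz0).1

theorem mul_sum (c : Config γP γR ψP ψQ ψR) {z : ℂ} (hz : z ∉ cuts γP γR) (hz0 : z ≠ 0) :
    z * (ψP z + ψQ z + ψR z) = 1 := by
  have hf := (c.factor hz hz0).1
  have hp := hf 1
  have hm := hf (-1)
  have h0 := hf 0
  simp only [cubic] at hp hm h0
  linear_combination (hp + hm) / 2 - h0

theorem dense_compl_cuts (c : Config γP γR ψP ψQ ψR) : Dense (cuts γP γR ∪ {0})ᶜ := by
  rw [Set.compl_union, Set.compl_union]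
  refine (c.arcP.dense_compl_trace.inter_of_isOpen_left c.arcR.dense_compl_trace
    c.arcP.isClosed_trace.isOpen_compl).inter_of_isOpen_left (dense_compl_singleton 0) ?_
  exact c.arcP.isClosed_trace.isOpen_compl.inter c.arcR.isClosed_trace.isOpen_compl

theorem cubic_eq_zero_of_continuousAt (c : Config γP γR ψP ψQ ψR) {f : ℂ → ℂ}
    (hf : ∀ z, z ∉ cuts γP γR → z ≠ 0 → cubic z (f z) = 0) {z : ℂ} (hfz : ContinuousAt f z) :
    cubic z (f z) = 0 := by
  have hne : (𝓝[(cuts γP γR ∪ {0})ᶜ] z).NeBot :=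
    mem_closure_iff_nhdsWithin_neBot.1 (c.dense_compl_cuts z)
  exact cubic_eq_zero_of_tendsto (S := (cuts γP γR ∪ {0})ᶜ) le_rfl
    (fun y hy => hf y (fun h => hy (Or.inl h)) fun h => hy (Or.inr h)) (hfz.tendsto.mono_left nhdsWithin_le_nhds)

theorem cubic_P (c : Config γP γR ψP ψQ ψR) {z : ℂ} (hz : z ∉ trace γP) :
    cubic z (ψP z) = 0 :=
  c.cubic_eq_zero_of_continuousAt (fun y hy hy0 => by rw [(c.factor hy hy0).1]; simp)
    (c.sheets.analyticP z hz).continuousAt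

theorem cubic_R (c : Config γP γR ψP ψQ ψR) {z : ℂ} (hz : z ∉ trace γR) :
    cubic z (ψR z) = 0 :=
  c.cubic_eq_zero_of_continuousAt (fun y hy hy0 => by rw [(c.factor hy hy0).1]; simp)
    (c.sheets.analyticR z hz).continuousAt

theorem cubic_Q (c : Config γP γR ψP ψQ ψR) {z : ℂ} (hz : z ∉ cuts γP γR) (hz0 : z ≠ 0) :
    cubic z (ψQ z) = 0 := by
  rw [(c.factor hz hz0).1]; simp

theorem sides_le_P (c : Config γP γR ψP ψQ ψR) {t : ℝ} (ht : t ∈ Set.Ioo (0 : ℝ) 1)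
    {F : Filter ℂ} (hF : F = plusSide γP t ∨ F = minusSide γP t) :
    F ≤ 𝓝[(cuts γP γR ∪ {0})ᶜ] (γP t) := by
  have hle : F ≤ 𝓝[(trace γP)ᶜ] (γP t) := by
    rcases hF with rfl | rfl
    exacts [(c.arcP.sides_le ht).1, (c.arcP.sides_le ht).2]
  refine hle.trans ?_
  have hre : ∀ᶠ z in 𝓝 (γP t), z.re < 0 :=
    Complex.continuous_re.continuousAt.eventually
      (gt_mem_nhds (c.leftP t (Set.Ioo_subset_Icc_self ht)))
  refine le_inf nhdsWithin_le_nhds (le_principal_iff.2 ?_)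
  filter_upwards [self_mem_nhdsWithin, nhdsWithin_le_nhds hre] with z hz hzre
  rintro ((h | h) | h)
  · exact hz h
  · exact absurd ((re_pos_or_neg_of_mem_cuts c).2 z h) (not_lt.2 hzre.le)
  · rw [Set.mem_singleton_iff.1 h, Complex.zero_re] at hzre
    exact lt_irrefl _ hzre

/-- The first slit lies over the cut `γP`. -/
theorem mem_plusImage_P (c : Config γP γR ψP ψQ ψR) {w : ℂ}
    (hw : w ∈ plusImage γP ψP (critW 1) (critW 2)) : ∃ z ∈ trace γP, cubic z w = 0 := by
  rcases hw with ⟨t, ht, h⟩ | rfl | h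
  · exact ⟨γP t, mem_trace (Set.Ioo_subset_Icc_self ht), cubic_eq_zero_of_tendsto
      (c.sides_le_P ht (Or.inl rfl)) (fun y hy => c.cubic_P fun h => hy (Or.inl (Or.inl h))) h⟩
  · exact ⟨_, ⟨0, by simp, c.arcP.source⟩, cubic_branchZ (by decide)⟩
  · rw [Set.mem_singleton_iff.1 h]
    exact ⟨_, ⟨1, by simp, c.arcP.target⟩, cubic_branchZ (by decide)⟩

end Config

/-! ### Asymptotics and normalization of the square root -/

/-- Near infinity the square root is `w²` times the principal root of `3 + w⁻⁴`: the exterior of a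
disc is connected, and positivity on the real axis fixes the sign. Only the boundedness of the
slits `C` matters. -/
theorem exists_sqrt_asymptotics {s : ℂ → ℂ} {C : Set ℂ} (hC : ∀ᶠ w in Bornology.cobounded ℂ, w ∉ C)
    (hs : AnalyticOnNhd ℂ s Cᶜ) (hsq : ∀ w ∉ C, s w ^ 2 = 3 * w ^ 4 + 1)
    (hpos : ∀ᶠ x : ℝ in atTop, ∃ r : ℝ, 0 < r ∧ s (x : ℂ) = (r : ℂ)) :
    ∀ᶠ w in Bornology.cobounded ℂ, s w = w ^ 2 * (3 + (w ^ 4)⁻¹) ^ (1 / ((2 : ℕ) : ℂ)) := by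
  rw [← comap_norm_atTop, eventually_comap] at hC
  obtain ⟨R₀, hR₀⟩ := eventually_atTop.1 hC
  set R := max R₀ 1 with hR
  have hR0 : 0 < R := lt_max_of_lt_right one_pos
  have hw0 : ∀ w ∈ {w : ℂ | R < ‖w‖}, w ≠ 0 := by
    rintro w hw rfl
    exact absurd hw (by simp [hR0.le])
  have hwC : ∀ w ∈ {w : ℂ | R < ‖w‖}, w ∉ C := fun w hw =>
    hR₀ ‖w‖ ((le_max_left _ _).trans (le_of_lt hw)) w rfl
  have hval : ∀ w ∈ {w : ℂ | R < ‖w‖}, (s w / w ^ 2) ^ 2 = 3 + (w ^ 4)⁻¹ := fun w hw => by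
    have := hw0 w hw
    rw [div_pow, hsq w (hwC w hw)]
    field_simp
  obtain ⟨r, hr, hroot⟩ := exists_eq_mul_cpow (isPreconnected_exterior hR0)
    (f := fun w => s w / w ^ 2)
    (ContinuousOn.div (hs.continuousOn.mono hwC) (by fun_prop) fun w hw => pow_ne_zero _ (hw0 w hw))
    two_ne_zero fun w hw => by
      rw [hval w hw]
      refine Complex.mem_slitPlane_iff.2 (Or.inl ?_)
      have h1 : ‖(w ^ 4)⁻¹‖ ≤ 1 := by
        rw [norm_inv, norm_pow]
        exact inv_le_one_of_one_le₀ (one_le_pow₀ ((le_max_right _ _).trans (le_of_lt hw)))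
      have h2 := (abs_le.1 ((Complex.abs_re_le_norm _).trans h1)).1
      have h3 : (3 : ℂ).re = 3 := by norm_num
      rw [Complex.add_re, h3]
      linarith
  have hr1 : r = 1 := by
    obtain ⟨x, ⟨ρ, hρ, hx⟩, hxR⟩ := (hpos.and (eventually_gt_atTop R)).exists
    have hx0 : 0 < x := hR0.trans hxR
    have hmem : (x : ℂ) ∈ {w : ℂ | R < ‖w‖} := by
      show R < ‖(x : ℂ)‖
      rwa [Complex.norm_real, Real.norm_eq_abs, abs_of_pos hx0]
    have h1 := hroot x hmem
    have h2 : s (x : ℂ) / (x : ℂ) ^ 2 = ((ρ / x ^ 2 : ℝ) : ℂ) := by rw [hx]; push_cast; ring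
    have h3 : 0 < ρ / x ^ 2 := by positivity
    have h4 : ((((ρ / x ^ 2 : ℝ) : ℂ)) ^ 2) ^ (1 / ((2 : ℕ) : ℂ)) = ((ρ / x ^ 2 : ℝ) : ℂ) := by
      have := Complex.sq_cpow_two_inv (x := ((ρ / x ^ 2 : ℝ) : ℂ)) (by rwa [Complex.ofReal_re])
      rwa [show (1 / ((2 : ℕ) : ℂ)) = 2⁻¹ by norm_num]
    simp only [h2, h4] at h1
    have h5 : ((ρ / x ^ 2 : ℝ) : ℂ) ≠ 0 := Complex.ofReal_ne_zero.2 h3.ne'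
    exact (mul_right_cancel₀ h5 (by rw [one_mul]; exact h1)).symm
  rw [← comap_norm_atTop, eventually_comap]
  filter_upwards [eventually_gt_atTop R] with ρ hρ w hw
  have hmem : w ∈ {w : ℂ | R < ‖w‖} := by
    show R < ‖w‖
    rwa [hw]
  have h1 := hroot w hmem
  rw [hval w hmem, hr1, one_mul] at h1
  rw [← h1, mul_div_cancel₀ _ (pow_ne_zero 2 (hw0 w hmem))]

theorem re_eq_zero_of_cubic {z w : ℂ} (h : cubic z w = 0) (hw : w.re = 0) : z.re = 0 := by
  have hw0 := (ne_of_cubic_eq_zero h).1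
  obtain ⟨v, rfl⟩ : ∃ v : ℝ, w = v * Complex.I := ⟨w.im, by apply Complex.ext <;> simp [hw]⟩
  have hv : v ≠ 0 := by rintro rfl; simp at hw0
  have h1 : z * ((v ^ 3 + v : ℝ) : ℂ) = ((-(v ^ 2 + 1 / 3) : ℝ) : ℂ) * Complex.I := by
    simp only [cubic] at h
    push_cast
    linear_combination Complex.I * h - (z * v ^ 3 * (Complex.I ^ 2 - 1) - v ^ 2 * Complex.I
      - z * v) * Complex.I_sq
  have h2 := congrArg Complex.re h1
  rw [Complex.re_mul_ofReal, Complex.re_ofReal_mul, Complex.I_re, mul_zero] at h2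
  have h3 : v ^ 3 + v ≠ 0 := by
    have : v ^ 3 + v = v * (v ^ 2 + 1) := by ring
    rw [this]; positivity
  exact (mul_eq_zero.1 h2).resolve_right h3

namespace Config

variable {γP γR : ℝ → ℂ} {ψP ψQ ψR s : ℂ → ℂ}

/-- The symmetry `z ↦ -z`, `w ↦ -w` exchanges the sheets `P` and `R`. -/
theorem neg (c : Config γP γR ψP ψQ ψR) :
    Config (fun t => -γR t) (fun t => -γP t) (fun z => -ψR (-z)) (fun z => -ψQ (-z))
      (fun z => -ψP (-z)) where
  arcP := by
    have := c.arcR.neg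
    rwa [branchZ_neg.1, branchZ_neg.2, neg_neg, neg_neg] at this
  leftP t ht := by simpa using c.rightR t ht
  arcR := by
    have := c.arcP.neg
    rwa [← branchZ_neg.1, ← branchZ_neg.2] at this
  rightR t ht := by simpa using c.leftP t ht
  sheets :=
    { analyticP := fun z hz => by
        have h : -z ∈ (trace γR)ᶜ := fun h => hz (mem_trace_neg.2 h)
        exact ((c.sheets.analyticR (-z) h).fun_comp analyticAt_id.neg).neg
      analyticQ := fun z hz => by
        have h : -z ∈ (trace γP ∪ trace γR ∪ {0})ᶜ := by
          rintro ((h | h) | h)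
          · exact hz (Or.inl (Or.inr (mem_trace_neg.2 h)))
          · exact hz (Or.inl (Or.inl (mem_trace_neg.2 h)))
          · exact hz (Or.inr (neg_eq_zero.1 h))
        exact ((c.sheets.analyticQ (-z) h).fun_comp analyticAt_id.neg).neg
      analyticR := fun z hz => by
        have h : -z ∈ (trace γP)ᶜ := fun h => hz (mem_trace_neg.2 h)
        exact ((c.sheets.analyticP (-z) h).fun_comp analyticAt_id.neg).neg
      roots := fun z hz hz0 w => by
        have h : -z ∉ trace γP ∪ trace γR := by
          rintro (h | h)
          · exact hz (Or.inr (mem_trace_neg.2 h))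
          · exact hz (Or.inl (mem_trace_neg.2 h))
        have := c.sheets.roots (-z) h (neg_ne_zero.2 hz0) (-w)
        have hc := cubic_neg z w
        simp only [cubic] at hc
        rw [← hc, this, neg_eq_iff_eq_neg, neg_eq_iff_eq_neg, neg_eq_iff_eq_neg]
        tauto
      inftyP := by
        have := (c.sheets.inftyR.comp tendsto_neg_cobounded).neg
        simpa [Function.comp_def] using this
      inftyQ := by
        have := (c.sheets.inftyQ.comp tendsto_neg_cobounded).neg
        simpa [Function.comp_def] using this
      inftyR := by
        have := (c.sheets.inftyP.comp tendsto_neg_cobounded).neg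
        simpa [Function.comp_def] using this
      glueP := c.sheets.glueR.neg
      glueR := c.sheets.glueP.neg }

theorem mem_plusImage_R_iff {w : ℂ} : w ∈ plusImage γR ψR (critW 3) (critW 4) ↔
    -w ∈ plusImage (fun t => -γR t) (fun z => -ψR (-z)) (critW 1) (critW 2) := by
  have := mem_plusImage_neg (γ := γR) (ψ := ψR) (a := critW 3) (b := critW 4) (w := -w)
  rw [critW_neg.1, critW_neg.2, neg_neg, neg_neg, neg_neg, ← critW_neg.1, ← critW_neg.2] at this
  exact this.symm

theorem mem_plusImage_R (c : Config γP γR ψP ψQ ψR) {w : ℂ}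
    (hw : w ∈ plusImage γR ψR (critW 3) (critW 4)) : ∃ z ∈ trace γR, cubic z w = 0 := by
  obtain ⟨z, hz, h⟩ := c.neg.mem_plusImage_P (mem_plusImage_R_iff.1 hw)
  exact ⟨-z, mem_trace_neg.1 hz, by rw [← cubic_neg, neg_neg, h]⟩

theorem exists_of_mem_slits (c : Config γP γR ψP ψQ ψR) {w : ℂ}
    (hw : w ∈ slits γP γR ψP ψR) : ∃ z ∈ cuts γP γR, cubic z w = 0 := by
  rcases hw with hw | hw
  · obtain ⟨z, hz, h⟩ := c.mem_plusImage_P hw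
    exact ⟨z, Or.inl hz, h⟩
  · obtain ⟨z, hz, h⟩ := c.mem_plusImage_R hw
    exact ⟨z, Or.inr hz, h⟩

theorem not_mem_slits (c : Config γP γR ψP ψQ ψR) {z w : ℂ} (hz : z ∉ cuts γP γR)
    (h : cubic z w = 0) : w ∉ slits γP γR ψP ψR := by
  intro hw
  obtain ⟨z', hz', h'⟩ := c.exists_of_mem_slits hw
  exact hz (eq_of_cubic_eq_zero h h' ▸ hz')

/-- The points over `z = ∞` do not lie on the slits. -/
theorem not_mem_slits_of_pole (c : Config γP γR ψP ψQ ψR) {w : ℂ}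
    (hw : w = 0 ∨ w - 1 = 0 ∨ w + 1 = 0) : w ∉ slits γP γR ψP ψR := by
  intro h
  obtain ⟨z, -, h'⟩ := c.exists_of_mem_slits h
  obtain ⟨h0, h1, h2⟩ := ne_of_cubic_eq_zero h'
  tauto

theorem eventually_not_mem_slits (c : Config γP γR ψP ψQ ψR) :
    ∀ᶠ w in Bornology.cobounded ℂ, w ∉ slits γP γR ψP ψR := by
  have h0 : (0 : ℂ) ∈ (cuts γP γR)ᶜ := c.not_mem_cuts_of_re_eq_zero Complex.zero_re
  filter_upwards [tendsto_zOf_cobounded.eventually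
    (c.isClosed_cuts.isOpen_compl.mem_nhds h0)] with w hw
  by_cases hp : w = 0 ∨ w - 1 = 0 ∨ w + 1 = 0
  · exact c.not_mem_slits_of_pole hp
  · push Not at hp
    exact c.not_mem_slits hw ((zOf_eq_iff hp.1 hp.2.1 hp.2.2).1 rfl)

theorem sqrt_eventually_eq (c : Config γP γR ψP ψQ ψR) (hs : IsSqrtBranch γP γR ψP ψR s) :
    ∀ᶠ w in Bornology.cobounded ℂ, s w = w ^ 2 * (3 + (w ^ 4)⁻¹) ^ (1 / ((2 : ℕ) : ℂ)) :=
  exists_sqrt_asymptotics c.eventually_not_mem_slits hs.analytic hs.sq hs.pos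

theorem tendsto_inv_pow_cobounded {n : ℕ} (hn : n ≠ 0) :
    Tendsto (fun w : ℂ => (w ^ n)⁻¹) (Bornology.cobounded ℂ) (𝓝 0) := by
  have := (tendsto_inv₀_cobounded (α := ℂ)).pow n
  simpa [hn] using this

theorem tendsto_sqrt_div_sq (c : Config γP γR ψP ψQ ψR) (hs : IsSqrtBranch γP γR ψP ψR s) :
    Tendsto (fun w => s w / w ^ 2) (Bornology.cobounded ℂ) (𝓝 (3 ^ (1 / ((2 : ℕ) : ℂ)))) := by
  have h1 : Tendsto (fun w : ℂ => 3 + (w ^ 4)⁻¹) (Bornology.cobounded ℂ) (𝓝 3) := by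
    simpa using (tendsto_inv_pow_cobounded four_ne_zero).const_add (3 : ℂ)
  have h3 : (3 : ℂ) ∈ Complex.slitPlane := Complex.mem_slitPlane_iff.2 (Or.inl (by norm_num))
  refine ((continuousAt_cpow_const h3).tendsto.comp h1).congr' ?_
  filter_upwards [c.sqrt_eventually_eq hs, 
    tendsto_norm_cobounded_atTop.eventually (eventually_gt_atTop 0)] with w hw hw0
  rw [hw, mul_div_cancel_left₀ _ (pow_ne_zero 2 (norm_pos_iff.1 hw0))]
  rfl

/-- The symmetry carries the square root to the square root of the reflected configuration; it stays
positive for large positive `w` because it is even near infinity. -/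
theorem sqrt_neg (c : Config γP γR ψP ψQ ψR) (hs : IsSqrtBranch γP γR ψP ψR s) :
    IsSqrtBranch (fun t => -γR t) (fun t => -γP t) (fun z => -ψR (-z)) (fun z => -ψP (-z))
      (fun w => s (-w)) := by
  have hmem : ∀ {w : ℂ}, w ∉ plusImage (fun t => -γR t) (fun z => -ψR (-z)) (critW 1) (critW 2) ∪
      plusImage (fun t => -γP t) (fun z => -ψP (-z)) (critW 3) (critW 4) →
      -w ∉ slits γP γR ψP ψR := by
    rintro w hw (h | h)
    · refine hw (Or.inr ?_)
      rw [critW_neg.1, critW_neg.2, mem_plusImage_neg]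
      exact h
    · refine hw (Or.inl ?_)
      rw [mem_plusImage_R_iff, neg_neg] at h
      exact h
  refine ⟨fun w hw => ?_, fun w hw => ?_, ?_⟩
  · exact (hs.analytic (-w) (hmem hw)).fun_comp analyticAt_id.neg
  · rw [hs.sq _ (hmem hw)]; ring
  · have h1 := c.sqrt_eventually_eq hs
    have h2 : Tendsto (fun x : ℝ => (x : ℂ)) atTop (Bornology.cobounded ℂ) :=
      tendsto_norm_atTop_iff_cobounded.1 (by simpa using tendsto_abs_atTop_atTop)
    filter_upwards [hs.pos, h2.eventually h1, (tendsto_neg_cobounded.comp h2).eventually h1]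
      with x hx hx1 hx2
    obtain ⟨r, hr, hxr⟩ := hx
    refine ⟨r, hr, ?_⟩
    rw [← hxr, hx1]
    refine hx2.trans ?_
    simp only [Function.comp]
    norm_num

/-- On the imaginary axis the square root cannot change sign, and it is negative far out, since it
behaves like `√3 w²`. -/
theorem sqrt_zero (c : Config γP γR ψP ψQ ψR) (hs : IsSqrtBranch γP γR ψP ψR s) : s 0 = -1 := by
  have hmem : ∀ v : ℝ, (v : ℂ) * Complex.I ∉ slits γP γR ψP ψR := by
    intro v hv
    obtain ⟨z, hz, h⟩ := c.exists_of_mem_slits hv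
    exact c.not_mem_cuts_of_re_eq_zero (re_eq_zero_of_cubic h (by simp)) hz
  have hsq : ∀ v : ℝ, s (v * Complex.I) ^ 2 = ((3 * v ^ 4 + 1 : ℝ) : ℂ) := fun v => by
    rw [hs.sq _ (hmem v), mul_pow, Complex.I_pow_four]; push_cast; ring
  have hsl : ∀ v : ℝ, s (v * Complex.I) ^ 2 ∈ Complex.slitPlane := fun v => by
    rw [hsq]
    refine Complex.mem_slitPlane_iff.2 (Or.inl ?_)
    rw [Complex.ofReal_re]; positivity
  have hcont : ContinuousOn (fun v : ℝ => s (v * Complex.I)) Set.univ := by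
    refine ContinuousOn.comp (t := (slits γP γR ψP ψR)ᶜ) hs.analytic.continuousOn
      (by fun_prop) fun v _ => hmem v
  obtain ⟨r, hr, hroot⟩ := exists_eq_mul_cpow isPreconnected_univ hcont two_ne_zero
    fun v _ => hsl v
  have hvI : Tendsto (fun v : ℝ => (v : ℂ) * Complex.I) atTop (Bornology.cobounded ℂ) :=
    tendsto_norm_atTop_iff_cobounded.1 (by simpa using tendsto_abs_atTop_atTop)
  obtain ⟨v, hv, hv0⟩ :=
    ((hvI.eventually (c.sqrt_eventually_eq hs)).and (eventually_gt_atTop 0)).exists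
  have hr1 : r ≠ 1 := by
    rintro rfl
    have h1 : 0 < (s (v * Complex.I)).re := by
      rw [hroot v trivial, one_mul]
      exact re_cpow_half_pos (hsl v)
    have h2 : (3 + (((v : ℂ) * Complex.I) ^ 4)⁻¹) = ((3 + (v ^ 4)⁻¹ : ℝ) : ℂ) := by
      rw [mul_pow, Complex.I_pow_four]; push_cast; ring
    have h3 : ((v : ℂ) * Complex.I) ^ 2 = ((-v ^ 2 : ℝ) : ℂ) := by
      rw [mul_pow, Complex.I_sq]; push_cast; ring
    rw [hv, h2, h3, Complex.re_ofReal_mul] at h1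
    have h4 : ((3 + (v ^ 4)⁻¹ : ℝ) : ℂ) ∈ Complex.slitPlane := by
      refine Complex.mem_slitPlane_iff.2 (Or.inl ?_)
      rw [Complex.ofReal_re]; positivity
    have h5 := mul_pos (show 0 < v ^ 2 by positivity) (re_cpow_half_pos h4)
    linarith
  have hr2 : r = -1 := (sq_eq_one_iff.1 hr).resolve_left hr1
  have h0 := hroot 0 trivial
  simp only [hsq, hr2] at h0
  simpa using h0

theorem sqrt_ne_zero (c : Config γP γR ψP ψQ ψR) (hs : IsSqrtBranch γP γR ψP ψR s) {z w : ℂ}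
    (hz : z ∉ cuts γP γR) (h : cubic z w = 0) : s w ≠ 0 := by
  intro h0
  have := hs.sq w (c.not_mem_slits hz h)
  rw [h0, zero_pow two_ne_zero] at this
  exact quartic_ne_zero (c.ne_branchZ hz) h this.symm

end Config

/-! ### Boundary values on the left arc -/

/-- The boundary values at `γP t`: `a` and `b` are those of `ψP` from the left and from the right,
`σ` and `ω` are the limits of the square root at the point `a` of its slit, taken from the images
of the sheets `P` and `Q` respectively. -/
structure BoundaryValues (γP γR : ℝ → ℂ) (ψP ψQ ψR s : ℂ → ℂ) (t : ℝ) (a b σ ω : ℂ) : Prop where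
  P_plus : Tendsto ψP (plusSide γP t) (𝓝 a)
  Q_minus : Tendsto ψQ (minusSide γP t) (𝓝 a)
  Q_plus : Tendsto ψQ (plusSide γP t) (𝓝 b)
  P_minus : Tendsto ψP (minusSide γP t) (𝓝 b)
  factor : ∀ w, cubic (γP t) w = γP t * ((w - a) * (w - b) * (w - ψR (γP t)))
  quartic_a : 3 * a ^ 4 + 1 ≠ 0
  quartic_b : 3 * b ^ 4 + 1 ≠ 0
  quartic_R : 3 * ψR (γP t) ^ 4 + 1 ≠ 0
  not_mem_b : b ∉ slits γP γR ψP ψR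
  not_mem_R : ψR (γP t) ∉ slits γP γR ψP ψR
  sqrt_plus : Tendsto (fun z => s (ψP z)) (plusSide γP t) (𝓝 σ)
  sqrt_minus : Tendsto (fun z => s (ψQ z)) (minusSide γP t) (𝓝 ω)
  sq_plus : σ ^ 2 = 3 * a ^ 4 + 1
  sq_minus : ω ^ 2 = 3 * a ^ 4 + 1

/-- If the sum and the product of two functions tend to those of a double root `l`, both functions
tend to `l`. -/
theorem tendsto_of_add_of_mul {X : Type*} {F : Filter X} {f g : X → ℂ} {l : ℂ}
    (hadd : Tendsto (fun x => f x + g x) F (𝓝 (2 * l)))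
    (hmul : Tendsto (fun x => (f x - l) * (g x - l)) F (𝓝 0)) :
    Tendsto f F (𝓝 l) ∧ Tendsto g F (𝓝 l) := by
  have hsq : Tendsto (fun x => (f x - g x) ^ 2) F (𝓝 0) := by
    have h := ((hadd.sub_const (2 * l)).pow 2).sub (hmul.const_mul 4)
    simp only [sub_self, zero_pow two_ne_zero, mul_zero] at h
    refine h.congr fun x => by ring
  have hdiff : Tendsto (fun x => f x - g x) F (𝓝 0) := by
    rw [tendsto_zero_iff_norm_tendsto_zero] at hsq ⊢
    have := hsq.sqrt
    rw [Real.sqrt_zero] at this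
    refine this.congr fun x => ?_
    rw [norm_pow, Real.sqrt_sq (norm_nonneg _)]
  constructor
  · have := (hadd.add hdiff).div_const 2
    rw [add_zero, mul_div_cancel_left₀ l two_ne_zero] at this
    exact this.congr fun x => by ring
  · have := (hadd.sub hdiff).div_const 2
    rw [sub_zero, mul_div_cancel_left₀ l two_ne_zero] at this
    exact this.congr fun x => by ring

/-- The third root of the cubic at the first branch point. -/
def thirdRoot : ℂ := (3 * critW 1 ^ 3 - critW 1) / 2

/-- At the first branch point the cubic has the double root `critW 1` and the simple root
`thirdRoot`. -/
theorem branchZ_factor : ∃ z₁ : ℂ, z₁ = branchZ 1 ∧ z₁ ≠ 0 ∧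
    3 * z₁ * critW 1 ^ 2 - 2 * critW 1 - z₁ = 0 ∧ critW 1 ^ 3 - critW 1 ≠ 0 ∧
    critW 1 ≠ thirdRoot ∧
    z₁ * (2 * critW 1 + thirdRoot) = 1 ∧
    ∀ w, cubic z₁ w = z₁ * ((w - critW 1) ^ 2 * (w - thirdRoot)) := by
  have h4 := critW_pow_four (k := 1) (by decide)
  have hc := cubic_branchZ (k := 1) (by decide)
  set w₁ := critW 1
  set z₁ := branchZ 1
  obtain ⟨h0, h1, h2⟩ := ne_of_cubic_eq_zero hc
  have hne : w₁ ^ 3 - w₁ ≠ 0 := by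
    have : w₁ ^ 3 - w₁ = w₁ * (w₁ - 1) * (w₁ + 1) := by ring
    rw [this]
    exact mul_ne_zero (mul_ne_zero h0 h1) h2
  simp only [cubic] at hc
  have hder : 3 * z₁ * w₁ ^ 2 - 2 * w₁ - z₁ = 0 := by
    refine mul_left_cancel₀ hne ?_
    linear_combination h4 + (3 * w₁ ^ 2 - 1) * hc
  have hsum : z₁ * (2 * w₁ + thirdRoot) = 1 := by
    rw [thirdRoot]
    refine mul_left_cancel₀ h0 ?_
    linear_combination (3 / 2 * z₁) * h4 + (1 / 2 : ℂ) * hder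
  have hz : z₁ ≠ 0 := by
    intro h
    rw [h, zero_mul] at hsum
    exact zero_ne_one hsum
  refine ⟨z₁, rfl, hz, hder, hne, ?_, hsum, fun w => ?_⟩
  · intro h
    rw [thirdRoot] at h
    have h5 : w₁ ^ 2 = 1 := mul_left_cancel₀ h0 (by linear_combination -(2 / 3 : ℂ) * h)
    have h6 : w₁ ^ 4 = 1 := by rw [show w₁ ^ 4 = (w₁ ^ 2) ^ 2 by ring, h5]; ring
    rw [h6] at h4
    norm_num at h4
  · have e2 : w₁ ^ 2 + 2 * w₁ * thirdRoot = -1 := by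
      rw [thirdRoot]; linear_combination 3 * h4
    have e3 : z₁ * (w₁ ^ 2 * thirdRoot) = -(1 / 3) := by
      linear_combination w₁ ^ 2 * hsum + hc - w₁ * hder
    simp only [cubic]
    linear_combination w ^ 2 * hsum - z₁ * w * e2 + e3

namespace Config

variable {γP γR : ℝ → ℂ} {ψP ψQ ψR s : ℂ → ℂ}

theorem P_not_mem_R (c : Config γP γR ψP ψQ ψR) {t : ℝ} (ht : t ∈ Set.Icc (0 : ℝ) 1) :
    γP t ∉ trace γR := fun h =>
  lt_asymm (c.leftP t ht) ((re_pos_or_neg_of_mem_cuts c).2 _ h)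

theorem arcP_ne_zero (c : Config γP γR ψP ψQ ψR) {t : ℝ} (ht : t ∈ Set.Icc (0 : ℝ) 1) :
    γP t ≠ 0 := fun h => by
  have := c.leftP t ht
  rw [h, Complex.zero_re] at this
  exact lt_irrefl _ this

theorem continuousOn_sqrt_comp (c : Config γP γR ψP ψQ ψR) (hs : IsSqrtBranch γP γR ψP ψR s) :
    ContinuousOn (fun z => s (ψP z)) (cuts γP γR ∪ {0})ᶜ ∧
      ContinuousOn (fun z => s (ψQ z)) (cuts γP γR ∪ {0})ᶜ := by
  constructor
  · refine hs.analytic.continuousOn.comp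
      (c.sheets.analyticP.continuousOn.mono fun z hz h => hz (Or.inl (Or.inl h))) fun z hz => ?_
    exact c.not_mem_slits (fun h => hz (Or.inl h)) (c.cubic_P fun h => hz (Or.inl (Or.inl h)))
  · refine hs.analytic.continuousOn.comp c.sheets.analyticQ.continuousOn fun z hz => ?_
    exact c.not_mem_slits (fun h => hz (Or.inl h))
      (c.cubic_Q (fun h => hz (Or.inl h)) fun h => hz (Or.inr h))

/-- Only one of the three points over `γP t` lies on the slits, the boundary value of `ψP` from the
left. -/
theorem not_mem_slits_of_ne (c : Config γP γR ψP ψQ ψR) {t : ℝ} (ht : t ∈ Set.Ioo (0 : ℝ) 1)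
    {a w : ℂ} (ha : Tendsto ψP (plusSide γP t) (𝓝 a)) (hw : cubic (γP t) w = 0) (hwa : w ≠ a) :
    w ∉ slits γP γR ψP ψR := by
  have hb := c.arcP_ne_branchZ ht
  rintro ((⟨t', ht', h⟩ | h | h) | h)
  · have h1 : cubic (γP t') w = 0 := cubic_eq_zero_of_tendsto
      (c.sides_le_P ht' (Or.inl rfl)) (fun y hy => c.cubic_P fun h => hy (Or.inl (Or.inl h))) h
    have h2 := c.arcP.injOn (Set.Ioo_subset_Icc_self ht) (Set.Ioo_subset_Icc_self ht')
      (eq_of_cubic_eq_zero hw h1)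
    rw [← h2] at h
    exact hwa (tendsto_nhds_unique h ha)
  · rw [h] at hw
    exact hb 1 (by decide) (eq_of_cubic_eq_zero hw (cubic_branchZ (by decide)))
  · rw [Set.mem_singleton_iff.1 h] at hw
    exact hb 2 (by decide) (eq_of_cubic_eq_zero hw (cubic_branchZ (by decide)))
  · obtain ⟨z, hz, h'⟩ := c.mem_plusImage_R h
    rw [← eq_of_cubic_eq_zero hw h'] at hz
    exact c.P_not_mem_R (Set.Ioo_subset_Icc_self ht) hz

theorem exists_boundaryValues (c : Config γP γR ψP ψQ ψR) (hs : IsSqrtBranch γP γR ψP ψR s)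
    {t : ℝ} (ht : t ∈ Set.Ioo (0 : ℝ) 1) :
    ∃ a b σ ω, BoundaryValues γP γR ψP ψQ ψR s t a b σ ω := by
  obtain ⟨⟨a, ha1, ha2⟩, b, hb1, hb2⟩ := c.sheets.glueP t ht
  have htI := Set.Ioo_subset_Icc_self ht
  have hp := c.sides_le_P ht (Or.inl rfl)
  have hm := c.sides_le_P ht (Or.inr rfl)
  have hmemp : (cuts γP γR ∪ {0})ᶜ ∈ plusSide γP t := hp self_mem_nhdsWithin
  have hmemm : (cuts γP γR ∪ {0})ᶜ ∈ minusSide γP t := hm self_mem_nhdsWithin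
  have hz : Tendsto (fun y : ℂ => y) (plusSide γP t) (𝓝 (γP t)) :=
    tendsto_id'.2 (hp.trans nhdsWithin_le_nhds)
  have hR : Tendsto ψR (plusSide γP t) (𝓝 (ψR (γP t))) :=
    (c.sheets.analyticR _ (c.P_not_mem_R htI)).continuousAt.tendsto.comp hz
  have hfac : ∀ w, cubic (γP t) w = γP t * ((w - a) * (w - b) * (w - ψR (γP t))) := by
    intro w
    have h1 := hz.mul (((hb1.const_sub w).mul (hR.const_sub w)).mul (ha1.const_sub w))
    have h2 : Tendsto (fun z => cubic z w) (plusSide γP t) (𝓝 (cubic (γP t) w)) := by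
      have : Continuous fun z => cubic z w := by unfold cubic; fun_prop
      exact (this.tendsto _).comp hz
    have h3 := tendsto_nhds_unique (h2.congr' ?_) h1
    · rw [h3]; ring
    · filter_upwards [hmemp] with z hz
      rw [(c.factor (fun h => hz (Or.inl h)) fun h => hz (Or.inr h)).1]
      ring
  have hq : ∀ {w}, cubic (γP t) w = 0 → 3 * w ^ 4 + 1 ≠ 0 := fun h =>
    quartic_ne_zero (c.arcP_ne_branchZ ht) h
  have hqa := hq (w := a) (by rw [hfac]; simp)
  have hqb := hq (w := b) (by rw [hfac]; simp)
  have hqR := hq (w := ψR (γP t)) (by rw [hfac]; simp)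
  have htri := isTriple_of_factor (c.arcP_ne_zero htI) hfac
  have hba : b ≠ a := by
    rintro rfl
    exact hqb (by rw [htri.quartic]; simp)
  have hRa : ψR (γP t) ≠ a := by
    intro h
    exact hqR (by rw [htri.rotate.quartic, h]; simp)
  have hsq : ∀ {F : Filter ℂ} {f : ℂ → ℂ}, (cuts γP γR ∪ {0})ᶜ ∈ F →
      (∀ z ∈ (cuts γP γR ∪ {0})ᶜ, cubic z (f z) = 0) → Tendsto f F (𝓝 a) →
      Tendsto (fun z => s (f z) ^ 2) F (𝓝 (3 * a ^ 4 + 1)) := by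
    intro F f hF hf hfa
    refine (((hfa.pow 4).const_mul 3).add_const 1).congr' ?_
    filter_upwards [hF] with z hz
    exact (hs.sq _ (c.not_mem_slits (fun h => hz (Or.inl h)) (hf z hz))).symm
  have hsqP := hsq hmemp (fun z hz => c.cubic_P fun h => hz (Or.inl (Or.inl h))) ha1
  have hsqQ := hsq hmemm
    (fun z hz => c.cubic_Q (fun h => hz (Or.inl h)) fun h => hz (Or.inr h)) ha2
  obtain ⟨σ, hσ⟩ := c.arcP.exists_tendsto_of_sq ht (Or.inl rfl) hmemp
    (c.continuousOn_sqrt_comp hs).1 hqa hsqP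
  obtain ⟨ω, hω⟩ := c.arcP.exists_tendsto_of_sq ht (Or.inr rfl) hmemm
    (c.continuousOn_sqrt_comp hs).2 hqa hsqQ
  exact ⟨a, b, σ, ω, ha1, ha2, hb1, hb2, hfac, hqa, hqb, hqR,
    c.not_mem_slits_of_ne ht ha1 (by rw [hfac]; simp) hba,
    c.not_mem_slits_of_ne ht ha1 (by rw [hfac]; simp) hRa, hσ, hω,
    tendsto_nhds_unique (hσ.pow 2) hsqP, tendsto_nhds_unique (hω.pow 2) hsqQ⟩

theorem branchZ_one_not_mem_R (c : Config γP γR ψP ψQ ψR) : branchZ 1 ∉ trace γR := by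
  rw [← c.arcP.source]; exact c.P_not_mem_R (by simp)

/-- On the sheet `R` the value over `z₁` is the simple root: an analytic inverse of `z(w)` cannot
take the value `w₁`, where `z'(w₁) = 0`. -/
theorem R_branchZ_one (c : Config γP γR ψP ψQ ψR) : ψR (branchZ 1) = thirdRoot := by
  obtain ⟨z₁, hz₁, hz0, hder, hne, -, -, hfac⟩ := branchZ_factor
  have hroot := c.cubic_R c.branchZ_one_not_mem_R
  rw [← hz₁, hfac] at hroot
  rcases mul_eq_zero.1 ((mul_eq_zero.1 hroot).resolve_left hz0) with h | h
  · have hw : ψR z₁ = critW 1 := sub_eq_zero.1 (pow_eq_zero_iff two_ne_zero |>.1 h)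
    have hmem : z₁ ∈ (trace γR)ᶜ := hz₁ ▸ c.branchZ_one_not_mem_R
    have hd := (c.sheets.analyticR z₁ hmem).differentiableAt.hasDerivAt
    have hzero : (fun z => cubic z (ψR z)) =ᶠ[𝓝 z₁] fun _ => 0 := by
      filter_upwards [c.arcR.isClosed_trace.isOpen_compl.mem_nhds hmem] with z hz
      exact c.cubic_R hz
    have h1 : HasDerivAt (fun z => cubic z (ψR z)) 0 z₁ :=
      (hasDerivAt_const z₁ (0 : ℂ)).congr_of_eventuallyEq hzero
    have h2 : HasDerivAt (fun z => z * ψR z ^ 3 - ψR z ^ 2 - z * ψR z + 1 / 3) _ z₁ :=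
      ((((hasDerivAt_id z₁).mul (hd.pow 3)).sub (hd.pow 2)).sub
        ((hasDerivAt_id z₁).mul hd)).add_const (1 / 3 : ℂ)
    have h3 := h1.unique h2
    simp only [Pi.pow_apply, id, hw] at h3
    refine absurd ?_ hne
    push_cast at h3
    linear_combination -h3 - deriv ψR z₁ * hder
  · rw [← hz₁]
    exact sub_eq_zero.1 h

theorem eventually_mem_compl_cuts (c : Config γP γR ψP ψQ ψR) :
    (cuts γP γR ∪ {0})ᶜ ∈ 𝓝[(trace γP)ᶜ] (branchZ 1) := by
  obtain ⟨z₁, hz₁, hz0, -⟩ := branchZ_factor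
  filter_upwards [self_mem_nhdsWithin, nhdsWithin_le_nhds
    (c.arcR.isClosed_trace.isOpen_compl.mem_nhds c.branchZ_one_not_mem_R),
    nhdsWithin_le_nhds (isOpen_compl_singleton.mem_nhds (hz₁ ▸ hz0))] with z h1 h2 h3
  rintro ((h | h) | h)
  exacts [h1 h, h2 h, h3 h]

/-- The sheets `P` and `Q` branch at `z₁`. -/
theorem tendsto_branchZ_one (c : Config γP γR ψP ψQ ψR) :
    Tendsto ψP (𝓝[(trace γP)ᶜ] (branchZ 1)) (𝓝 (critW 1)) ∧
      Tendsto ψQ (𝓝[(trace γP)ᶜ] (branchZ 1)) (𝓝 (critW 1)) := by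
  obtain ⟨z₁, hz₁, hz0, -, -, hw, hsum, hfac⟩ := branchZ_factor
  have hmem := c.eventually_mem_compl_cuts
  have hR := (c.sheets.analyticR _ c.branchZ_one_not_mem_R).continuousAt.tendsto
  rw [c.R_branchZ_one] at hR
  rw [← hz₁] at hmem hR ⊢
  have hR' : Tendsto ψR (𝓝[(trace γP)ᶜ] z₁) (𝓝 thirdRoot) := hR.mono_left nhdsWithin_le_nhds
  have hz : Tendsto (fun z : ℂ => z) (𝓝[(trace γP)ᶜ] z₁) (𝓝 z₁) := nhdsWithin_le_nhds
  refine tendsto_of_add_of_mul ?_ ?_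
  · have h1 := (hz.inv₀ hz0).sub hR'
    have h2 : z₁⁻¹ - thirdRoot = 2 * critW 1 := by
      rw [inv_eq_of_mul_eq_one_right hsum]; ring
    rw [h2] at h1
    refine h1.congr' ?_
    filter_upwards [hmem] with z hz
    have hz0 : z ≠ 0 := fun h => hz (Or.inr h)
    rw [inv_eq_of_mul_eq_one_right (c.mul_sum (fun h => hz (Or.inl h)) hz0)]
    ring
  · have h1 : Tendsto (fun z => cubic z (critW 1)) (𝓝[(trace γP)ᶜ] z₁) (𝓝 0) := by
      have hc : Continuous fun z => cubic z (critW 1) := by unfold cubic; fun_prop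
      have := (hc.tendsto z₁).comp hz
      rwa [hfac, sub_self, zero_pow two_ne_zero, zero_mul, mul_zero] at this
    have hwR : critW 1 - thirdRoot ≠ 0 := sub_ne_zero.2 hw
    have h2 := h1.div (hz.mul (hR'.const_sub (critW 1))) (mul_ne_zero hz0 hwR)
    rw [zero_div] at h2
    refine h2.congr' ?_
    filter_upwards [hmem, (hR'.const_sub (critW 1)).eventually_ne hwR] with z hz hzR
    have hz0 : z ≠ 0 := fun h => hz (Or.inr h)
    simp only [Pi.div_apply]
    rw [(c.factor (fun h => hz (Or.inl h)) hz0).1]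
    field_simp
    ring

/-- On both sheets `P`, `Q` the fourth power of the square root, `(3w⁴+1)²`, behaves like
`K (z - z₁)` at the branch point, with the same `K`. -/
theorem tendsto_sqrt_pow_four (c : Config γP γR ψP ψQ ψR) (hs : IsSqrtBranch γP γR ψP ψR s) :
    ∃ K : ℂ, K ≠ 0 ∧
      Tendsto (fun z => s (ψP z) ^ 4 / (z - branchZ 1)) (𝓝[(trace γP)ᶜ] (branchZ 1)) (𝓝 K) ∧
      Tendsto (fun z => s (ψQ z) ^ 4 / (z - branchZ 1)) (𝓝[(trace γP)ᶜ] (branchZ 1)) (𝓝 K) := by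
  obtain ⟨z₁, hz₁, hz0, -, hne, hw, hsum, hfac⟩ := branchZ_factor
  have h4 := critW_pow_four (k := 1) (by decide)
  have hw0 : critW 1 ≠ 0 := by
    intro h; rw [h] at h4; norm_num at h4
  have hmem := c.eventually_mem_compl_cuts
  have hmemP : z₁ ∈ trace γP := ⟨0, by simp, by rw [hz₁, c.arcP.source]⟩
  have hlim := c.tendsto_branchZ_one
  rw [← hz₁] at hmem hlim ⊢
  have hwR : critW 1 - thirdRoot ≠ 0 := sub_ne_zero.2 hw
  have main : ∀ f : ℂ → ℂ, Tendsto f (𝓝[(trace γP)ᶜ] z₁) (𝓝 (critW 1)) →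
      (∀ z ∈ (cuts γP γR ∪ {0})ᶜ, cubic z (f z) = 0) →
      Tendsto (fun z => s (f z) ^ 4 / (z - z₁)) (𝓝[(trace γP)ᶜ] z₁)
        (𝓝 (-(critW 1 ^ 3 - critW 1) / (z₁ * (critW 1 - thirdRoot)) *
          (3 * ((critW 1 + critW 1) * (critW 1 ^ 2 + critW 1 ^ 2))) ^ 2)) := by
    intro f hf hroot
    have h1 := (((hf.pow 3).sub hf).neg.div ((hf.sub_const thirdRoot).const_mul z₁)
      (mul_ne_zero hz0 hwR)).mul
      ((((hf.add_const (critW 1)).mul ((hf.pow 2).add_const (critW 1 ^ 2))).const_mul 3).pow 2)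
    refine h1.congr' ?_
    filter_upwards [hmem, self_mem_nhdsWithin, (hf.sub_const thirdRoot).eventually_ne hwR] with
      z hz hzP hzR
    have hzne : z - z₁ ≠ 0 := fun h => hzP (sub_eq_zero.1 h ▸ hmemP)
    have hc := hroot z hz
    have hsq := hs.sq _ (c.not_mem_slits (fun h => hz (Or.inl h)) hc)
    have hs4 : s (f z) ^ 4 = (3 * f z ^ 4 + 1) ^ 2 := by rw [← hsq]; ring
    have hq : 3 * f z ^ 4 + 1 =
        (f z - critW 1) * (3 * ((f z + critW 1) * (f z ^ 2 + critW 1 ^ 2))) := by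
      linear_combination 3 * h4
    have hrel : z₁ * ((f z - critW 1) ^ 2 * (f z - thirdRoot)) =
        -(z - z₁) * (f z ^ 3 - f z) := by
      rw [← hfac]
      simp only [cubic] at hc ⊢
      linear_combination hc
    have hkey : -(f z ^ 3 - f z) / (z₁ * (f z - thirdRoot)) = (f z - critW 1) ^ 2 / (z - z₁) := by
      rw [div_eq_div_iff (mul_ne_zero hz0 hzR) hzne]
      linear_combination -hrel
    show -(f z ^ 3 - f z) / (z₁ * (f z - thirdRoot)) * _ = _
    rw [hkey, hs4, hq]
    ring
  refine ⟨_, ?_, main ψP hlim.1 fun z hz => c.cubic_P fun h => hz (Or.inl (Or.inl h)),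
    main ψQ hlim.2 fun z hz => c.cubic_Q (fun h => hz (Or.inl h)) fun h => hz (Or.inr h)⟩
  refine mul_ne_zero (div_ne_zero (neg_ne_zero.2 hne) (mul_ne_zero hz0 hwR)) ?_
  have : 3 * ((critW 1 + critW 1) * (critW 1 ^ 2 + critW 1 ^ 2)) = 12 * critW 1 ^ 3 := by ring
  rw [this]
  exact pow_ne_zero _ (mul_ne_zero (by norm_num) (pow_ne_zero _ hw0))

/-- The square root changes sign across its slit: its two limits at `a t` are `σ t` and `-σ t`.
Moreover its value at the point `b t` of the sheet `P` on the right of the cut differs from `σ t` by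
nearly a quarter turn when `γP t` is close to `z₁`. -/
theorem exists_boundaryValues_neg (c : Config γP γR ψP ψQ ψR)
    (hs : IsSqrtBranch γP γR ψP ψR s) : ∃ a b σ : ℝ → ℂ,
      (∀ t ∈ Set.Ioo (0 : ℝ) 1,
        BoundaryValues γP γR ψP ψQ ψR s t (a t) (b t) (σ t) (-σ t)) ∧
      Tendsto (fun t => s (b t) / σ t) (𝓝[>] 0) (𝓝 Complex.I) := by
  have hex : ∀ t : ℝ, ∃ a b σ ω : ℂ, t ∈ Set.Ioo (0 : ℝ) 1 →
      BoundaryValues γP γR ψP ψQ ψR s t a b σ ω := fun t => by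
    by_cases ht : t ∈ Set.Ioo (0 : ℝ) 1
    · obtain ⟨a, b, σ, ω, h⟩ := c.exists_boundaryValues hs ht
      exact ⟨a, b, σ, ω, fun _ => h⟩
    · exact ⟨0, 0, 0, 0, fun h => absurd h ht⟩
  choose a b σ ω hB using hex
  obtain ⟨K, hK, hKP, hKQ⟩ := c.tendsto_sqrt_pow_four hs
  have hre : (branchZ 1).re < 0 := by
    rw [← c.arcP.source]; exact c.leftP 0 (by simp)
  have hU : {z : ℂ | z.re < 0} ∈ 𝓝 (branchZ 1) :=
    (isOpen_lt Complex.continuous_re continuous_const).mem_nhds hre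
  have hsub : {z : ℂ | z.re < 0} ∩ (trace γP)ᶜ ⊆ (cuts γP γR ∪ {0})ᶜ := by
    rintro z ⟨hz, hzP⟩ ((h | h) | h)
    · exact hzP h
    · exact lt_asymm hz ((re_pos_or_neg_of_mem_cuts c).2 z h)
    · rw [Set.mem_singleton_iff.1 h] at hz
      exact lt_irrefl (0 : ℝ) hz
  have hcont := c.continuousOn_sqrt_comp hs
  have hsb : ∀ t ∈ Set.Ioo (0 : ℝ) 1, ContinuousAt s (b t) := fun t ht =>
    (hs.analytic _ (hB t ht).not_mem_b).continuousAt
  have h1 := c.arcP.tendsto_boundaryValue_ratio hK hU (hcont.1.mono hsub) hKP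
    (fun t ht => (hB t ht).sqrt_plus)
    fun t ht => (hsb t ht).tendsto.comp (hB t ht).P_minus
  have h2 := c.arcP.tendsto_boundaryValue_ratio hK hU (hcont.2.mono hsub) hKQ
    (fun t ht => (hsb t ht).tendsto.comp (hB t ht).Q_plus)
    fun t ht => (hB t ht).sqrt_minus
  have hσ0 : ∀ t ∈ Set.Ioo (0 : ℝ) 1, σ t ≠ 0 := fun t ht h => (hB t ht).quartic_a (by
    rw [← (hB t ht).sq_plus, h, zero_pow two_ne_zero])
  have hσc : ContinuousOn σ (Set.Ioo 0 1) :=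
    c.arcP.continuousOn_boundaryValue (Or.inl rfl) fun t ht => (hB t ht).sqrt_plus
  have hωc : ContinuousOn ω (Set.Ioo 0 1) :=
    c.arcP.continuousOn_boundaryValue (Or.inr rfl) fun t ht => (hB t ht).sqrt_minus
  have hsq : Set.EqOn (ω ^ 2) (σ ^ 2) (Set.Ioo 0 1) := fun t ht => by
    simp only [Pi.pow_apply]
    rw [(hB t ht).sq_plus, (hB t ht).sq_minus]
  rcases isPreconnected_Ioo.eq_or_eq_neg_of_sq_eq hωc hσc hsq (fun {t} ht => hσ0 t ht) with h | h
  · -- two turns around `z₁`, one on each sheet, multiply the square root by `i² = -1`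
    have h3 := h1.mul h2
    rw [Complex.I_mul_I] at h3
    have h4 : Tendsto (fun t => s (b t) / σ t * (ω t / s (b t))) (𝓝[>] 0) (𝓝 1) := by
      refine tendsto_const_nhds.congr' ?_
      filter_upwards [Ioo_mem_nhdsGT (zero_lt_one' ℝ)] with t ht
      have hb0 : s (b t) ≠ 0 := fun h0 => (hB t ht).quartic_b (by
        rw [← hs.sq _ (hB t ht).not_mem_b, h0, zero_pow two_ne_zero])
      rw [h ht]
      have := hσ0 t ht
      field_simp
    have := tendsto_nhds_unique h3 h4
    norm_num at this
  · refine ⟨a, b, σ, fun t ht => ?_, h1⟩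
    have := hB t ht
    rwa [h ht] at this

end Config

/-! ### The sign of the square root at the points over infinity -/

/-- A `±1`-valued function on a dense set which is constant near each point of a preconnected set
is constant there. -/
theorem exists_sign_of_isPreconnected {S D : Set ℂ} (hS : IsPreconnected S) (hD : Dense D)
    {k : ℂ → ℂ} (hk : ∀ z ∈ S, (∀ᶠ y in 𝓝[D] z, k y = 1) ∨ ∀ᶠ y in 𝓝[D] z, k y = -1) :
    ∃ ε : ℂ, (ε = 1 ∨ ε = -1) ∧ ∀ z ∈ S, ∀ᶠ y in 𝓝[D] z, k y = ε := by
  have hopen : ∀ ε : ℂ, IsOpen {z | ∀ᶠ y in 𝓝[D] z, k y = ε} := fun ε =>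
    isOpen_iff_mem_nhds.2 fun z hz => eventually_nhds_nhdsWithin.2 hz
  have hdisj : S ∩ ({z | ∀ᶠ y in 𝓝[D] z, k y = 1} ∩ {z | ∀ᶠ y in 𝓝[D] z, k y = -1}) = ∅ := by
    refine Set.eq_empty_iff_forall_notMem.2 fun z hz => ?_
    have : (𝓝[D] z).NeBot := mem_closure_iff_nhdsWithin_neBot.1 (hD z)
    have h1 : ∀ᶠ y in 𝓝[D] z, k y = 1 := hz.2.1
    have h2 : ∀ᶠ y in 𝓝[D] z, k y = -1 := hz.2.2
    obtain ⟨y, hy1, hy2⟩ := (h1.and h2).exists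
    rw [hy1] at hy2
    norm_num at hy2
  rcases isPreconnected_iff_subset_of_disjoint.1 hS _ _ (hopen 1) (hopen (-1))
    (fun z hz => hk z hz) hdisj with h | h
  · exact ⟨1, Or.inl rfl, h⟩
  · exact ⟨-1, Or.inr rfl, h⟩

theorem eventually_eq_of_sq_eq_one {F : Filter ℂ} [F.NeBot] {k : ℂ → ℂ} {l : ℂ}
    (hk : Tendsto k F (𝓝 l)) (hsq : ∀ᶠ y in F, k y ^ 2 = 1) :
    (∀ᶠ y in F, k y = 1) ∨ ∀ᶠ y in F, k y = -1 := by
  have hl : l ^ 2 = 1 := tendsto_nhds_unique (hk.pow 2)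
    (tendsto_const_nhds.congr' (hsq.mono fun y hy => hy.symm))
  have hev := hk.eventually (Metric.ball_mem_nhds l one_pos)
  have hne : ∀ y, dist (k y) l < 1 → k y ≠ -l := fun y hy h => by
    have hl1 : ‖l‖ = 1 := by
      have := congrArg norm hl
      rw [norm_pow, norm_one] at this
      exact (pow_eq_one_iff_of_nonneg (norm_nonneg l) two_ne_zero).1 this
    rw [h, dist_eq_norm, show -l - l = -(2 * l) by ring, norm_neg, norm_mul, hl1] at hy
    norm_num at hy
  rcases sq_eq_one_iff.1 hl with rfl | rfl
  · left
    filter_upwards [hev, hsq] with y hy hy2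
    exact (sq_eq_one_iff.1 hy2).resolve_right (hne y hy)
  · right
    filter_upwards [hev, hsq] with y hy hy2
    exact (sq_eq_one_iff.1 hy2).resolve_left fun h => hne y hy (by rw [h, neg_neg])

/-- A half-plane with two points removed is the homeomorphic image of a plane with at most two
points removed. -/
theorem isPreconnected_halfPlane_diff (p q : ℂ) :
    IsPreconnected ({z : ℂ | z.re < 0} \ {p, q}) := by
  set f : ℂ → ℂ := fun z => -(Real.exp z.re : ℂ) + z.im * Complex.I with hf
  have hre : ∀ z, (f z).re = -Real.exp z.re := fun z => by
    simp only [hf, Complex.add_re, Complex.neg_re, Complex.ofReal_re, Complex.re_ofReal_mul,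
      Complex.I_re, mul_zero, add_zero]
  have him : ∀ z, (f z).im = z.im := fun z => by
    simp only [hf, Complex.add_im, Complex.neg_im, Complex.ofReal_im, Complex.im_ofReal_mul,
      Complex.I_im, mul_one, neg_zero, zero_add]
  have hinj : Function.Injective f := fun x y hxy => by
    refine Complex.ext (Real.exp_injective (neg_injective ?_)) ?_
    · rw [← hre x, hxy, hre]
    · rw [← him x, hxy, him]
  have hcont : Continuous f := by fun_prop
  have hset : {z : ℂ | z.re < 0} \ {p, q} = f '' (f ⁻¹' {p, q})ᶜ := by
    ext z
    constructor
    · rintro ⟨hz, hzpq⟩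
      have hz' : z.re < 0 := hz
      have hfz : f ⟨Real.log (-z.re), z.im⟩ = z := by
        refine Complex.ext ?_ (him _)
        rw [hre, Real.exp_log (by linarith), neg_neg]
      refine ⟨⟨Real.log (-z.re), z.im⟩, fun h => hzpq ?_, hfz⟩
      rwa [Set.mem_preimage, hfz] at h
    · rintro ⟨y, hy, rfl⟩
      refine ⟨?_, hy⟩
      show (f y).re < 0
      rw [hre]
      exact neg_neg_of_pos (Real.exp_pos _)
  rw [hset]
  refine IsPreconnected.image ?_ _ hcont.continuousOn
  refine (Set.Countable.isConnected_compl_of_one_lt_rank ?_ ?_).isPreconnected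
  · rw [Complex.rank_real_complex]; norm_num
  · exact ((Set.toFinite {p, q}).preimage hinj.injOn).countable

/-- If `3w⁴+1 ≤ 0`, then `w` lies on a diagonal `Im w = ± Re w`, where `Re z(w)` has the sign of
`Re w`. -/
theorem mem_slitPlane_of_cubic {z w : ℂ} (hz : z.re < 0) (hw : 0 < w.re) (h : cubic z w = 0) :
    3 * w ^ 4 + 1 ∈ Complex.slitPlane := by
  obtain ⟨x, y⟩ := z
  obtain ⟨p, q⟩ := w
  simp only at hz hw
  rw [Complex.mem_slitPlane_iff]
  by_contra hcon
  push Not at hcon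
  obtain ⟨h1, h2⟩ := hcon
  have e1 : ((3 : ℂ) * (⟨p, q⟩ : ℂ) ^ 4 + 1).re = 3 * (p ^ 4 - 6 * p ^ 2 * q ^ 2 + q ^ 4) + 1 := by
    simp [pow_succ, Complex.mul_re, Complex.mul_im]
    ring
  have e2 : ((3 : ℂ) * (⟨p, q⟩ : ℂ) ^ 4 + 1).im = 12 * (p * q * (p ^ 2 - q ^ 2)) := by
    simp [pow_succ, Complex.mul_re, Complex.mul_im]
    ring
  rw [e1] at h1
  rw [e2] at h2
  have hre := congrArg Complex.re h
  have him := congrArg Complex.im h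
  simp [cubic, pow_succ, Complex.mul_re, Complex.mul_im] at hre him
  have hq : q ≠ 0 := by
    rintro rfl
    have : 0 < p ^ 4 := by positivity
    nlinarith
  have hpq : q ^ 2 = p ^ 2 := by
    have : p * q ≠ 0 := mul_ne_zero hw.ne' hq
    have h3 : p * q * (p ^ 2 - q ^ 2) = 0 := by linarith
    have := (mul_eq_zero.1 h3).resolve_left this
    linarith
  have hp4 : 0 < 4 * p ^ 4 - 4 / 3 * p ^ 2 + 1 / 3 := by
    nlinarith [sq_nonneg (p ^ 2 - 1 / 6)]
  have hfin : x * (8 * p ^ 6 + 2 * p ^ 2) = p * (4 * p ^ 4 - 4 / 3 * p ^ 2 + 1 / 3) := by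
    rcases sq_eq_sq_iff_eq_or_eq_neg.1 hpq with rfl | rfl
    · linear_combination (-(2 * q ^ 3 + q)) * hre + (2 * q ^ 3 - q) * him
    · linear_combination (-(2 * p ^ 3 + p)) * hre - (2 * p ^ 3 - p) * him
  have : x * (8 * p ^ 6 + 2 * p ^ 2) < 0 := mul_neg_of_neg_of_pos hz (by positivity)
  have := mul_pos hw hp4
  linarith

/-- The value of the principal square root at the third root over `z₁`, and its relation to the
other quantities entering the sign computation. -/
theorem thirdRoot_sqrt (hre : 0 < thirdRoot.re) :
    2 * (3 * thirdRoot ^ 4 + 1) ^ (1 / ((2 : ℕ) : ℂ)) =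
      Complex.I * ((3 * critW 1 ^ 2 - 1) * (critW 1 - thirdRoot) * (3 * thirdRoot ^ 2 - 1)) := by
  obtain ⟨u, hu0, hu1, hu4, hw, -⟩ := exists_critW_explicit
  have h4 := critW_pow_four (k := 1) (by decide)
  -- `-3 i w₁² = √3`
  have hr : -3 * Complex.I * critW 1 ^ 2 = ((6 * u.re ^ 2 : ℝ) : ℂ) := by
    rw [hw]
    apply Complex.ext
    · simp [pow_succ, Complex.mul_re, Complex.mul_im, ← hu1]; ring
    · simp [pow_succ, Complex.mul_re, Complex.mul_im, ← hu1]
  have hsq : 3 * thirdRoot ^ 4 + 1 = (-3 * Complex.I * critW 1 ^ 2 * thirdRoot) ^ 2 := by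
    rw [thirdRoot]
    linear_combination (3 - 135 / 16 * critW 1 ^ 4 + 243 / 16 * critW 1 ^ 8) * h4 -
      9 * critW 1 ^ 4 * ((3 * critW 1 ^ 3 - critW 1) / 2) ^ 2 * Complex.I_sq
  have hpos : 0 < (-3 * Complex.I * critW 1 ^ 2 * thirdRoot).re := by
    rw [hr, Complex.re_ofReal_mul]
    positivity
  rw [hsq, show (1 / ((2 : ℕ) : ℂ)) = 2⁻¹ by norm_num, Complex.sq_cpow_two_inv hpos, thirdRoot]
  linear_combination Complex.I * (-9 / 2 * critW 1 + 243 / 8 * critW 1 ^ 3 -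
    243 / 4 * critW 1 ^ 5 + 243 / 8 * critW 1 ^ 7) * h4

namespace Config

variable {γP γR : ℝ → ℂ} {ψP ψQ ψR s : ℂ → ℂ}

theorem mem_compl_cuts (c : Config γP γR ψP ψQ ψR) {z : ℂ} (hz : z.re < 0) (hzP : z ∉ trace γP) :
    z ∈ (cuts γP γR ∪ {0})ᶜ := by
  rintro ((h | h) | h)
  · exact hzP h
  · exact lt_asymm hz ((re_pos_or_neg_of_mem_cuts c).2 z h)
  · rw [Set.mem_singleton_iff.1 h] at hz
    exact lt_irrefl (0 : ℝ) hz

theorem not_mem_trace_R (c : Config γP γR ψP ψQ ψR) {z : ℂ} (hz : z.re < 0) : z ∉ trace γR :=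
  fun h => lt_asymm hz ((re_pos_or_neg_of_mem_cuts c).2 z h)

theorem tendsto_neg_ofReal_cobounded :
    Tendsto (fun x : ℝ => -(x : ℂ)) atTop (Bornology.cobounded ℂ) :=
  tendsto_norm_atTop_iff_cobounded.1 (by simpa using tendsto_abs_atTop_atTop)

/-- The sheet `R` maps the left half-plane into the right one, since no point of the imaginary
axis is mapped there by `z(w)`. -/
theorem re_R_pos (c : Config γP γR ψP ψQ ψR) {z : ℂ} (hz : z.re < 0) : 0 < (ψR z).re := by
  by_contra hcon
  have hcont : ContinuousOn (fun z => (ψR z).re) {z : ℂ | z.re < 0} :=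
    Complex.continuous_re.comp_continuousOn
      (c.sheets.analyticR.continuousOn.mono fun z hz => c.not_mem_trace_R hz)
  have h1 : Tendsto (fun x : ℝ => (ψR (-(x : ℂ))).re) atTop (𝓝 1) := by
    have := (Complex.continuous_re.tendsto 1).comp
      (c.sheets.inftyR.comp tendsto_neg_ofReal_cobounded)
    exact this
  obtain ⟨x, hx, hx0⟩ := ((h1.eventually (lt_mem_nhds one_pos)).and
    (eventually_gt_atTop (0 : ℝ))).exists
  have hxm : -(x : ℂ) ∈ {z : ℂ | z.re < 0} := by
    show (-(x : ℂ)).re < 0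
    simpa using hx0
  obtain ⟨y, hy, hy0⟩ := (convex_halfSpace_re_lt 0).isPreconnected.intermediate_value hz hxm hcont
    ⟨not_lt.1 hcon, hx.le⟩
  exact (ne_of_lt hy) (re_eq_zero_of_cubic (c.cubic_R (c.not_mem_trace_R hy)) hy0)

theorem mem_slitPlane_R (c : Config γP γR ψP ψQ ψR) {z : ℂ} (hz : z.re < 0) :
    3 * ψR z ^ 4 + 1 ∈ Complex.slitPlane :=
  mem_slitPlane_of_cubic hz (c.re_R_pos hz) (c.cubic_R (c.not_mem_trace_R hz))

/-- On the left half-plane the product of the square roots on the sheets `P` and `Q` is, up to a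
constant sign, an explicit function of the three sheets. -/
theorem exists_sign (c : Config γP γR ψP ψQ ψR) (hs : IsSqrtBranch γP γR ψP ψR s) :
    ∃ ε : ℂ, (ε = 1 ∨ ε = -1) ∧ ∀ z : ℂ, z.re < 0 → z ∉ trace γP →
      s (ψP z) * s (ψQ z) * (3 * ψR z ^ 2 - 1) =
        ε * (2 * (ψP z - ψQ z) * (3 * ψR z ^ 4 + 1) ^ (1 / ((2 : ℕ) : ℂ))) := by
  obtain ⟨a, b, σ, hB, -⟩ := c.exists_boundaryValues_neg hs
  set S : ℂ → ℂ := fun z => (3 * ψR z ^ 4 + 1) ^ (1 / ((2 : ℕ) : ℂ)) with hSdef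
  have hS2 : ∀ z, S z ^ 2 = 3 * ψR z ^ 4 + 1 := fun z => by
    simp only [hSdef, one_div]
    exact Complex.cpow_nat_inv_pow _ two_ne_zero
  have hS0 : ∀ z : ℂ, z.re < 0 → S z ≠ 0 := fun z hz h =>
    Complex.slitPlane_ne_zero (c.mem_slitPlane_R hz) (by rw [← hS2, h, zero_pow two_ne_zero])
  have hRc : ∀ z : ℂ, z.re < 0 → ContinuousAt ψR z := fun z hz =>
    (c.sheets.analyticR z (c.not_mem_trace_R hz)).continuousAt
  have hSc : ∀ z : ℂ, z.re < 0 → ContinuousAt S z := fun z hz =>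
    ((((hRc z hz).pow 4).const_mul 3).add_const 1).cpow continuousAt_const (c.mem_slitPlane_R hz)
  set D := (cuts γP γR ∪ {0})ᶜ with hD
  have hDopen : IsOpen D := (c.isClosed_cuts.union isClosed_singleton).isOpen_compl
  set M : ℂ → ℂ := fun z => 2 * (ψP z - ψQ z) * S z with hM
  set k : ℂ → ℂ := fun z => s (ψP z) * s (ψQ z) * (3 * ψR z ^ 2 - 1) / M z with hk
  have hM0 : ∀ z : ℂ, z.re < 0 → z ∈ D → M z ≠ 0 := fun z hz hzD =>
    mul_ne_zero (mul_ne_zero two_ne_zero (sub_ne_zero.2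
      (c.factor (fun h => hzD (Or.inl h)) fun h => hzD (Or.inr h)).2.1)) (hS0 z hz)
  have hksq : ∀ z : ℂ, z.re < 0 → z ∈ D → k z ^ 2 = 1 := by
    intro z hz hzD
    have hzc : z ∉ cuts γP γR := fun h => hzD (Or.inl h)
    have hz0 : z ≠ 0 := fun h => hzD (Or.inr h)
    have ht := c.isTriple hzc hz0
    have hsP := hs.sq _ (c.not_mem_slits hzc (c.cubic_P fun h => hzc (Or.inl h)))
    have hsQ := hs.sq _ (c.not_mem_slits hzc (c.cubic_Q hzc hz0))
    have q1 := ht.quartic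
    have q2 := ht.swap.quartic
    have q3 := ht.rotate.quartic
    have q4 := ht.prod_sq
    simp only [hk, hM]
    rw [div_pow, div_eq_one_iff_eq (pow_ne_zero 2 (hM0 z hz hzD)), mul_pow, mul_pow, hsP, hsQ,
      mul_pow, hS2, q1, q2, q3]
    linear_combination (-(ψP z - ψQ z) ^ 2 * (ψP z - ψR z) * (ψQ z - ψR z)
      * (3 * ψR z ^ 2 - 1)) * q4
  have hev : ∀ z : ℂ, z.re < 0 → ∀ᶠ y in 𝓝 z, y.re < 0 := fun z hz =>
    Complex.continuous_re.continuousAt.eventually (gt_mem_nhds hz)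
  have hloc : ∀ z ∈ {z : ℂ | z.re < 0} \ {branchZ 1, branchZ 2},
      (∀ᶠ y in 𝓝[D] z, k y = 1) ∨ ∀ᶠ y in 𝓝[D] z, k y = -1 := by
    rintro z ⟨hz, hzb⟩
    have hne : (𝓝[D] z).NeBot := mem_closure_iff_nhdsWithin_neBot.1 (c.dense_compl_cuts z)
    have hsq : ∀ᶠ y in 𝓝[D] z, k y ^ 2 = 1 := by
      filter_upwards [self_mem_nhdsWithin, nhdsWithin_le_nhds (hev z hz)] with y hyD hy
      exact hksq y hy hyD
    by_cases hzP : z ∈ trace γP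
    · obtain ⟨t, htI, rfl⟩ := hzP
      have ht : t ∈ Set.Ioo (0 : ℝ) 1 := by
        refine ⟨lt_of_le_of_ne htI.1 ?_, lt_of_le_of_ne htI.2 ?_⟩
        · rintro rfl; exact hzb (Or.inl c.arcP.source)
        · rintro rfl; exact hzb (Or.inr c.arcP.target)
      have B := hB t ht
      have hab : a t - b t ≠ 0 := fun h => B.quartic_a (by
        rw [(isTriple_of_factor (c.arcP_ne_zero htI) B.factor).quartic, h]; simp)
      have hsb := (hs.analytic _ B.not_mem_b).continuousAt.tendsto
      set l := σ t * s (b t) * (3 * ψR (γP t) ^ 2 - 1) / (2 * (a t - b t) * S (γP t)) with hl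
      have hp : Tendsto k (plusSide γP t) (𝓝 l) := by
        have h1 : Tendsto ψR (plusSide γP t) (𝓝 (ψR (γP t))) :=
          (hRc _ hz).tendsto.mono_left (c.arcP.plusSide_le ht)
        have h2 : Tendsto S (plusSide γP t) (𝓝 (S (γP t))) :=
          (hSc _ hz).tendsto.mono_left (c.arcP.plusSide_le ht)
        exact ((B.sqrt_plus.mul (hsb.comp B.Q_plus)).mul
          (((h1.pow 2).const_mul 3).sub_const 1)).div
          (((B.P_plus.sub B.Q_plus).const_mul 2).mul h2)
          (mul_ne_zero (mul_ne_zero two_ne_zero hab) (hS0 _ hz))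
      have hm : Tendsto k (minusSide γP t) (𝓝 l) := by
        have h1 : Tendsto ψR (minusSide γP t) (𝓝 (ψR (γP t))) :=
          (hRc _ hz).tendsto.mono_left (c.arcP.minusSide_le ht)
        have h2 : Tendsto S (minusSide γP t) (𝓝 (S (γP t))) :=
          (hSc _ hz).tendsto.mono_left (c.arcP.minusSide_le ht)
        have h3 := (((hsb.comp B.P_minus).mul B.sqrt_minus).mul
          (((h1.pow 2).const_mul 3).sub_const 1)).div
          (((B.P_minus.sub B.Q_minus).const_mul 2).mul h2)
          (mul_ne_zero (mul_ne_zero two_ne_zero (by rw [← neg_sub]; exact neg_ne_zero.2 hab))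
            (hS0 _ hz))
        have h4 : s (b t) * -σ t * (3 * ψR (γP t) ^ 2 - 1) /
            (2 * (b t - a t) * S (γP t)) = l := by
          rw [hl, ← neg_div_neg_eq]
          congr 1 <;> ring
        rw [h4] at h3
        exact h3
      refine eventually_eq_of_sq_eq_one (l := l) ?_ hsq
      have hle : 𝓝[D] (γP t) ≤ 𝓝[(trace γP)ᶜ] (γP t) :=
        nhdsWithin_mono _ fun y hy h => hy (Or.inl (Or.inl h))
      exact (hp.sup hm).mono_left (hle.trans (c.arcP.nhdsWithin_le_sides ht))
    · have hzD := c.mem_compl_cuts hz hzP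
      have hDn := hDopen.mem_nhds hzD
      have h1 := (c.continuousOn_sqrt_comp hs).1.continuousAt hDn
      have h2 := (c.continuousOn_sqrt_comp hs).2.continuousAt hDn
      have h3 := (c.sheets.analyticP z hzP).continuousAt
      have h4 := (c.sheets.analyticQ z hzD).continuousAt
      have hkc : ContinuousAt k z :=
        ((h1.mul h2).mul ((((hRc z hz).pow 2).const_mul 3).sub_const 1)).div
          (((h3.sub h4).const_mul 2).mul (hSc z hz)) (hM0 z hz hzD)
      exact eventually_eq_of_sq_eq_one (hkc.tendsto.mono_left nhdsWithin_le_nhds) hsq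
  obtain ⟨ε, hε, hconst⟩ := exists_sign_of_isPreconnected
    (isPreconnected_halfPlane_diff (branchZ 1) (branchZ 2)) c.dense_compl_cuts hloc
  refine ⟨ε, hε, fun z hz hzP => ?_⟩
  have hzD := c.mem_compl_cuts hz hzP
  have hzb : z ∉ ({branchZ 1, branchZ 2} : Set ℂ) := by
    rintro (rfl | h)
    · exact hzP ⟨0, by simp, c.arcP.source⟩
    · exact hzP ⟨1, by simp, c.arcP.target.trans (Set.mem_singleton_iff.1 h).symm⟩
  have := (hconst z ⟨hz, hzb⟩).self_of_nhdsWithin hzD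
  exact (div_eq_iff (hM0 z hz hzD)).1 this

/-- At the point `-1` over infinity the square root equals `2`: the sign is transported to the
branch point `z₁` and read off from the turning of the boundary values there. -/
theorem sqrt_neg_one (c : Config γP γR ψP ψQ ψR) (hs : IsSqrtBranch γP γR ψP ψR s) :
    s (-1) = 2 := by
  obtain ⟨ε, hε, hsign⟩ := c.exists_sign hs
  have hs0 := c.sqrt_zero hs
  -- the sign at infinity
  have hinf : s (-1) = 2 * ε := by
    have hx := tendsto_neg_ofReal_cobounded
    have hP := c.sheets.inftyP.comp hx
    have hQ := c.sheets.inftyQ.comp hx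
    have hR := c.sheets.inftyR.comp hx
    have hsP := (hs.analytic _ (c.not_mem_slits_of_pole
      (w := -1) (by simp))).continuousAt.tendsto.comp hP
    have hsQ := (hs.analytic _ (c.not_mem_slits_of_pole
      (w := 0) (by simp))).continuousAt.tendsto.comp hQ
    have h4 : (3 : ℂ) * 1 ^ 4 + 1 ∈ Complex.slitPlane :=
      Complex.mem_slitPlane_iff.2 (Or.inl (by norm_num))
    have hS := (continuousAt_cpow_const (b := 1 / ((2 : ℕ) : ℂ)) h4).tendsto.comp
      (((hR.pow 4).const_mul 3).add_const 1)
    have h1 := (hsP.mul hsQ).mul (((hR.pow 2).const_mul 3).sub_const 1)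
    have h2 := ((((hP.sub hQ).const_mul 2).mul hS)).const_mul ε
    have h3 : (fun x : ℝ => s (ψP (-(x : ℂ))) * s (ψQ (-(x : ℂ))) * (3 * ψR (-(x : ℂ)) ^ 2 - 1))
        =ᶠ[atTop] fun x : ℝ => ε * (2 * (ψP (-(x : ℂ)) - ψQ (-(x : ℂ))) *
          (3 * ψR (-(x : ℂ)) ^ 4 + 1) ^ (1 / ((2 : ℕ) : ℂ))) := by
      have hbdd := hx.eventually (Bornology.isBounded_def.1 c.arcP.isCompact_trace.isBounded)
      filter_upwards [hbdd, eventually_gt_atTop 0] with x hxP hx0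
      exact hsign _ (by simpa using hx0) hxP
    have h5 := tendsto_nhds_unique (h1.congr' h3) h2
    have h6 : ((3 : ℂ) * 1 ^ 4 + 1) ^ (1 / ((2 : ℕ) : ℂ)) = 2 := by
      rw [show (3 : ℂ) * 1 ^ 4 + 1 = 2 ^ 2 by norm_num,
        show (1 / ((2 : ℕ) : ℂ)) = 2⁻¹ by norm_num, Complex.sq_cpow_two_inv (by norm_num)]
    rw [h6, hs0] at h5
    linear_combination -h5 / 2
  -- the sign at the branch point
  obtain ⟨a, b, σ, hB, hturn⟩ := c.exists_boundaryValues_neg hs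
  have hre : (branchZ 1).re < 0 := by
    rw [← c.arcP.source]; exact c.leftP 0 (by simp)
  have hRre := c.re_R_pos hre
  have hsl := c.mem_slitPlane_R hre
  have hR0 := (c.sheets.analyticR _ c.branchZ_one_not_mem_R).continuousAt.tendsto
  rw [c.R_branchZ_one] at hR0 hRre hsl
  have hnum := thirdRoot_sqrt hRre
  have hR : Tendsto ψR (𝓝[(trace γP)ᶜ] (branchZ 1)) (𝓝 thirdRoot) :=
    hR0.mono_left nhdsWithin_le_nhds
  have hQ := c.tendsto_branchZ_one.2
  have hS := (continuousAt_cpow_const (b := 1 / ((2 : ℕ) : ℂ)) hsl).tendsto.comp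
    (((hR.pow 4).const_mul 3).add_const 1)
  have hden0 : (3 * critW 1 ^ 2 - 1) * (critW 1 - thirdRoot) * (3 * thirdRoot ^ 2 - 1) ≠ 0 := by
    intro h
    rw [h, mul_zero] at hnum
    have := re_cpow_half_pos hsl
    rw [(mul_eq_zero.1 hnum).resolve_left two_ne_zero] at this
    exact lt_irrefl (0 : ℝ) this
  have hden := ((((hQ.pow 2).const_mul 3).sub_const 1).mul (hQ.sub hR)).mul
    (((hR.pow 2).const_mul 3).sub_const 1)
  have hρ : Tendsto (fun z => s (ψP z) / s (ψQ z)) (𝓝[(trace γP)ᶜ] (branchZ 1))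
      (𝓝 (-ε * Complex.I)) := by
    have h1 := ((hS.const_mul 2).div hden hden0).const_mul (-ε)
    rw [hnum, mul_div_assoc, div_self hden0, mul_one] at h1
    refine h1.congr' ?_
    filter_upwards [self_mem_nhdsWithin, c.eventually_mem_compl_cuts, nhdsWithin_le_nhds
      (Complex.continuous_re.continuousAt.eventually (gt_mem_nhds hre)),
      hden.eventually_ne hden0] with z hzP hzD hz hz0
    have hzc : z ∉ cuts γP γR := fun h => hzD (Or.inl h)
    have hzz : z ≠ 0 := fun h => hzD (Or.inr h)
    have hrel := hsign z hz hzP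
    have hq := (c.isTriple hzc hzz).swap.quartic
    have hsQ := hs.sq _ (c.not_mem_slits hzc (c.cubic_Q hzc hzz))
    have hsQ0 := c.sqrt_ne_zero hs hzc (c.cubic_Q hzc hzz)
    have hPQ : ψP z - ψQ z ≠ 0 := sub_ne_zero.2 (c.factor hzc hzz).2.1
    simp only [Pi.div_apply, Function.comp]
    rw [← mul_div_assoc, div_eq_div_iff hz0 hsQ0]
    refine mul_left_cancel₀ (mul_ne_zero hsQ0 hPQ) ?_
    rw [hq] at hsQ
    linear_combination (-ε * 2 * (3 * ψR z ^ 4 + 1) ^ (1 / ((2 : ℕ) : ℂ)) * (ψP z - ψQ z)) * hsQ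
      - ((3 * ψQ z ^ 2 - 1) * (ψQ z - ψR z) * (ψP z - ψQ z)) * hrel
  have hclose := hρ.eventually (Metric.closedBall_mem_nhds _ (show (0 : ℝ) < 1 / 2 by norm_num))
  have hbd : ∀ᶠ t in 𝓝[>] (0 : ℝ), ‖(s (b t) / σ t)⁻¹ - -ε * Complex.I‖ ≤ 1 / 2 := by
    filter_upwards [c.arcP.tendsto_source.eventually (eventually_nhds_nhdsWithin.2 hclose),
      Ioo_mem_nhdsGT (zero_lt_one' ℝ)] with t ht htI
    have B := hB t htI
    have hb0 : s (b t) ≠ 0 := fun h0 => B.quartic_b (by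
      rw [← hs.sq _ B.not_mem_b, h0, zero_pow two_ne_zero])
    have hlim := B.sqrt_plus.div
      ((hs.analytic _ B.not_mem_b).continuousAt.tendsto.comp B.Q_plus) hb0
    have := Metric.isClosed_closedBall.mem_of_tendsto hlim ((c.arcP.sides_le htI).1 ht)
    rw [inv_div, ← dist_eq_norm]
    exact this
  have hlim := ((hturn.inv₀ Complex.I_ne_zero).sub_const (-ε * Complex.I)).norm
  have hle := le_of_tendsto hlim hbd
  rcases hε with rfl | rfl
  · rw [hinf, mul_one]
  · rw [Complex.inv_I, show -Complex.I - -(-1) * Complex.I = -(2 * Complex.I) by ring, norm_neg,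
      norm_mul, Complex.norm_I] at hle
    norm_num at hle

theorem sqrt_one (c : Config γP γR ψP ψQ ψR) (hs : IsSqrtBranch γP γR ψP ψR s) : s 1 = 2 := by
  have := c.neg.sqrt_neg_one (c.sqrt_neg hs)
  rwa [neg_neg] at this

end Config

/-! ### The entries of the matrix -/

/-- The formula for `G̃` on the image of the sheet `P`. -/
def GP (w : ℂ) : ℂ := (1 / w) * Complex.exp ((w + 1) * (2 * w - 1) / (w * (w - 1)))

/-- The formula for `G̃` on the image of the sheet `Q`. -/
def GQ (w : ℂ) : ℂ := ((w ^ 2 - 1) / (w ^ 2 - 1 / 3)) * Complex.exp (2 * w ^ 2 / (w ^ 2 - 1))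

/-- The formula for `G̃` on the image of the sheet `R`. -/
def GR (w : ℂ) : ℂ := (1 / w) * Complex.exp ((w - 1) * (2 * w + 1) / (w * (w + 1)))

/-- The column `(F̃₁, F̃₂, F̃₃)` in terms of the values `w`, `g = G̃(w)` and `r = √(3w⁴+1)`. -/
def column (w g r : ℂ) : Fin 3 → ℂ :=
  ![-w * (w - 1) * g / r, (w ^ 2 - 1) * g / (3 * r), w * (w + 1) * g / r]

theorem Ft_eq (s G : ℂ → ℂ) (w : ℂ) : Ft s G w = column w (G w) (s w) := rfl

theorem tendsto_column {X : Type*} {F : Filter X} {f g r : X → ℂ} {w₀ g₀ r₀ : ℂ}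
    (hf : Tendsto f F (𝓝 w₀)) (hg : Tendsto g F (𝓝 g₀)) (hr : Tendsto r F (𝓝 r₀)) (h0 : r₀ ≠ 0)
    (i : Fin 3) : Tendsto (fun x => column (f x) (g x) (r x) i) F (𝓝 (column w₀ g₀ r₀ i)) := by
  fin_cases i
  · exact ((hf.neg.mul (hf.sub_const 1)).mul hg).div hr h0
  · exact ((((hf.pow 2).sub_const 1)).mul hg).div (hr.const_mul 3) (mul_ne_zero three_ne_zero h0)
  · exact ((hf.mul (hf.add_const 1)).mul hg).div hr h0

theorem column_mul (w g r k : ℂ) (i : Fin 3) : column w (k * g) r i = k * column w g r i := by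
  fin_cases i <;> simp [column] <;> ring

theorem column_neg (w g r : ℂ) (i : Fin 3) : column w g (-r) i = -column w g r i := by
  fin_cases i <;> simp [column, div_neg]

theorem analyticAt_Ft {s G : ℂ → ℂ} {w : ℂ} (hs : AnalyticAt ℂ s w) (h0 : s w ≠ 0)
    (hG : AnalyticAt ℂ G w) (i : Fin 3) : AnalyticAt ℂ (fun w => Ft s G w i) w := by
  have hid : AnalyticAt ℂ (fun w : ℂ => w) w := analyticAt_id
  fin_cases i
  · exact ((hid.neg.mul (hid.sub analyticAt_const)).mul hG).div hs h0
  · exact (((hid.pow 2).sub analyticAt_const).mul hG).div (analyticAt_const.mul hs)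
      (mul_ne_zero three_ne_zero h0)
  · exact ((hid.mul (hid.add analyticAt_const)).mul hG).div hs h0

theorem analyticAt_GP {w : ℂ} (h0 : w ≠ 0) (h1 : w - 1 ≠ 0) : AnalyticAt ℂ GP w := by
  have : w * (w - 1) ≠ 0 := mul_ne_zero h0 h1
  unfold GP
  fun_prop (disch := assumption)

theorem analyticAt_GR {w : ℂ} (h0 : w ≠ 0) (h1 : w + 1 ≠ 0) : AnalyticAt ℂ GR w := by
  have : w * (w + 1) ≠ 0 := mul_ne_zero h0 h1
  unfold GR
  fun_prop (disch := assumption)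

theorem analyticAt_GQ {w : ℂ} (h0 : w ^ 2 - 1 / 3 ≠ 0) (h1 : w ^ 2 - 1 ≠ 0) :
    AnalyticAt ℂ GQ w := by
  unfold GQ
  fun_prop (disch := assumption)

theorem sq_sub_ne_zero_of_cubic {z w : ℂ} (hz : z ≠ 0) (h : cubic z w = 0) :
    w ^ 2 - 1 / 3 ≠ 0 ∧ w ^ 2 - 1 ≠ 0 := by
  obtain ⟨h0, h1, h2⟩ := ne_of_cubic_eq_zero h
  have h3 : w ^ 2 - 1 ≠ 0 := by
    rw [show w ^ 2 - 1 = (w - 1) * (w + 1) by ring]; exact mul_ne_zero h1 h2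
  refine ⟨fun h4 => ?_, h3⟩
  have : z * (w * (w ^ 2 - 1)) = 0 := by
    simp only [cubic] at h
    linear_combination h + h4
  exact mul_ne_zero hz (mul_ne_zero h0 h3) this

/-- The functions on the sheets `P` and `Q` differ by the factor `z e^{3z}`. -/
theorem GP_eq {z w : ℂ} (hz : z ≠ 0) (h : cubic z w = 0) :
    GP w = z * Complex.exp (3 * z) * GQ w := by
  obtain ⟨h0, h1, h2⟩ := ne_of_cubic_eq_zero h
  obtain ⟨h3, h4⟩ := sq_sub_ne_zero_of_cubic hz h
  have hz' : z = (w ^ 2 - 1 / 3) / (w * (w ^ 2 - 1)) := by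
    rw [eq_div_iff (mul_ne_zero h0 h4)]
    simp only [cubic] at h
    linear_combination h
  have hexp : (w + 1) * (2 * w - 1) / (w * (w - 1)) = 3 * z + 2 * w ^ 2 / (w ^ 2 - 1) := by
    rw [hz', show w ^ 2 - 1 = (w - 1) * (w + 1) by ring]
    field_simp
    ring
  have hpre : 1 / w = z * ((w ^ 2 - 1) / (w ^ 2 - 1 / 3)) := by
    rw [hz']
    generalize w ^ 2 - 1 / 3 = x at h3
    field_simp
  rw [GP, GQ, hexp, Complex.exp_add, hpre]
  ring

/-- The functions on the sheets `R` and `Q` differ by the factor `z e^{-3z}`. -/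
theorem GR_eq {z w : ℂ} (hz : z ≠ 0) (h : cubic z w = 0) :
    GR w = z * Complex.exp (-3 * z) * GQ w := by
  have h1 := GP_eq (neg_ne_zero.2 hz) ((cubic_neg z w).trans h)
  have h2 : GP (-w) = -GR w := by
    have e1 : (-w + 1) * (2 * -w - 1) / (-w * (-w - 1)) =
        (w - 1) * (2 * w + 1) / (w * (w + 1)) := by
      congr 1 <;> ring
    rw [GP, GR, e1, one_div, one_div, inv_neg]
    ring
  have h3 : GQ (-w) = GQ w := by simp only [GQ, neg_sq]
  rw [h2, h3, show (3 : ℂ) * -z = -3 * z by ring] at h1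
  linear_combination -h1

/-! ### Boundary values on either arc -/

/-- The boundary values at `γ t` of two sheets `f`, `g` glued along `γ`, of the remaining sheet
`h`, and of the square root, which changes sign across its slit through `a`. -/
structure Crossing (γ : ℝ → ℂ) (f g h s : ℂ → ℂ) (t : ℝ) (a b σ : ℂ) : Prop where
  f_plus : Tendsto f (plusSide γ t) (𝓝 a)
  g_minus : Tendsto g (minusSide γ t) (𝓝 a)
  g_plus : Tendsto g (plusSide γ t) (𝓝 b)
  f_minus : Tendsto f (minusSide γ t) (𝓝 b)
  cont : ContinuousAt h (γ t)
  cubic_a : cubic (γ t) a = 0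
  cubic_b : cubic (γ t) b = 0
  cubic_h : cubic (γ t) (h (γ t)) = 0
  sqrt_plus : Tendsto (fun z => s (f z)) (plusSide γ t) (𝓝 σ)
  sqrt_minus : Tendsto (fun z => s (g z)) (minusSide γ t) (𝓝 (-σ))
  ne_zero : σ ≠ 0
  sqrt_b : ContinuousAt s b
  sqrt_b_ne : s b ≠ 0
  sqrt_h : ContinuousAt s (h (γ t))
  sqrt_h_ne : s (h (γ t)) ≠ 0

/-- The symmetry `z ↦ -z`, `w ↦ -w` transports the boundary values from one arc to the other. -/
theorem Crossing.neg {γ : ℝ → ℂ} {f g h s : ℂ → ℂ} {t : ℝ} {a b σ : ℂ}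
    (C : Crossing (fun t => -γ t) (fun z => -f (-z)) (fun z => -g (-z)) (fun z => -h (-z))
      (fun w => s (-w)) t a b σ) : Crossing γ f g h s t (-a) (-b) σ := by
  obtain ⟨h1, h2, h3, h4, h5, h6, h7, h8, h9, h10, h11, h12, h13, h14, h15⟩ := C
  simp only [plusSide_neg, minusSide_neg, tendsto_map'_iff, Function.comp_def, neg_neg] at *
  have hc : ContinuousAt h (γ t) := by
    have e : h = fun z => -(-h (- -z)) := by simp
    rw [e]
    refine (ContinuousAt.comp (f := fun z : ℂ => -z) (g := fun z => -h (-z)) h5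
      continuousAt_neg).neg
  have hs : ∀ {w : ℂ}, ContinuousAt (fun w => s (-w)) w → ContinuousAt s (-w) := fun {w} hw => by
    have e : s = (fun w => s (-w)) ∘ fun w => -w := by funext w; simp
    rw [e]
    refine ContinuousAt.comp ?_ continuousAt_neg
    rwa [neg_neg]
  refine ⟨by simpa using h1.neg, by simpa using h2.neg, by simpa using h3.neg,
    by simpa using h4.neg, hc, ?_, ?_, ?_, h9, h10, h11, hs h12, h13, ?_, h15⟩
  · rw [← cubic_neg, neg_neg]; exact h6
  · rw [← cubic_neg, neg_neg]; exact h7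
  · rw [← cubic_neg]; exact h8
  · simpa using hs h14

namespace Config

variable {γP γR : ℝ → ℂ} {ψP ψQ ψR s : ℂ → ℂ}

theorem crossing_P (c : Config γP γR ψP ψQ ψR) (hs : IsSqrtBranch γP γR ψP ψR s) {t : ℝ}
    (ht : t ∈ Set.Ioo (0 : ℝ) 1) : ∃ a b σ, Crossing γP ψP ψQ ψR s t a b σ := by
  obtain ⟨a, b, σ, hB, -⟩ := c.exists_boundaryValues_neg hs
  have B := hB t ht
  have hne : ∀ {w r : ℂ}, r ^ 2 = 3 * w ^ 4 + 1 → 3 * w ^ 4 + 1 ≠ 0 → r ≠ 0 := by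
    rintro w r h1 h2 rfl
    exact h2 (by rw [← h1, zero_pow two_ne_zero])
  exact ⟨a t, b t, σ t, B.P_plus, B.Q_minus, B.Q_plus, B.P_minus,
    (c.sheets.analyticR _ (c.P_not_mem_R (Set.Ioo_subset_Icc_self ht))).continuousAt,
    by rw [B.factor]; simp, by rw [B.factor]; simp, by rw [B.factor]; simp,
    B.sqrt_plus, B.sqrt_minus, hne B.sq_plus B.quartic_a,
    (hs.analytic _ B.not_mem_b).continuousAt, hne (hs.sq _ B.not_mem_b) B.quartic_b,
    (hs.analytic _ B.not_mem_R).continuousAt, hne (hs.sq _ B.not_mem_R) B.quartic_R⟩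

theorem crossing_R (c : Config γP γR ψP ψQ ψR) (hs : IsSqrtBranch γP γR ψP ψR s) {t : ℝ}
    (ht : t ∈ Set.Ioo (0 : ℝ) 1) : ∃ a b σ, Crossing γR ψR ψQ ψP s t a b σ := by
  obtain ⟨a, b, σ, C⟩ := c.neg.crossing_P (c.sqrt_neg hs) ht
  exact ⟨-a, -b, σ, C.neg⟩

end Config

/-- The two columns belonging to the glued sheets are exchanged across the arc, up to the
factors `-k` and `k⁻¹`. -/
theorem Crossing.columns {γ : ℝ → ℂ} {f g h s Gf Gg : ℂ → ℂ} {t : ℝ} {a b σ k : ℂ}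
    (C : Crossing γ f g h s t a b σ) (hk : k ≠ 0)
    (hf : ∀ w, cubic (γ t) w = 0 → ContinuousAt Gf w ∧ ContinuousAt Gg w ∧ Gf w = k * Gg w)
    (i : Fin 3) :
    Tendsto (fun z => Ft s Gf (f z) i) (plusSide γ t) (𝓝 (column a (Gg a) (-σ) i * -k)) ∧
    Tendsto (fun z => Ft s Gg (g z) i) (minusSide γ t) (𝓝 (column a (Gg a) (-σ) i)) ∧
    Tendsto (fun z => Ft s Gg (g z) i) (plusSide γ t) (𝓝 (column b (Gf b) (s b) i * k⁻¹)) ∧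
    Tendsto (fun z => Ft s Gf (f z) i) (minusSide γ t) (𝓝 (column b (Gf b) (s b) i)) := by
  obtain ⟨ha1, ha2, ha3⟩ := hf a C.cubic_a
  obtain ⟨hb1, hb2, hb3⟩ := hf b C.cubic_b
  refine ⟨?_, ?_, ?_, ?_⟩
  · have := tendsto_column C.f_plus (ha1.tendsto.comp C.f_plus) C.sqrt_plus C.ne_zero i
    have e : column a (Gg a) (-σ) i * -k = column a (Gf a) σ i := by
      rw [ha3, column_neg, column_mul]; ring
    rw [e]
    exact this
  · exact tendsto_column C.g_minus (ha2.tendsto.comp C.g_minus) C.sqrt_minus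
      (neg_ne_zero.2 C.ne_zero) i
  · have := tendsto_column C.g_plus (hb2.tendsto.comp C.g_plus)
      (C.sqrt_b.tendsto.comp C.g_plus) C.sqrt_b_ne i
    have e : column b (Gf b) (s b) i * k⁻¹ = column b (Gg b) (s b) i := by
      rw [hb3, column_mul, mul_comm k, mul_assoc, mul_inv_cancel₀ hk, mul_one]
    rw [e]
    exact this
  · exact tendsto_column C.f_minus (hb1.tendsto.comp C.f_minus)
      (C.sqrt_b.tendsto.comp C.f_minus) C.sqrt_b_ne i

/-! ### Behaviour at infinity and at the origin -/

theorem isBigO_comp_sub {F ψ : ℂ → ℂ} {w₀ : ℂ} (hF : DifferentiableAt ℂ F w₀)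
    (hψ : Tendsto ψ (Bornology.cobounded ℂ) (𝓝 w₀))
    (hO : (fun z => ψ z - w₀) =O[Bornology.cobounded ℂ] fun z => z⁻¹) :
    (fun z => F (ψ z) - F w₀) =O[Bornology.cobounded ℂ] fun z => z⁻¹ :=
  (hF.isBigO_sub.comp_tendsto hψ).trans hO

/-- A branch of the inverse of `z(w)` tending to a pole `w₀` of `z(w)` differs from `w₀` by
`O(1/z)`. -/
theorem isBigO_sub_pole {ψ : ℂ → ℂ} {w₀ : ℂ} (hw₀ : w₀ = 0 ∨ w₀ = 1 ∨ w₀ = -1)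
    (hψ : Tendsto ψ (Bornology.cobounded ℂ) (𝓝 w₀))
    (hroot : ∀ᶠ z in Bornology.cobounded ℂ, cubic z (ψ z) = 0) :
    (fun z => ψ z - w₀) =O[Bornology.cobounded ℂ] fun z => z⁻¹ := by
  -- the cofactor of `w - w₀` in `w³ - w`
  obtain ⟨q, hqc, hq0, hq⟩ : ∃ q : ℂ → ℂ, Continuous q ∧ q w₀ ≠ 0 ∧
      ∀ w, w ^ 3 - w = (w - w₀) * q w := by
    rcases hw₀ with rfl | rfl | rfl
    · exact ⟨fun w => w ^ 2 - 1, by fun_prop, by norm_num, fun w => by ring⟩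
    · exact ⟨fun w => w * (w + 1), by fun_prop, by norm_num, fun w => by ring⟩
    · exact ⟨fun w => w * (w - 1), by fun_prop, by norm_num, fun w => by ring⟩
  have hqψ : Tendsto (fun z => q (ψ z)) (Bornology.cobounded ℂ) (𝓝 (q w₀)) :=
    (hqc.tendsto w₀).comp hψ
  have h1 : (fun z => (ψ z ^ 2 - 1 / 3) / q (ψ z)) =O[Bornology.cobounded ℂ] fun _ => (1 : ℂ) :=
    (((hψ.pow 2).sub_const (1 / 3)).div hqψ hq0).isBigO_one ℂ
  have h2 := (isBigO_refl (fun z : ℂ => z⁻¹) (Bornology.cobounded ℂ)).mul h1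
  simp only [mul_one] at h2
  refine h2.congr' ?_ EventuallyEq.rfl
  filter_upwards [hroot, hqψ.eventually_ne hq0,
    tendsto_norm_cobounded_atTop.eventually (eventually_gt_atTop 0)] with z hz hqz hz0
  have hz0 : z ≠ 0 := norm_pos_iff.1 hz0
  have h3 := hq (ψ z)
  simp only [cubic] at hz
  rw [inv_mul_eq_div, div_div, div_eq_iff (mul_ne_zero hqz hz0)]
  linear_combination z * h3 - hz

/-- The entries on the sheet `Q` have limits at the image `w = ∞` of `z = 0`. -/
theorem exists_tendsto_Ft_cobounded {s : ℂ → ℂ} {r : ℂ} (hr : r ≠ 0)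
    (hs : Tendsto (fun w => s w / w ^ 2) (Bornology.cobounded ℂ) (𝓝 r)) :
    ∃ L : Fin 3 → ℂ, ∀ i, Tendsto (fun w => Ft s GQ w i) (Bornology.cobounded ℂ) (𝓝 (L i)) := by
  have hne : ∀ᶠ w : ℂ in Bornology.cobounded ℂ, w ≠ 0 := by
    filter_upwards [tendsto_norm_cobounded_atTop.eventually (eventually_gt_atTop 0)] with w hw
    exact norm_pos_iff.1 hw
  have hu : Tendsto (fun w : ℂ => w⁻¹) (Bornology.cobounded ℂ) (𝓝 0) := tendsto_inv₀_cobounded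
  have hG : Tendsto GQ (Bornology.cobounded ℂ)
      (𝓝 ((1 - 0 ^ 2) / (1 - 1 / 3 * 0 ^ 2) * Complex.exp (2 / (1 - 0 ^ 2)))) := by
    have hexp : Tendsto (fun w : ℂ => Complex.exp (2 / (1 - w⁻¹ ^ 2))) (Bornology.cobounded ℂ)
        (𝓝 (Complex.exp (2 / (1 - 0 ^ 2)))) :=
      (Complex.continuous_exp.tendsto _).comp
        (tendsto_const_nhds.div ((hu.pow 2).const_sub 1) (by norm_num))
    refine ((((hu.pow 2).const_sub 1).div (((hu.pow 2).const_mul (1 / 3)).const_sub 1)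
      (by norm_num)).mul hexp).congr' ?_
    filter_upwards [hne] with w hw
    have e1 : w ^ 2 - 1 = w ^ 2 * (1 - w⁻¹ ^ 2) := by field_simp
    have e2 : w ^ 2 - 1 / 3 = w ^ 2 * (1 - 1 / 3 * w⁻¹ ^ 2) := by field_simp
    simp only [Pi.div_apply]
    rw [GQ, e1, e2, mul_div_mul_left _ _ (pow_ne_zero 2 hw), mul_comm (2 : ℂ) (w ^ 2),
      mul_div_mul_left _ _ (pow_ne_zero 2 hw)]
  have hex : ∀ i, ∃ l, Tendsto (fun w => Ft s GQ w i) (Bornology.cobounded ℂ) (𝓝 l) := by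
    intro i
    fin_cases i
    · refine ⟨_, (((hu.const_sub 1).neg.mul hG).div hs hr).congr' ?_⟩
      filter_upwards [hne] with w hw
      show -(1 - w⁻¹) * GQ w / (s w / w ^ 2) = -w * (w - 1) * GQ w / s w
      rw [div_div_eq_mul_div]
      congr 1
      field_simp
    · refine ⟨_, ((((hu.pow 2).const_sub 1).mul hG).div (hs.const_mul 3)
        (mul_ne_zero three_ne_zero hr)).congr' ?_⟩
      filter_upwards [hne] with w hw
      show (1 - w⁻¹ ^ 2) * GQ w / (3 * (s w / w ^ 2)) = (w ^ 2 - 1) * GQ w / (3 * s w)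
      rw [← mul_div_assoc, div_div_eq_mul_div]
      congr 1
      field_simp
    · refine ⟨_, (((hu.const_add 1).mul hG).div hs hr).congr' ?_⟩
      filter_upwards [hne] with w hw
      show (1 + w⁻¹) * GQ w / (s w / w ^ 2) = w * (w + 1) * GQ w / s w
      rw [div_div_eq_mul_div]
      congr 1
      field_simp
  choose L hL using hex
  exact ⟨L, hL⟩

/-! ### The solution of the Riemann-Hilbert problem -/

open Classical in
/-- The matrix `Ñ`, with the explicit formulas for `G̃` on the three sheets; `L` is the second
column at `z = 0`, where `ψQ` has a pole and its Lean value is irrelevant. -/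
def outerN (ψP ψQ ψR s : ℂ → ℂ) (L : Fin 3 → ℂ) (z : ℂ) : Matrix (Fin 3) (Fin 3) ℂ :=
  Matrix.of fun i => ![Ft s GP (ψP z) i, if z = 0 then L i else Ft s GQ (ψQ z) i,
    Ft s GR (ψR z) i]

section entries

variable (ψP ψQ ψR s : ℂ → ℂ) (L : Fin 3 → ℂ)

theorem outerN_zero (z : ℂ) (i : Fin 3) : outerN ψP ψQ ψR s L z i 0 = Ft s GP (ψP z) i := rfl

theorem outerN_one {z : ℂ} (hz : z ≠ 0) (i : Fin 3) :
    outerN ψP ψQ ψR s L z i 1 = Ft s GQ (ψQ z) i := if_neg hz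

theorem outerN_two (z : ℂ) (i : Fin 3) : outerN ψP ψQ ψR s L z i 2 = Ft s GR (ψR z) i := rfl

end entries

theorem tendsto_matrix {X : Type*} {F : Filter X} {N : X → Matrix (Fin 3) (Fin 3) ℂ}
    {A : Matrix (Fin 3) (Fin 3) ℂ} (h : ∀ i, Tendsto (fun x => N x i 0) F (𝓝 (A i 0)) ∧
      Tendsto (fun x => N x i 1) F (𝓝 (A i 1)) ∧ Tendsto (fun x => N x i 2) F (𝓝 (A i 2))) :
    Tendsto N F (𝓝 A) := by
  refine tendsto_pi_nhds.2 fun i => tendsto_pi_nhds.2 fun j => ?_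
  fin_cases j
  exacts [(h i).1, (h i).2.1, (h i).2.2]

namespace Config

variable {γP γR : ℝ → ℂ} {ψP ψQ ψR s : ℂ → ℂ}

/-- The piecewise function `G̃` is given by the expected formula on each sheet, because distinct
sheets have disjoint images. -/
theorem Gt_eq (c : Config γP γR ψP ψQ ψR) {z : ℂ} (hz : z ∉ cuts γP γR) (hz0 : z ≠ 0) :
    Gt γP γR ψP ψQ ψR (ψP z) = GP (ψP z) ∧ Gt γP γR ψP ψQ ψR (ψQ z) = GQ (ψQ z) ∧
      Gt γP γR ψP ψQ ψR (ψR z) = GR (ψR z) := by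
  obtain ⟨-, hPQ, hPR, hQR⟩ := c.factor hz hz0
  have hzP : z ∉ trace γP := fun h => hz (Or.inl h)
  have hzR : z ∉ trace γR := fun h => hz (Or.inr h)
  have hcQ := c.cubic_Q hz hz0
  have hcR := c.cubic_R hzR
  have hP : ψP z ∈ imageP γP ψP := Or.inl ⟨z, hzP, rfl⟩
  have hQ : ψQ z ∈ imageQ γP γR ψQ := by
    refine Or.inl ⟨z, ?_, rfl⟩
    rintro (h | h)
    exacts [hz h, hz0 h]
  have hR : ψR z ∈ imageR γR ψR := Or.inl ⟨z, hzR, rfl⟩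
  have hnP : ∀ w, cubic z w = 0 → ψP z ≠ w → w ∉ imageP γP ψP := by
    rintro w hw hne (⟨y, hy, rfl⟩ | h)
    · rw [eq_of_cubic_eq_zero hw (c.cubic_P hy)] at hne
      exact hne rfl
    · exact (ne_of_cubic_eq_zero hw).2.2 (by rw [Set.mem_singleton_iff.1 h]; ring)
  have hnQ : ∀ w, cubic z w = 0 → ψQ z ≠ w → w ∉ imageQ γP γR ψQ := by
    rintro w hw hne (⟨y, hy, rfl⟩ | h)
    · rw [eq_of_cubic_eq_zero hw (c.cubic_Q (fun h => hy (Or.inl h)) fun h => hy (Or.inr h))] at hne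
      exact hne rfl
    · exact (ne_of_cubic_eq_zero hw).1 (Set.mem_singleton_iff.1 h)
  refine ⟨?_, ?_, ?_⟩
  · rw [Gt, if_pos hP, GP]
  · rw [Gt, if_neg (hnP _ hcQ hPQ), if_pos hQ, GQ]
  · rw [Gt, if_neg (hnP _ hcR hPR), if_neg (hnQ _ hcR hQR), if_pos hR, GR]

/-- The pole of `ψQ` at the origin. -/
theorem tendsto_Q_zero (c : Config γP γR ψP ψQ ψR) :
    Tendsto ψQ (𝓝[≠] 0) (Bornology.cobounded ℂ) := by
  have h0 := c.not_mem_cuts_of_re_eq_zero Complex.zero_re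
  have hP := (c.sheets.analyticP 0 fun h => h0 (Or.inl h)).continuousAt
  have hR := (c.sheets.analyticR 0 fun h => h0 (Or.inr h)).continuousAt
  have h1 : Tendsto (fun z => ‖1 - z * (ψP z + ψR z)‖) (𝓝[≠] 0) (𝓝 1) := by
    have : ContinuousAt (fun z => ‖1 - z * (ψP z + ψR z)‖) 0 :=
      (continuousAt_const.sub (continuousAt_id.mul (hP.add hR))).norm
    have h2 := this.tendsto.mono_left (nhdsWithin_le_nhds (s := {0}ᶜ))
    simpa using h2
  have h2 : Tendsto (fun z : ℂ => ‖z⁻¹‖) (𝓝[≠] 0) atTop :=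
    tendsto_norm_cobounded_atTop.comp tendsto_inv₀_nhdsNE_zero
  refine tendsto_norm_atTop_iff_cobounded.1 ((h1.pos_mul_atTop one_pos h2).congr' ?_)
  filter_upwards [self_mem_nhdsWithin,
    nhdsWithin_le_nhds (c.isClosed_cuts.isOpen_compl.mem_nhds h0)] with z hz hzc
  have := c.mul_sum hzc hz
  rw [← norm_mul]
  congr 1
  have hz' : z ≠ 0 := hz
  field_simp
  linear_combination -this

theorem analyticAt_outerN (c : Config γP γR ψP ψQ ψR) (hs : IsSqrtBranch γP γR ψP ψR s)
    {L : Fin 3 → ℂ} (hL : ∀ i, Tendsto (fun w => Ft s GQ w i) (Bornology.cobounded ℂ) (𝓝 (L i)))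
    {z : ℂ} (hz : z ∉ cuts γP γR) (i j : Fin 3) :
    AnalyticAt ℂ (fun z => outerN ψP ψQ ψR s L z i j) z := by
  have key : ∀ {y w : ℂ}, y ∉ cuts γP γR → cubic y w = 0 → AnalyticAt ℂ s w ∧ s w ≠ 0 :=
    fun hy h => ⟨hs.analytic _ (c.not_mem_slits hy h), c.sqrt_ne_zero hs hy h⟩
  have hQ : ∀ y : ℂ, y ∉ cuts γP γR → y ≠ 0 →
      AnalyticAt ℂ (fun z => outerN ψP ψQ ψR s L z i 1) y := by
    intro y hy hy0
    have hc := c.cubic_Q hy hy0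
    obtain ⟨h1, h2⟩ := sq_sub_ne_zero_of_cubic hy0 hc
    have hyD : y ∈ (cuts γP γR ∪ {0})ᶜ := by
      rintro (h | h)
      exacts [hy h, hy0 h]
    have := (analyticAt_Ft (key hy hc).1 (key hy hc).2 (analyticAt_GQ h1 h2) i).fun_comp
      (c.sheets.analyticQ y hyD)
    refine this.congr ?_
    filter_upwards [isOpen_compl_singleton.mem_nhds hy0] with x hx
    exact (outerN_one ψP ψQ ψR s L hx i).symm
  fin_cases j
  · have hzP : z ∉ trace γP := fun h => hz (Or.inl h)
    have hc := c.cubic_P hzP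
    obtain ⟨h0, h1, -⟩ := ne_of_cubic_eq_zero hc
    exact (analyticAt_Ft (key hz hc).1 (key hz hc).2 (analyticAt_GP h0 h1) i).fun_comp
      (c.sheets.analyticP z hzP)
  · by_cases hz0 : z = 0
    · -- the second column has a removable singularity at the origin
      subst hz0
      refine Complex.analyticAt_of_differentiable_on_punctured_nhds_of_continuousAt ?_ ?_
      · filter_upwards [self_mem_nhdsWithin,
          nhdsWithin_le_nhds (c.isClosed_cuts.isOpen_compl.mem_nhds hz)] with y hy hyc
        exact (hQ y hyc hy).differentiableAt
      · refine continuousAt_iff_punctured_nhds.2 ?_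
        have h1 := (hL i).comp c.tendsto_Q_zero
        have h2 : outerN ψP ψQ ψR s L 0 i 1 = L i := if_pos rfl
        show Tendsto _ _ (𝓝 (outerN ψP ψQ ψR s L 0 i 1))
        rw [h2]
        refine h1.congr' ?_
        filter_upwards [self_mem_nhdsWithin] with y hy
        exact (outerN_one ψP ψQ ψR s L hy i).symm
    · exact hQ z hz hz0
  · have hzR : z ∉ trace γR := fun h => hz (Or.inr h)
    have hc := c.cubic_R hzR
    obtain ⟨h0, -, h1⟩ := ne_of_cubic_eq_zero hc
    exact (analyticAt_Ft (key hz hc).1 (key hz hc).2 (analyticAt_GR h0 h1) i).fun_comp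
      (c.sheets.analyticR z hzR)

theorem continuousAt_G {z w : ℂ} (hz : z ≠ 0) (h : cubic z w = 0) :
    ContinuousAt GP w ∧ ContinuousAt GQ w ∧ ContinuousAt GR w := by
  obtain ⟨h0, h1, h2⟩ := ne_of_cubic_eq_zero h
  obtain ⟨h3, h4⟩ := sq_sub_ne_zero_of_cubic hz h
  exact ⟨(analyticAt_GP h0 h1).continuousAt, (analyticAt_GQ h3 h4).continuousAt,
    (analyticAt_GR h0 h2).continuousAt⟩

theorem hasJump_P (c : Config γP γR ψP ψQ ψR) (hs : IsSqrtBranch γP γR ψP ψR s) (L : Fin 3 → ℂ) :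
    HasJump γP jumpP (outerN ψP ψQ ψR s L) := by
  intro t ht
  obtain ⟨a, b, σ, C⟩ := c.crossing_P hs ht
  have hz0 := c.arcP_ne_zero (Set.Ioo_subset_Icc_self ht)
  have hp := c.arcP.plusSide_le ht
  have hm := c.arcP.minusSide_le ht
  set z := γP t with hz
  set k := z * Complex.exp (3 * z) with hk
  have hk0 : k ≠ 0 := mul_ne_zero hz0 (Complex.exp_ne_zero _)
  have hkinv : k⁻¹ = z⁻¹ * Complex.exp (-3 * z) := by
    rw [hk, mul_inv, ← Complex.exp_neg, neg_mul]
  have hcol := C.columns hk0 (Gf := GP) (Gg := GQ) fun w hw =>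
    ⟨(continuousAt_G hz0 hw).1, (continuousAt_G hz0 hw).2.1, GP_eq hz0 hw⟩
  have hR := fun i => tendsto_column C.cont.tendsto
    ((continuousAt_G hz0 C.cubic_h).2.2.tendsto.comp C.cont.tendsto)
    (C.sqrt_h.tendsto.comp C.cont.tendsto) C.sqrt_h_ne i
  have hne : ∀ᶠ y in 𝓝 z, y ≠ 0 := isOpen_compl_singleton.mem_nhds hz0
  refine ⟨Matrix.of fun i => ![column a (GQ a) (-σ) i * -k, column b (GP b) (s b) i * k⁻¹,
      column (ψR z) (GR (ψR z)) (s (ψR z)) i],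
    Matrix.of fun i => ![column b (GP b) (s b) i, column a (GQ a) (-σ) i,
      column (ψR z) (GR (ψR z)) (s (ψR z)) i],
    tendsto_matrix fun i => ⟨(hcol i).1, (hcol i).2.2.1.congr' ?_, (hR i).mono_left hp⟩,
    tendsto_matrix fun i => ⟨(hcol i).2.2.2, (hcol i).2.1.congr' ?_, (hR i).mono_left hm⟩, ?_⟩
  · filter_upwards [hp hne] with y hy using (outerN_one ψP ψQ ψR s L hy i).symm
  · filter_upwards [hm hne] with y hy using (outerN_one ψP ψQ ψR s L hy i).symm
  · ext i j
    rw [hkinv]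
    fin_cases j <;> simp [Matrix.mul_apply, Fin.sum_univ_three, jumpP, hk]

theorem hasJump_R (c : Config γP γR ψP ψQ ψR) (hs : IsSqrtBranch γP γR ψP ψR s) (L : Fin 3 → ℂ) :
    HasJump γR jumpR (outerN ψP ψQ ψR s L) := by
  intro t ht
  obtain ⟨a, b, σ, C⟩ := c.crossing_R hs ht
  have hz0 : γR t ≠ 0 := fun h => by
    have := c.rightR t (Set.Ioo_subset_Icc_self ht)
    rw [h, Complex.zero_re] at this
    exact lt_irrefl _ this
  have hp := c.arcR.plusSide_le ht
  have hm := c.arcR.minusSide_le ht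
  set z := γR t with hz
  set k := z * Complex.exp (-3 * z) with hk
  have hk0 : k ≠ 0 := mul_ne_zero hz0 (Complex.exp_ne_zero _)
  have hkinv : k⁻¹ = z⁻¹ * Complex.exp (3 * z) := by
    rw [hk, mul_inv, ← Complex.exp_neg, neg_mul, neg_neg]
  have hcol := C.columns hk0 (Gf := GR) (Gg := GQ) fun w hw =>
    ⟨(continuousAt_G hz0 hw).2.2, (continuousAt_G hz0 hw).2.1, GR_eq hz0 hw⟩
  have hP := fun i => tendsto_column C.cont.tendsto
    ((continuousAt_G hz0 C.cubic_h).1.tendsto.comp C.cont.tendsto)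
    (C.sqrt_h.tendsto.comp C.cont.tendsto) C.sqrt_h_ne i
  have hne : ∀ᶠ y in 𝓝 z, y ≠ 0 := isOpen_compl_singleton.mem_nhds hz0
  refine ⟨Matrix.of fun i => ![column (ψP z) (GP (ψP z)) (s (ψP z)) i,
      column b (GR b) (s b) i * k⁻¹, column a (GQ a) (-σ) i * -k],
    Matrix.of fun i => ![column (ψP z) (GP (ψP z)) (s (ψP z)) i,
      column a (GQ a) (-σ) i, column b (GR b) (s b) i],
    tendsto_matrix fun i => ⟨(hP i).mono_left hp, (hcol i).2.2.1.congr' ?_, (hcol i).1⟩,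
    tendsto_matrix fun i => ⟨(hP i).mono_left hm, (hcol i).2.1.congr' ?_, (hcol i).2.2.2⟩, ?_⟩
  · filter_upwards [hp hne] with y hy using (outerN_one ψP ψQ ψR s L hy i).symm
  · filter_upwards [hm hne] with y hy using (outerN_one ψP ψQ ψR s L hy i).symm
  · ext i j
    rw [hkinv]
    fin_cases j <;> simp [Matrix.mul_apply, Fin.sum_univ_three, jumpR, hk]

theorem isBigO_outerN (c : Config γP γR ψP ψQ ψR) (hs : IsSqrtBranch γP γR ψP ψR s)
    (L : Fin 3 → ℂ) (i j : Fin 3) :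
    (fun z => outerN ψP ψQ ψR s L z i j - (1 : Matrix (Fin 3) (Fin 3) ℂ) i j)
      =O[Bornology.cobounded ℂ] fun z => z⁻¹ := by
  have hs0 := c.sqrt_zero hs
  have hs1 := c.sqrt_one hs
  have hs2 := c.sqrt_neg_one hs
  have hcuts : ∀ᶠ z in Bornology.cobounded ℂ, z ∉ cuts γP γR := Bornology.isBounded_def.1
    (c.arcP.isCompact_trace.union c.arcR.isCompact_trace).isBounded
  have hne : ∀ᶠ z : ℂ in Bornology.cobounded ℂ, z ≠ 0 := by
    filter_upwards [tendsto_norm_cobounded_atTop.eventually (eventually_gt_atTop 0)] with z hz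
    exact norm_pos_iff.1 hz
  fin_cases j
  · have hO := isBigO_sub_pole (by simp) c.sheets.inftyP (by
      filter_upwards [hcuts] with z hz using c.cubic_P fun h => hz (Or.inl h))
    have hd := (analyticAt_Ft (hs.analytic _ (c.not_mem_slits_of_pole (w := -1) (by simp)))
      (by rw [hs2]; norm_num) (analyticAt_GP (by norm_num) (by norm_num)) i).differentiableAt
    have hv : Ft s GP (-1) i = (1 : Matrix (Fin 3) (Fin 3) ℂ) i 0 := by
      have : Ft s GP (-1) = ![1, 0, 0] := by
        norm_num [Ft, GP, hs2]
      rw [this]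
      clear hd
      revert i
      simp [Fin.forall_fin_succ, Matrix.one_apply]
    have := isBigO_comp_sub hd c.sheets.inftyP hO
    rw [hv] at this
    exact this
  · have hO := isBigO_sub_pole (by simp) c.sheets.inftyQ (by
      filter_upwards [hcuts, hne] with z hz hz0 using c.cubic_Q hz hz0)
    have hd := (analyticAt_Ft (hs.analytic _ (c.not_mem_slits_of_pole (w := 0) (by simp)))
      (by rw [hs0]; norm_num) (analyticAt_GQ (by norm_num) (by norm_num)) i).differentiableAt
    have hv : Ft s GQ 0 i = (1 : Matrix (Fin 3) (Fin 3) ℂ) i 1 := by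
      have : Ft s GQ 0 = ![0, 1, 0] := by
        norm_num [Ft, GQ, hs0]
      rw [this]
      clear hd
      revert i
      simp [Fin.forall_fin_succ, Matrix.one_apply]
    have := isBigO_comp_sub hd c.sheets.inftyQ hO
    rw [hv] at this
    refine this.congr' ?_ EventuallyEq.rfl
    filter_upwards [hne] with z hz
    exact congrArg (· - _) (outerN_one ψP ψQ ψR s L hz i).symm
  · have hO := isBigO_sub_pole (by simp) c.sheets.inftyR (by
      filter_upwards [hcuts] with z hz using c.cubic_R fun h => hz (Or.inr h))
    have hd := (analyticAt_Ft (hs.analytic _ (c.not_mem_slits_of_pole (w := 1) (by simp)))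
      (by rw [hs1]; norm_num) (analyticAt_GR (by norm_num) (by norm_num)) i).differentiableAt
    have hv : Ft s GR 1 i = (1 : Matrix (Fin 3) (Fin 3) ℂ) i 2 := by
      have : Ft s GR 1 = ![0, 0, 1] := by
        norm_num [Ft, GR, hs1]
      rw [this]
      clear hd
      revert i
      simp [Fin.forall_fin_succ, Matrix.one_apply]
    have := isBigO_comp_sub hd c.sheets.inftyR hO
    rw [hv] at this
    exact this

end Config

end HermitePadeRH

end

/-- `Γ_P`, `Γ_R` are the traces of the arcs `γP`, `γR`. The matrix `N` is given by the formula at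
every point off the cuts except `z = 0`, where `ψQ` has its pole and where the entries of the
second column are the limits `F̃ᵢ(∞)`; analyticity of `N` there is part of `SolvesRH`. -/
theorem proposition4p1 (γP γR : ℝ → ℂ)
    (hP : HermitePadeRH.IsArc γP (HermitePadeRH.branchZ 1) (HermitePadeRH.branchZ 2))
    (hP_left : ∀ t ∈ Set.Icc (0 : ℝ) 1, (γP t).re < 0)
    (hR : HermitePadeRH.IsArc γR (HermitePadeRH.branchZ 3) (HermitePadeRH.branchZ 4))
    (hR_right : ∀ t ∈ Set.Icc (0 : ℝ) 1, 0 < (γR t).re)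
    (ψP ψQ ψR : ℂ → ℂ) (hψ : HermitePadeRH.IsSheets γP γR ψP ψQ ψR)
    (s : ℂ → ℂ) (hs : HermitePadeRH.IsSqrtBranch γP γR ψP ψR s) :
    ∃ N : ℂ → Matrix (Fin 3) (Fin 3) ℂ,
      HermitePadeRH.SolvesRH γP γR N ∧
      ∀ z ∉ HermitePadeRH.trace γP ∪ HermitePadeRH.trace γR, z ≠ 0 → ∀ i : Fin 3,
        N z i 0 = HermitePadeRH.Ft s (HermitePadeRH.Gt γP γR ψP ψQ ψR) (ψP z) i ∧
        N z i 1 = HermitePadeRH.Ft s (HermitePadeRH.Gt γP γR ψP ψQ ψR) (ψQ z) i ∧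
        N z i 2 = HermitePadeRH.Ft s (HermitePadeRH.Gt γP γR ψP ψQ ψR) (ψR z) i := by
  have c : HermitePadeRH.Config γP γR ψP ψQ ψR := ⟨hP, hP_left, hR, hR_right, hψ⟩
  have h3 : (3 : ℂ) ^ (1 / ((2 : ℕ) : ℂ)) ≠ 0 := by
    rw [Ne, Complex.cpow_eq_zero_iff]
    norm_num
  obtain ⟨L, hL⟩ := HermitePadeRH.exists_tendsto_Ft_cobounded h3 (c.tendsto_sqrt_div_sq hs)
  refine ⟨HermitePadeRH.outerN ψP ψQ ψR s L,
    ⟨fun i j z hz => c.analyticAt_outerN hs hL hz i j, c.hasJump_P hs L, c.hasJump_R hs L,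
      c.isBigO_outerN hs L⟩, fun z hz hz0 i => ?_⟩
  obtain ⟨hGP, hGQ, hGR⟩ := c.Gt_eq hz hz0
  rw [HermitePadeRH.outerN_zero, HermitePadeRH.outerN_one _ _ _ _ _ hz0, HermitePadeRH.outerN_two]
  simp only [HermitePadeRH.Ft_eq, hGP, hGQ, hGR, and_self]
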